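/- Conventions. A strict partition is a sequence $\lambda=(\lambda_1>\dots>\lambda_l>0)$ of integers, with $l=l(\lambda)\ge 0$. Let $a=(a_0,a_1,\dots)$ be indeterminates and $(x|a)^r=\prod_{i=0}^{r-1}(x+a_i)$. For a partition $\lambda$ of length at most $n$, padded by zeros to $n$ entries, and an indeterminate $t$, put $$\mathcal P^C_\lambda(x_1,\dots,x_n|a;t)=\frac1{v^{(n)}_\lambda(t)}\sum_{w\in W_n}w\left(\prod_{i=1}^n(x_i|a)^{\lambda_i}\prod_{i=1}^n\frac{1-tx_i^{-2}}{1-x_i^{-2}}\prod_{1\le i<j\le n}\frac{1-tx_i^{-1}x_j}{1-x_i^{-1}x_j}\cdot\frac{1-tx_i^{-1}x_j^{-1}}{1-x_i^{-1}x_j^{-1}}\right),$$ where the hyperoctahedral group $W_n$ permutes and inverts the $x_i$, and $$v^{(n)}_\lambda(t)=\prod_{i=1}^{m_0}\frac{1-t^{2i}}{1-t}\ \prod_{r\ge1}\prod_{i=1}^{m_r}\frac{1-t^i}{1-t},$$ $m_r$ being the number of $i\le n$ with $\lambda_i=r$. For a strict partition $\lambda$ the factorial symplectic $Q$-function is $Q^C_\lambda(x_1,\dots,x_n|a)=2^{l(\lambda)}\,\mathcal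 P^C_\lambda(x_1,\dots,x_n|a;-1)$ if $l(\lambda)\le n$, and $0$ if $l(\lambda)>n$; the symplectic $Q$-function $Q^C_\lambda(x_1,\dots,x_n)$ is its value at $a=0$. Let $\Lambda$ be the ring of symmetric functions in infinitely many variables $X=\{x_1,x_2,\dots\}$ over $\mathbb Q$, let $\Lambda[a]$ be the same ring with coefficients in $\mathbb Q[a]=\mathbb Q[a_0,a_1,\dots]$, and let $\Gamma[a]=\mathbb Q[a][q_r:r\ge1]\subset\Lambda[a]$, where $\sum_{r\ge0}q_rz^r=\prod_i\frac{1+x_iz}{1-x_iz}$. For $n\ge0$ let $\tilde\pi_n$ be the ring homomorphism $f\mapsto f(x_1,\dots,x_n,x_1^{-1},\dots,x_n^{-1},0,0,\dots)$ on $\Lambda$, extended $\mathbb Q[a]$-linearly to $\Lambda[a]$. The universal symplectic $Q$-function $\mathsf Q^C_\mu(X)\in\Lambda$ is the symmetric function with $\tilde\pi_n(\mathsf Q^C_\mu(X))=Q^C_\mu(x_1,\dots,x_n)$ for all $n$. For a strict partition $\lambda$ define the universal factorial symplectic $Q$-function by $$\mathsf Q^C_\lambda(X|a)=\sum_\mu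 d_{\lambda,\mu}\,\mathsf Q^C_\mu(X),\qquad d_{\lambda,\mu}=\det\bigl(e_{\lambda_i-\mu_j}(a_0,\dots,a_{\lambda_i-1})\bigr)_{1\le i,j\le l(\lambda)},$$ where $\mu$ runs over all strict partitions with $\mu\subset\lambda$ and $l(\mu)=l(\lambda)$, $e_k$ is the $k$-th elementary symmetric polynomial, and $e_k=0$ for $k<0$. Proposition. The functions $\mathsf Q^C_\mu(X)$ exist and are unique, uniqueness holding already if $\tilde\pi_n$ is prescribed only for $n\ge l(\mu)$. Moreover: (1) For every strict partition $\lambda$ one has $\tilde\pi_n(\mathsf Q^C_\lambda(X|a))=Q^C_\lambda(x_1,\dots,x_n|a)$ for all $n\ge0$, and $\mathsf Q^C_\lambda(X|a)$ is the only element of $\Lambda[a]$ with this property, even if the equality is required only for $n\ge l(\lambda)$. (2) For every strict partition $\lambda$, $$\mathsf Q^C_\lambda(X|a)=\operatorname{Pf}\bigl(\mathsf Q^C_{(\lambda_i,\lambda_j)}(X|a)\bigr)_{1\le i,j\le m},$$ where $m=l(\lambda)$ or $l(\lambda)+1$ according as $l(\lambda)$ is even or odd. In the latter case $\lambda_m=0$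 and $\mathsf Q^C_{(r,0)}=\mathsf Q^C_{(r)}$. The matrix is skew-symmetric: $\mathsf Q^C_{(s,r)}=-\mathsf Q^C_{(r,s)}$, with zeros on the diagonal. (3) The functions $\mathsf Q^C_\lambda(X|a)$, $\lambda$ running over all strict partitions, form a basis of the $\mathbb Q[a]$-module $\Gamma[a]$ (in particular they lie in $\Gamma[a]$). -/

import Mathlib

noncomputable section

namespace SymplecticQ

/-- A strict partition `part 0 > part 1 > ... > part (len - 1) > 0`. -/
@[ext]
structure StrictPartition where
  len : ℕ
  part : Fin len → ℕ
  strictAnti : StrictAnti part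
  pos : ∀ i, 0 < part i

/-! ### Symmetric functions in infinitely many variables -/

/-- The ring of symmetric functions in the variables `x_0, x_1, ...` with coefficients in `R`:
the formal power series of bounded degree that are invariant under permutations of the
variables. -/
def SymFun (R : Type) [CommRing R] : Subalgebra R (MvPowerSeries ℕ R) where
  carrier := {f | (∃ d : ℕ, ∀ m : ℕ →₀ ℕ, d < m.degree → MvPowerSeries.coeff m f = 0) ∧
    ∀ s : Equiv.Perm ℕ, MvPowerSeries.rename s f = f}
  mul_mem' := by
    rintro f g ⟨⟨d, hd⟩, hf⟩ ⟨⟨e, he⟩, hg⟩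
    refine ⟨⟨d + e, fun m hm => ?_⟩, fun s => by rw [map_mul, hf, hg]⟩
    classical
    rw [MvPowerSeries.coeff_mul]
    refine Finset.sum_eq_zero fun p hp => ?_
    have h : p.1.degree + p.2.degree = m.degree := by
      rw [← (Finset.HasAntidiagonal.mem_antidiagonal.mp hp), map_add]
    by_cases h1 : d < p.1.degree
    · rw [hd _ h1, zero_mul]
    · rw [he _ (by omega), mul_zero]
  add_mem' := by
    rintro f g ⟨⟨d, hd⟩, hf⟩ ⟨⟨e, he⟩, hg⟩
    refine ⟨⟨d + e, fun m hm => ?_⟩, fun s => by rw [map_add, hf, hg]⟩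
    rw [map_add, hd _ (by omega), he _ (by omega), add_zero]
  algebraMap_mem' r := by
    refine ⟨⟨0, fun m hm => ?_⟩, fun s => AlgHom.commutes _ r⟩
    classical
    have hm0 : m ≠ 0 := by rintro rfl; simp at hm
    rw [MvPowerSeries.algebraMap_apply, MvPowerSeries.coeff_C, if_neg hm0]

theorem mem_SymFun {R : Type} [CommRing R] (f : MvPowerSeries ℕ R) :
    f ∈ SymFun R ↔ (∃ d : ℕ, ∀ m : ℕ →₀ ℕ, d < m.degree → MvPowerSeries.coeff m f = 0) ∧
      ∀ s : Equiv.Perm ℕ, MvPowerSeries.rename s f = f :=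
  Iff.rfl

/-- A symmetric function with rational coefficients, regarded as one with coefficients in `R`. -/
def SymFun.baseChange (R : Type) [CommRing R] [Algebra ℚ R] : SymFun ℚ →+* SymFun R :=
  ((MvPowerSeries.map (algebraMap ℚ R)).comp (SymFun ℚ).val.toRingHom).codRestrict (SymFun R) (by
    rintro ⟨f, ⟨d, hd⟩, hf⟩
    refine ⟨⟨d, fun m hm => ?_⟩, fun s => ?_⟩
    · simp [MvPowerSeries.coeff_map, hd m hm]
    · simp [MvPowerSeries.rename_map, hf s])

/-- The symmetric function `q_r`, determined by
`∑ q_r z ^ r = ∏ (1 + x_i z) / (1 - x_i z)`: since `(1 + x z) / (1 - x z) = 1 + 2 ∑ x ^ k z ^ k`,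
the coefficient of a monomial of degree `r` is `2` to the number of variables that occur. -/
def q (R : Type) [CommRing R] (r : ℕ) : SymFun R :=
  ⟨fun m => if m.degree = r then 2 ^ m.support.card else 0, by
    refine ⟨⟨r, fun m hm => ?_⟩, fun s => ?_⟩
    · exact if_neg (by omega)
    · ext m
      obtain ⟨m', rfl⟩ : ∃ m', m = Finsupp.embDomain s.toEmbedding m' :=
        ⟨Finsupp.mapDomain s.symm m, by
          rw [Finsupp.embDomain_eq_mapDomain, ← Finsupp.mapDomain_comp]
          simp⟩
      refine (MvPowerSeries.coeff_embDomain_rename s.toEmbedding _ m').trans ?_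
      have h1 : (Finsupp.embDomain s.toEmbedding m').degree = m'.degree := by
        rw [Finsupp.embDomain_eq_mapDomain, Finsupp.degree_mapDomain]
      change (if _ then _ else _) = (if _ then _ else _)
      rw [h1, Finsupp.support_embDomain, Finset.card_map]⟩

/-- The subalgebra `Γ_R = R[q_r : r ≥ 1]` of the ring of symmetric functions. -/
def Gam (R : Type) [CommRing R] : Subalgebra R (SymFun R) :=
  Algebra.adjoin R {f | ∃ r : ℕ, 1 ≤ r ∧ f = q R r}

/-! ### The projection to finitely many variables -/

/-- The field of rational functions in `x_0, ..., x_{n-1}` over `R`; it contains the ring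
of Laurent polynomials in these variables. -/
abbrev RF (R : Type) [CommRing R] [IsDomain R] (n : ℕ) : Type :=
  FractionRing (MvPolynomial (Fin n) R)

/-- The variable `x_i` of the field of rational functions. -/
def RF.x (R : Type) [CommRing R] [IsDomain R] (n : ℕ) (i : Fin n) : RF R n :=
  algebraMap (MvPolynomial (Fin n) R) (RF R n) (MvPolynomial.X i)

/-- Setting all but the first `2 n` variables to zero turns a symmetric function into a
polynomial in `2 n` variables. -/
theorem killCompl_mem_range {R : Type} [CommRing R] {t : Type} [Finite t] (e : t ↪ ℕ)
    (f : SymFun R) :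
    MvPowerSeries.killCompl e (f : MvPowerSeries ℕ R) ∈
      (MvPolynomial.coeToMvPowerSeries.algHom (σ := t) (R := R) R).range := by
  obtain ⟨d, hd⟩ := ((mem_SymFun _).mp f.2).1
  have hfin : {m : t →₀ ℕ | m.degree ≤ d}.Finite := Finsupp.finite_of_degree_le d
  refine (AlgHom.mem_range _).mpr
    ⟨MvPowerSeries.truncFinset R hfin.toFinset (MvPowerSeries.killCompl e f), ?_⟩
  rw [MvPolynomial.coeToMvPowerSeries.algHom_apply]
  ext m
  simp only [Algebra.algebraMap_self, MvPowerSeries.map_id, RingHom.id_apply,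
    MvPolynomial.coeff_coe]
  by_cases hm : m.degree ≤ d
  · rw [MvPowerSeries.coeff_truncFinset_of_mem _ (by simpa using hm)]
  · rw [MvPowerSeries.coeff_truncFinset_eq_zero _ (by simpa using hm),
      MvPowerSeries.coeff_killCompl, hd]
    rw [Finsupp.embDomain_eq_mapDomain, Finsupp.degree_mapDomain]
    omega

theorem coe_injective (R : Type) [CommRing R] (t : Type) :
    Function.Injective (MvPolynomial.coeToMvPowerSeries.algHom (σ := t) (R := R) R) := by
  intro p p' h
  simpa [MvPolynomial.coeToMvPowerSeries.algHom_apply] using h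

/-- The embedding of the two-part alphabet `(x_0, ..., x_{n-1}; y_0, ..., y_{n-1})` as the
first `2 n` variables. -/
def alphabet (n : ℕ) : Fin n ⊕ Fin n ↪ ℕ :=
  finSumFinEquiv.toEmbedding.trans Fin.valEmbedding

/-- A symmetric function as a polynomial in its first `2 n` variables, all other variables
being set to zero. -/
def toPoly (R : Type) [CommRing R] (n : ℕ) :
    SymFun R →ₐ[R] MvPolynomial (Fin n ⊕ Fin n) R :=
  (AlgEquiv.ofInjective _ (coe_injective R (Fin n ⊕ Fin n))).symm.toAlgHom.comp
    (((MvPowerSeries.killCompl (alphabet n)).comp (SymFun R).val).codRestrict _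
      (killCompl_mem_range (alphabet n)))

/-- The ring homomorphism
`f ↦ f (x_0, ..., x_{n-1}, x_0⁻¹, ..., x_{n-1}⁻¹, 0, 0, ...)`. -/
def proj (R : Type) [CommRing R] [IsDomain R] (n : ℕ) : SymFun R →ₐ[R] RF R n :=
  (MvPolynomial.aeval (Sum.elim (RF.x R n) fun i => (RF.x R n i)⁻¹)).comp (toPoly R n)

/-! ### Factorial symplectic Hall-Littlewood functions and `Q`-functions -/

section HallLittlewood

variable {F : Type} [Field F]

/-- The factorial monomial `(y | a) ^ r = (y + a_0) ... (y + a_{r-1})`. -/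
def facMonomial (a : ℕ → F) (y : F) (r : ℕ) : F :=
  ∏ i ∈ Finset.range r, (y + a i)

/-- The summand of the Hall-Littlewood symmetrization, at the point `y`. -/
def hlTerm {n : ℕ} (a : ℕ → F) (t : F) (p : Fin n → ℕ) (y : Fin n → F) : F :=
  (∏ i, facMonomial a (y i) (p i)) *
  (∏ i, (1 - t * (y i ^ 2)⁻¹) / (1 - (y i ^ 2)⁻¹)) *
  ∏ i, ∏ j ∈ Finset.Ioi i,
    ((1 - t * (y i)⁻¹ * y j) / (1 - (y i)⁻¹ * y j)) *
    ((1 - t * (y i)⁻¹ * (y j)⁻¹) / (1 - (y i)⁻¹ * (y j)⁻¹))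

/-- The sum over the hyperoctahedral group, which permutes the variables `x_i` and replaces
some of them by their inverses. -/
def hlSum {n : ℕ} (a : ℕ → F) (t : F) (p : Fin n → ℕ) (x : Fin n → F) : F :=
  ∑ s : Equiv.Perm (Fin n), ∑ ε : Fin n → ℤˣ,
    hlTerm a t p fun i => x (s i) ^ ((ε i : ℤˣ) : ℤ)

/-- The normalizing factor: the Poincaré polynomial of the stabilizer of `p` in the
hyperoctahedral group,
`∏_{i=1}^{m_0} (1 - t^{2i})/(1 - t) * ∏_{r ≥ 1} ∏_{i=1}^{m_r} (1 - t^i)/(1 - t)`,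
where `m_r` is the number of entries of `p` equal to `r`. -/
def hlNorm {n : ℕ} (t : F) (p : Fin n → ℕ) : F :=
  (∏ i ∈ Finset.Icc 1 (Finset.univ.filter fun j => p j = 0).card,
    ∑ k ∈ Finset.range (2 * i), t ^ k) *
  ∏ r ∈ (Finset.univ.image p).erase 0,
    ∏ i ∈ Finset.Icc 1 (Finset.univ.filter fun j => p j = r).card,
      ∑ k ∈ Finset.range i, t ^ k

end HallLittlewood

/-- Entry `i` of the sequence `p`, continued by zeros. -/
def entry {l : ℕ} (p : Fin l → ℕ) (i : ℕ) : ℕ :=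
  if h : i < l then p ⟨i, h⟩ else 0

/-- The factorial symplectic Hall-Littlewood function with factorial parameters `a`, in `n`
variables, of the partition `p` of length `l ≤ n`, as a rational function of `t` over the
field of rational functions in the variables `x_i`. -/
def facHL {R : Type} [CommRing R] [IsDomain R] (n : ℕ) (a : ℕ → R) {l : ℕ} (p : Fin l → ℕ) :
    RatFunc (RF R n) :=
  hlSum (fun k => RatFunc.C (algebraMap R (RF R n) (a k))) RatFunc.X
      (fun i : Fin n => entry p i) (fun i => RatFunc.C (RF.x R n i)) /
    hlNorm RatFunc.X (fun i : Fin n => entry p i)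

/-- The factorial symplectic `Q`-function in `n` variables: `2 ^ l` times the specialization
`t = -1` of the Hall-Littlewood function, and zero for partitions of length `l > n`. -/
def facSympQ {R : Type} [CommRing R] [IsDomain R] (n : ℕ) (a : ℕ → R) {l : ℕ}
    (p : Fin l → ℕ) : RF R n :=
  if l ≤ n then 2 ^ l * RatFunc.eval (RingHom.id (RF R n)) (-1) (facHL n a p) else 0

/-! ### Universal functions -/

/-- The universal symplectic `Q`-function: the symmetric function with rational coefficients
that projects to the symplectic `Q`-function in `n` variables for every `n`. -/
def univSympQ {l : ℕ} (p : Fin l → ℕ) : SymFun ℚ :=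
  Classical.epsilon fun f : SymFun ℚ =>
    ∀ n : ℕ, proj ℚ n f = facSympQ n (fun _ => (0 : ℚ)) p

/-- The coefficient ring `ℚ[a_0, a_1, ...]`. -/
abbrev Qa : Type := MvPolynomial ℕ ℚ

/-- The `k`-th elementary symmetric polynomial in `a_0, ..., a_{r-1}`. -/
def elemA (r k : ℕ) : Qa :=
  ∑ s ∈ (Finset.range r).powersetCard k, ∏ i ∈ s, MvPolynomial.X i

/-- `det (e_{λ_i - μ_j} (a_0, ..., a_{λ_i - 1}))`, where `e_k = 0` for negative `k`. -/
def dCoeff {l : ℕ} (p m : Fin l → ℕ) : Qa :=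
  Matrix.det (Matrix.of fun i j : Fin l => if m j ≤ p i then elemA (p i) (p i - m j) else 0)

open Classical in
/-- The strict partitions of length `l` contained in the partition `p` of length `l`. -/
def subPartitions {l : ℕ} (p : Fin l → ℕ) : Finset (Fin l → ℕ) :=
  (Fintype.piFinset fun i => Finset.Icc 1 (p i)).filter StrictAnti

/-- The universal factorial symplectic `Q`-function. -/
def univFacQ {l : ℕ} (p : Fin l → ℕ) : SymFun Qa :=
  ∑ m ∈ subPartitions p, dCoeff p m • SymFun.baseChange Qa (univSympQ m)

/-- The Pfaffian of a skew-symmetric `2k × 2k` matrix. -/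
def pfaffian {A : Type} [CommRing A] [Algebra ℚ A] {k : ℕ}
    (M : Matrix (Fin (2 * k)) (Fin (2 * k)) A) : A :=
  ((2 ^ k * k.factorial : ℚ)⁻¹) • ∑ s : Equiv.Perm (Fin (2 * k)),
    ((Equiv.Perm.sign s : ℤˣ) : ℤ) •
      ∏ i : Fin k, M (s ⟨2 * i, by omega⟩) (s ⟨2 * i + 1, by omega⟩)

/-- The universal factorial symplectic `Q`-function of the partition `(r, s)`, `r > s ≥ 0`. -/
def univFacQ₂ (r s : ℕ) : SymFun Qa :=
  if s = 0 then univFacQ ![r] else univFacQ ![r, s]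

/-- The skew-symmetric matrix whose entry above the diagonal is the universal function of
`(λ_i, λ_j)`; its size `2 ⌈l/2⌉` is `l` or `l + 1` according as `l` is even or odd, and in the
latter case the last part is zero. -/
def schurMatrix {l : ℕ} (p : Fin l → ℕ) :
    Matrix (Fin (2 * ((l + 1) / 2))) (Fin (2 * ((l + 1) / 2))) (SymFun Qa) :=
  Matrix.of fun i j =>
    if i < j then univFacQ₂ (entry p i) (entry p j)
    else if j < i then -univFacQ₂ (entry p j) (entry p i)
    else 0

end SymplecticQ

end

noncomputable section

namespace SymplecticQ

/-! ### Partial fractions -/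

/-- Partial fraction expansion of `∏ (X - t z) / (X - z)`, for elements `E` that behave like
`X / (X - z)`. -/
theorem prod_partialFractions {K ι : Type} [Field K] [DecidableEq ι] (t : K) (z : ι → K)
    (s : Finset ι) (hz : Set.InjOn z s) :
    ∀ (A : Type) [CommRing A] [Algebra K A] (E : ι → A),
      (∀ i ∈ s, ∀ j ∈ s, i ≠ j → (z i - z j) • (E i * E j) = z i • E i - z j • E j) →
      ∏ i ∈ s, (algebraMap K A t + (1 - t) • E i) =
        algebraMap K A (t ^ s.card) +
          (1 - t) • ∑ i ∈ s, (∏ w ∈ s.erase i, (z i - t * z w) / (z i - z w)) • E i := by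
  induction s using Finset.induction_on with
  | empty => intro A _ _ E _; simp
  | insert y s hy ih =>
    intro A _ _ E hE
    have hz' : Set.InjOn z s := hz.mono (by simp)
    have hne : ∀ i ∈ s, z i ≠ z y := fun i hi h =>
      hy (hz (by simp [hi]) (by simp) h ▸ hi)
    have key := ih hz' K (fun i => z y / (z y - z i)) (by
      intro i hi j hj hij
      have h1 : z y - z i ≠ 0 := sub_ne_zero.2 (hne i hi).symm
      have h2 : z y - z j ≠ 0 := sub_ne_zero.2 (hne j hj).symm
      simp only [smul_eq_mul]
      field_simp
      ring)
    have hA := ih hz' A E (fun i hi j hj => hE i (by simp [hi]) j (by simp [hj]))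
    have hkey : ∏ w ∈ s, (z y - t * z w) / (z y - z w) = t ^ s.card +
        (1 - t) * ∑ i ∈ s, (∏ w ∈ s.erase i, (z i - t * z w) / (z i - z w)) *
          (z y / (z y - z i)) := by
      simp only [Algebra.algebraMap_self, RingHom.id_apply, smul_eq_mul] at key
      rw [← key]
      refine Finset.prod_congr rfl fun i hi => ?_
      have h1 : z y - z i ≠ 0 := sub_ne_zero.2 (hne i hi).symm
      field_simp
      ring
    have hterm : ∀ i ∈ s, E i * (algebraMap K A t + (1 - t) • E y) =
        ((z i - t * z y) / (z i - z y)) • E i + ((1 - t) * (z y / (z y - z i))) • E y := by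
      intro i hi
      have h1 : z i - z y ≠ 0 := sub_ne_zero.2 (hne i hi)
      have h2 : z y - z i ≠ 0 := sub_ne_zero.2 (hne i hi).symm
      have h3 : E i * E y = (z i - z y)⁻¹ • (z i • E i - z y • E y) := by
        rw [← hE i (by simp [hi]) y (by simp) (fun h => hy (h ▸ hi)), smul_smul,
          inv_mul_cancel₀ h1, one_smul]
      rw [mul_add, mul_smul_comm, h3, mul_comm (E i), ← Algebra.smul_def]
      rw [smul_sub, smul_sub, smul_smul, smul_smul, smul_smul, smul_smul, ← add_sub_assoc,
        ← add_smul, sub_eq_add_neg, ← neg_smul]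
      congr 2
      · field_simp; ring
      · field_simp; ring
    have herase : ∀ i ∈ s, ∏ w ∈ (insert y s).erase i, (z i - t * z w) / (z i - z w) =
        (z i - t * z y) / (z i - z y) *
          ∏ w ∈ s.erase i, (z i - t * z w) / (z i - z w) := by
      intro i hi
      have hyi : y ≠ i := fun h => hy (h ▸ hi)
      rw [Finset.erase_insert_of_ne hyi, Finset.prod_insert (by simp [hy])]
    rw [Finset.prod_insert hy, hA, Finset.sum_insert hy, Finset.erase_insert hy,
      Finset.card_insert_of_notMem hy, hkey, mul_comm, add_mul, smul_mul_assoc, Finset.sum_mul]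
    have hsum : ∑ i ∈ s, (∏ w ∈ s.erase i, (z i - t * z w) / (z i - z w)) • E i *
          (algebraMap K A t + (1 - t) • E y) =
        ∑ i ∈ s, (∏ w ∈ (insert y s).erase i, (z i - t * z w) / (z i - z w)) • E i +
        ((1 - t) * ∑ i ∈ s, (∏ w ∈ s.erase i, (z i - t * z w) / (z i - z w)) *
          (z y / (z y - z i))) • E y := by
      rw [Finset.mul_sum, Finset.sum_smul, ← Finset.sum_add_distrib]
      refine Finset.sum_congr rfl fun i hi => ?_
      rw [smul_mul_assoc, hterm i hi, herase i hi, smul_add, smul_smul, smul_smul]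
      congr 2
      · ring
      · ring
    rw [hsum]
    simp only [Algebra.smul_def, map_add, map_mul, map_pow, map_sub, map_one]
    ring

theorem sum_prod_sub_div {K ι : Type} [Field K] [DecidableEq ι] (t : K) (ht : t ≠ 1)
    (z : ι → K) (s : Finset ι) (hz : Set.InjOn z s) :
    ∑ i ∈ s, ∏ w ∈ s.erase i, (z i - t * z w) / (z i - z w) =
      ∑ k ∈ Finset.range s.card, t ^ k := by
  have h := prod_partialFractions t z s hz K (fun _ => 1) (by intros; simp)
  simp only [Algebra.algebraMap_self, RingHom.id_apply, smul_eq_mul, mul_one,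
    add_sub_cancel, Finset.prod_const, one_pow] at h
  have h2 := mul_neg_geom_sum t s.card
  refine mul_left_cancel₀ (sub_ne_zero.2 (Ne.symm ht)) ?_
  rw [mul_comm (1 - t) (∑ k ∈ Finset.range s.card, t ^ k), mul_comm] at *
  linear_combination -h - h2

/-! ### Sums over permutations -/

/-- The permutation with value `p` at `0` which continues by `e`. -/
def consPerm {n : ℕ} (p : Fin (n + 1)) (e : Equiv.Perm (Fin n)) : Equiv.Perm (Fin (n + 1)) :=
  Equiv.ofBijective (Fin.cons p (p.succAbove ∘ e) : Fin (n + 1) → Fin (n + 1)) <| by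
    rw [Fintype.bijective_iff_injective_and_card]
    refine ⟨?_, rfl⟩
    rw [Fin.cons_injective_iff]
    refine ⟨?_, Fin.succAbove_right_injective.comp e.injective⟩
    rintro ⟨i, hi⟩
    exact Fin.succAbove_ne p _ hi

theorem coe_consPerm {n : ℕ} (p : Fin (n + 1)) (e : Equiv.Perm (Fin n)) :
    ⇑(consPerm p e) = (Fin.cons p (p.succAbove ∘ e) : Fin (n + 1) → Fin (n + 1)) := rfl

theorem sum_perm_succ {n : ℕ} {M : Type} [AddCommMonoid M]
    (f : (Fin (n + 1) → Fin (n + 1)) → M) :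
    ∑ s : Equiv.Perm (Fin (n + 1)), f s =
      ∑ p, ∑ e : Equiv.Perm (Fin n), f (Fin.cons p (p.succAbove ∘ e)) := by
  rw [← Fintype.sum_prod_type' (f := fun (p : Fin (n + 1)) (e : Equiv.Perm (Fin n)) =>
    f (Fin.cons p (p.succAbove ∘ e)))]
  symm
  refine Fintype.sum_bijective (fun q : Fin (n + 1) × Equiv.Perm (Fin n) => consPerm q.1 q.2)
    ?_ _ _ (fun q => by rw [coe_consPerm])
  rw [Fintype.bijective_iff_injective_and_card]
  constructor
  · rintro ⟨p, e⟩ ⟨p', e'⟩ h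
    have h' := congrArg (fun s : Equiv.Perm (Fin (n + 1)) => (⇑s)) h
    simp only [coe_consPerm] at h'
    obtain ⟨rfl, h2⟩ := Fin.cons_inj.1 h'
    congr 1
    ext i
    exact congrArg _ (Fin.succAbove_right_injective (congrFun h2 i))
  · simp [Fintype.card_perm, Nat.factorial_succ]

/-! ### Schur's Pfaffian -/

section Schur

variable {F : Type} [Field F]

/-- The kernel `(v - u) / (v + u)`. -/
def kker (u v : F) : F := (v - u) / (v + u)

theorem kker_antisymm (u v : F) : kker v u = -kker u v := by
  rw [kker, kker, ← neg_div, neg_sub, add_comm]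

@[simp]
theorem kker_self (u : F) : kker u u = 0 := by simp [kker]

theorem kker_ne_zero {u v : F} (h : u ≠ v) (h' : u + v ≠ 0) : kker u v ≠ 0 :=
  div_ne_zero (sub_ne_zero.2 h.symm) (by rwa [add_comm])

/-- The product of the kernels over all pairs. -/
def kprod {n : ℕ} (u : Fin n → F) : F := ∏ i, ∏ j ∈ Finset.Ioi i, kker (u i) (u j)

theorem kprod_comp_perm {n : ℕ} (u : Fin n → F) (s : Equiv.Perm (Fin n)) :
    kprod (u ∘ s) = ((Equiv.Perm.sign s : ℤˣ) : ℤ) * kprod u := by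
  have := s.prod_Ioi_comp_eq_sign_mul_prod (f := fun i j => kker (u i) (u j))
    (fun i j => by rw [kker_antisymm])
  simpa [kprod] using this

theorem prod_Ioi_cons {n : ℕ} {α M : Type} [CommMonoid M] (g : α → α → M) (a : α)
    (v : Fin n → α) :
    ∏ i, ∏ j ∈ Finset.Ioi i, g ((Fin.cons a v : Fin (n + 1) → α) i)
      ((Fin.cons a v : Fin (n + 1) → α) j) =
    (∏ j, g a (v j)) * ∏ i, ∏ j ∈ Finset.Ioi i, g (v i) (v j) := by
  rw [Fin.prod_univ_succ]
  congr 1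
  · rw [Fin.Ioi_zero_eq_map, Finset.prod_map]
    simp
  · refine Finset.prod_congr rfl fun i _ => ?_
    rw [Fin.Ioi_succ, Finset.prod_map]
    simp

theorem kprod_cons {n : ℕ} (a : F) (v : Fin n → F) :
    kprod (Fin.cons a v : Fin (n + 1) → F) = (∏ j, kker a (v j)) * kprod v :=
  prod_Ioi_cons kker a v

theorem kprod_ne_zero {n : ℕ} {u : Fin n → F} (hu : Function.Injective u)
    (h : ∀ i j, u i ≠ u j → u i + u j ≠ 0) : kprod u ≠ 0 := by
  refine Finset.prod_ne_zero_iff.2 fun i _ => Finset.prod_ne_zero_iff.2 fun j hj => ?_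
  have hij : u i ≠ u j := fun e => (Finset.mem_Ioi.1 hj).ne (hu e)
  exact kker_ne_zero hij (h _ _ hij)

theorem kprod_eq_zero {n : ℕ} {u : Fin n → F} (hu : ¬ Function.Injective u) : kprod u = 0 := by
  obtain ⟨i, j, hij, hne⟩ : ∃ i j, u i = u j ∧ i ≠ j := by
    simpa [Function.Injective] using hu
  wlog hlt : i < j generalizing i j
  · exact this j i hij.symm hne.symm (lt_of_le_of_ne (not_lt.1 hlt) hne.symm)
  exact Finset.prod_eq_zero (Finset.mem_univ i)
    (Finset.prod_eq_zero (Finset.mem_Ioi.2 hlt) (by rw [hij, kker_self]))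

/-- The expansion of `∏ (v_j - a) / (v_j + a)` into partial fractions, for an odd number of
points. -/
theorem prod_kker_eq_sum [CharZero F] {k : ℕ} (a : F) (v : Fin (2 * k + 1) → F)
    (hv : Function.Injective v) (ha : ∀ j, a + v j ≠ 0) :
    ∏ j, kker a (v j) =
      ∑ b, kker a (v b) * ∏ j : Fin (2 * k), (kker (v b) (v (b.succAbove j)))⁻¹ := by
  have hm1 : (-1 : F) ≠ 1 := by norm_num
  have hA : ∀ b : Fin (2 * k + 1),
      ∏ w ∈ Finset.univ.erase b, (v b - -1 * v w) / (v b - v w) =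
      ∏ j : Fin (2 * k), (kker (v b) (v (b.succAbove j)))⁻¹ := by
    intro b
    have h1 : Finset.univ.erase b = Finset.univ.map (Fin.succAboveEmb b) := by
      ext i; simp
    rw [h1, Finset.prod_map]
    have h2 : ∀ j : Fin (2 * k), (v b - -1 * v (b.succAbove j)) / (v b - v (b.succAbove j)) =
        -1 * (kker (v b) (v (b.succAbove j)))⁻¹ := fun j => by
      rw [kker, inv_div, ← neg_sub (v (b.succAbove j)) (v b), div_neg]
      ring
    simp only [Fin.coe_succAboveEmb, h2, Finset.prod_mul_distrib]
    simp
  have h1 := sum_prod_sub_div (-1 : F) hm1 v Finset.univ hv.injOn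
  have h2 := prod_partialFractions (-1 : F) v Finset.univ hv.injOn F
    (fun i => -a / (-a - v i)) (by
      intro i _ j _ _
      have hi : -a - v i ≠ 0 := by have := ha i; rwa [← neg_add', neg_ne_zero]
      have hj : -a - v j ≠ 0 := by have := ha j; rwa [← neg_add', neg_ne_zero]
      simp only [smul_eq_mul]
      field_simp
      ring)
  simp only [hA] at h1 h2
  have h3 : ∀ i, algebraMap F F (-1) + (1 - -1 : F) • (-a / (-a - v i)) = -1 * kker a (v i) := by
    intro i
    have hi : -a - v i ≠ 0 := by have := ha i; rwa [← neg_add', neg_ne_zero]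
    have hi' : v i + a ≠ 0 := by rw [add_comm]; exact ha i
    simp only [Algebra.algebraMap_self, RingHom.id_apply, smul_eq_mul, kker]
    field_simp
    ring
  have h4 : ∀ i, kker a (v i) = 1 - 2 * (-a / (-a - v i)) := by
    intro i
    have := h3 i
    simp only [Algebra.algebraMap_self, RingHom.id_apply, smul_eq_mul] at this
    linear_combination this
  simp only [h3, Finset.prod_mul_distrib] at h2
  have h5 : ∑ x ∈ Finset.range (2 * k + 1), (-1 : F) ^ x = 1 := by
    rw [Finset.sum_range_succ]
    have : ∀ k : ℕ, ∑ x ∈ Finset.range (2 * k), (-1 : F) ^ x = 0 := by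
      intro k
      induction k with
      | zero => simp
      | succ k ih =>
        rw [mul_add, Finset.sum_range_succ, Finset.sum_range_succ, ih, pow_succ, pow_mul]
        simp
    rw [this]; simp
  simp only [Finset.card_univ, Fintype.card_fin, h5] at h1 h2
  simp only [Finset.prod_const, Finset.card_univ, Fintype.card_fin, smul_eq_mul,
    Algebra.algebraMap_self, RingHom.id_apply] at h2
  have hodd : (-1 : F) ^ (2 * k + 1) = -1 := by rw [pow_succ, pow_mul]; simp
  rw [hodd] at h2
  have h6 : ∑ b, kker a (v b) * ∏ j : Fin (2 * k), (kker (v b) (v (b.succAbove j)))⁻¹ =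
      ∑ b, ∏ j : Fin (2 * k), (kker (v b) (v (b.succAbove j)))⁻¹ -
      2 * ∑ b, (∏ j : Fin (2 * k), (kker (v b) (v (b.succAbove j)))⁻¹) *
        (-a / (-a - v b)) := by
    rw [Finset.mul_sum, ← Finset.sum_sub_distrib]
    refine Finset.sum_congr rfl fun b _ => ?_
    conv_lhs => rw [h4 b]
    ring
  rw [h6, h1]
  linear_combination -h2

/-- The quotient of a single product of the Pfaffian by the product of all kernels. -/
def pfTerm (k : ℕ) (u : Fin (2 * k) → F) : F :=
  (∏ i : Fin k, kker (u ⟨2 * i, by omega⟩) (u ⟨2 * i + 1, by omega⟩)) / kprod u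

theorem pfTerm_cons_cons {k : ℕ} (a b : F) (v : Fin (2 * k) → F) (hab : kker a b ≠ 0) :
    pfTerm (k + 1) (Fin.cons a (Fin.cons b v : Fin (2 * k + 1) → F) : Fin (2 * k + 2) → F) =
      (∏ j, (kker a (v j))⁻¹) * (∏ j, (kker b (v j))⁻¹) * pfTerm k v := by
  have h1 : kprod (Fin.cons a (Fin.cons b v : Fin (2 * k + 1) → F) : Fin (2 * k + 2) → F) =
      kker a b * (∏ j, kker a (v j)) * ((∏ j, kker b (v j)) * kprod v) := by
    rw [kprod_cons, kprod_cons, Fin.prod_univ_succ]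
    simp
  have h2 : ∏ i : Fin (k + 1), kker
      ((Fin.cons a (Fin.cons b v : Fin (2 * k + 1) → F) : Fin (2 * k + 2) → F) ⟨2 * i, by omega⟩)
      ((Fin.cons a (Fin.cons b v : Fin (2 * k + 1) → F) : Fin (2 * k + 2) → F)
        ⟨2 * i + 1, by omega⟩) =
      kker a b * ∏ i : Fin k, kker (v ⟨2 * i, by omega⟩) (v ⟨2 * i + 1, by omega⟩) := by
    rw [Fin.prod_univ_succ]
    rfl
  rw [pfTerm]
  refine (congrArg₂ (· / ·) h2 h1).trans ?_
  rw [pfTerm, Finset.prod_inv_distrib, Finset.prod_inv_distrib, mul_assoc, mul_assoc,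
    mul_div_mul_left _ _ hab]
  simp only [div_eq_mul_inv, mul_inv]
  ring

theorem sum_pfTerm [CharZero F] (k : ℕ) : ∀ (u : Fin (2 * k) → F), Function.Injective u →
    (∀ i j, u i ≠ u j → u i + u j ≠ 0) →
    ∑ s : Equiv.Perm (Fin (2 * k)), pfTerm k (u ∘ s) = 2 ^ k * k.factorial := by
  induction k with
  | zero => intro u _ _; simp [pfTerm, kprod]
  | succ k ih =>
    intro u hu h
    have e1 : ∑ s : Equiv.Perm (Fin (2 * k + 2)), pfTerm (k + 1) (u ∘ s) =
      ∑ p, ∑ e : Equiv.Perm (Fin (2 * k + 1)), pfTerm (k + 1)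
        (u ∘ (Fin.cons p (p.succAbove ∘ e) : Fin (2 * k + 2) → Fin (2 * k + 2))) :=
      sum_perm_succ fun s => pfTerm (k + 1) (u ∘ s)
    refine e1.trans ?_
    have e2 : ∀ p : Fin (2 * k + 2), ∑ e : Equiv.Perm (Fin (2 * k + 1)), pfTerm (k + 1)
        (u ∘ (Fin.cons p (p.succAbove ∘ e) : Fin (2 * k + 2) → Fin (2 * k + 2))) =
        2 ^ k * k.factorial := by
      intro p
      rw [sum_perm_succ fun s => pfTerm (k + 1)
        (u ∘ (Fin.cons p (p.succAbove ∘ s) : Fin (2 * k + 2) → Fin (2 * k + 2)))]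
      have hup : ∀ j, u p ≠ u (p.succAbove j) := fun j e => Fin.succAbove_ne p j (hu e).symm
      have hk : ∀ j, kker (u p) (u (p.succAbove j)) ≠ 0 := fun j =>
        kker_ne_zero (hup j) (h _ _ (hup j))
      have e3 : ∀ b : Fin (2 * k + 1), ∑ e : Equiv.Perm (Fin (2 * k)), pfTerm (k + 1)
          (u ∘ (Fin.cons p (p.succAbove ∘ (Fin.cons b (b.succAbove ∘ e) :
            Fin (2 * k + 1) → Fin (2 * k + 1))) : Fin (2 * k + 2) → Fin (2 * k + 2))) =
          (∏ j, (kker (u p) (u (p.succAbove (b.succAbove j))))⁻¹) *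
          (∏ j, (kker (u (p.succAbove b)) (u (p.succAbove (b.succAbove j))))⁻¹) *
            (2 ^ k * k.factorial) := by
        intro b
        rw [← ih (u ∘ p.succAbove ∘ b.succAbove)
          (hu.comp (Fin.succAbove_right_injective.comp Fin.succAbove_right_injective))
          (fun i j hij => h _ _ hij), Finset.mul_sum]
        refine Finset.sum_congr rfl fun e _ => ?_
        have e4 : (u ∘ (Fin.cons p (p.succAbove ∘ (Fin.cons b (b.succAbove ∘ e) :
            Fin (2 * k + 1) → Fin (2 * k + 1))) : Fin (2 * k + 2) → Fin (2 * k + 2))) =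
            Fin.cons (u p) (Fin.cons (u (p.succAbove b))
              ((u ∘ p.succAbove ∘ b.succAbove) ∘ e) : Fin (2 * k + 1) → F) := by
          funext i
          refine Fin.cases rfl (fun i => ?_) i
          refine Fin.cases rfl (fun i => ?_) i
          rfl
        rw [e4, pfTerm_cons_cons _ _ _ (hk b)]
        congr 2
        · exact Equiv.prod_comp e fun j => (kker (u p) (u (p.succAbove (b.succAbove j))))⁻¹
        · exact Equiv.prod_comp e fun j =>
            (kker (u (p.succAbove b)) (u (p.succAbove (b.succAbove j))))⁻¹
      rw [Finset.sum_congr rfl fun b _ => e3 b, ← Finset.sum_mul]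
      have e5 := prod_kker_eq_sum (u p) (u ∘ p.succAbove)
        (hu.comp Fin.succAbove_right_injective) (fun j => h _ _ (hup j))
      have hP : ∏ j, kker (u p) ((u ∘ p.succAbove) j) ≠ 0 :=
        Finset.prod_ne_zero_iff.2 fun j _ => hk j
      have e6 : ∑ b : Fin (2 * k + 1),
          (∏ j, (kker (u p) (u (p.succAbove (b.succAbove j))))⁻¹) *
          (∏ j, (kker (u (p.succAbove b)) (u (p.succAbove (b.succAbove j))))⁻¹) = 1 := by
        refine mul_left_cancel₀ hP ?_
        rw [mul_one]
        conv_rhs => rw [e5]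
        rw [Finset.mul_sum]
        refine Finset.sum_congr rfl fun b _ => ?_
        rw [Fin.prod_univ_succAbove _ b, ← mul_assoc]
        congr 1
        rw [mul_assoc, ← Finset.prod_mul_distrib]
        simp [hk]
      rw [e6, one_mul]
    rw [Finset.sum_congr rfl fun p _ => e2 p]
    simp [Nat.factorial_succ, pow_succ]
    ring

/-- Schur's Pfaffian. -/
theorem sum_sign_prod_kker [CharZero F] {k : ℕ} (u : Fin (2 * k) → F)
    (h : ∀ i j, u i ≠ u j → u i + u j ≠ 0) :
    ∑ s : Equiv.Perm (Fin (2 * k)), (((Equiv.Perm.sign s : ℤˣ) : ℤ) : F) *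
      ∏ i : Fin k, kker (u (s ⟨2 * i, by omega⟩)) (u (s ⟨2 * i + 1, by omega⟩)) =
    2 ^ k * k.factorial * kprod u := by
  by_cases hu : Function.Injective u
  · rw [← sum_pfTerm k u hu h, Finset.sum_mul]
    refine Finset.sum_congr rfl fun s _ => ?_
    have hD := kprod_ne_zero hu h
    rw [pfTerm, kprod_comp_perm]
    have hs : (((Equiv.Perm.sign s : ℤˣ) : ℤ) : F) * (((Equiv.Perm.sign s : ℤˣ) : ℤ) : F) = 1 := by
      rw [← Int.cast_mul, ← Units.val_mul, Int.units_mul_self]; simp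
    have hs0 : (((Equiv.Perm.sign s : ℤˣ) : ℤ) : F) ≠ 0 := left_ne_zero_of_mul_eq_one hs
    simp only [Function.comp_apply]
    generalize (((Equiv.Perm.sign s : ℤˣ) : ℤ) : F) = e at hs hs0
    field_simp
    linear_combination (∏ i : Fin k, kker (u (s ⟨2 * i, by omega⟩))
      (u (s ⟨2 * i + 1, by omega⟩))) * hs
  · rw [kprod_eq_zero hu, mul_zero]
    obtain ⟨a, b, hab, hne⟩ : ∃ i j, u i = u j ∧ i ≠ j := by
      simpa [Function.Injective] using hu
    have huc : ∀ i, u (Equiv.swap a b i) = u i := fun i => by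
      rw [Equiv.swap_apply_def]; split_ifs <;> simp_all
    refine Finset.sum_involution (fun s _ => Equiv.swap a b * s) ?_ ?_ ?_ ?_
    · intro s _
      simp only [Equiv.Perm.coe_mul, Function.comp_apply, huc, map_mul, Equiv.Perm.sign_swap hne]
      simp
    · intro s _ _ e
      have : Equiv.swap a b = 1 := by simpa using e
      exact hne (Equiv.swap_eq_one_iff.1 this)
    · simp
    · intro s _
      simp [← mul_assoc]

end Schur

/-! ### Alphabets closed under inversion -/

section Alphabet

variable {F : Type} [Field F]

theorem units_prod {M : Type} [CommMonoid M] (h : ℤˣ → M) : ∏ e, h e = h 1 * h (-1) := by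
  have : (Finset.univ : Finset ℤˣ) = {1, -1} := rfl
  rw [this, Finset.prod_pair (by decide)]

theorem units_prod' {M : Type} [CommMonoid M] (h : ℤˣ → M) (e : ℤˣ) :
    h e * h (-e) = h 1 * h (-1) := by
  rcases Int.units_eq_one_or e with rfl | rfl
  · rfl
  · rw [neg_neg, mul_comm]

/-- The point `x_i` or `x_i⁻¹`. -/
def pt {n : ℕ} (x : Fin n → F) (z : Fin n × ℤˣ) : F := x z.1 ^ ((z.2 : ℤˣ) : ℤ)

/-- The conditions on the variables under which no denominator vanishes. -/
structure Generic {n : ℕ} (x : Fin n → F) : Prop where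
  ne_zero : ∀ i, x i ≠ 0
  injective : Function.Injective x
  mul_ne_one : ∀ i j, x i * x j ≠ 1
  mul_ne_neg_one : ∀ i j, x i * x j ≠ -1
  add_ne_zero : ∀ i j, x i + x j ≠ 0

theorem Generic.comp {m n : ℕ} {x : Fin n → F} (hx : Generic x) {e : Fin m → Fin n}
    (he : Function.Injective e) : Generic (x ∘ e) where
  ne_zero _ := hx.ne_zero _
  injective := hx.injective.comp he
  mul_ne_one _ _ := hx.mul_ne_one _ _
  mul_ne_neg_one _ _ := hx.mul_ne_neg_one _ _
  add_ne_zero _ _ := hx.add_ne_zero _ _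

theorem Generic.succAbove {n : ℕ} {x : Fin (n + 1) → F} (hx : Generic x) (i : Fin (n + 1)) :
    Generic (x ∘ i.succAbove) := hx.comp Fin.succAbove_right_injective

/-- The inversion of the alphabet. -/
def conj {n : ℕ} : Fin n × ℤˣ ≃ Fin n × ℤˣ where
  toFun z := (z.1, -z.2)
  invFun z := (z.1, -z.2)
  left_inv z := by simp
  right_inv z := by simp

theorem pt_conj {n : ℕ} (x : Fin n → F) (z : Fin n × ℤˣ) : pt x (conj z) = (pt x z)⁻¹ := by
  simp [pt, conj, zpow_neg]

theorem pt_ne_zero {n : ℕ} {x : Fin n → F} (hx : Generic x) (z : Fin n × ℤˣ) : pt x z ≠ 0 :=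
  zpow_ne_zero _ (hx.ne_zero _)

theorem pt_add_ne_zero {n : ℕ} {x : Fin n → F} (hx : Generic x) (z w : Fin n × ℤˣ) :
    pt x z + pt x w ≠ 0 := by
  obtain ⟨i, e⟩ := z
  obtain ⟨j, d⟩ := w
  have hi := hx.ne_zero i
  have hj := hx.ne_zero j
  have h1 := hx.add_ne_zero i j
  have h2 := hx.mul_ne_neg_one i j
  rcases Int.units_eq_one_or e with rfl | rfl <;> rcases Int.units_eq_one_or d with rfl | rfl <;>
    simp only [pt, Units.val_one, Units.val_neg, zpow_one, zpow_neg] <;> intro h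
  · exact h1 h
  · field_simp at h; exact h2 (by linear_combination h)
  · field_simp at h; exact h2 (by linear_combination h)
  · field_simp at h; exact h1 (by linear_combination h)

theorem pt_injective {n : ℕ} {x : Fin n → F} (hx : Generic x) : Function.Injective (pt x) := by
  rintro ⟨i, e⟩ ⟨j, d⟩ h
  have hi := hx.ne_zero i
  have hj := hx.ne_zero j
  have h2 := hx.mul_ne_one i j
  have h3 := @hx.injective i j
  rcases Int.units_eq_one_or e with rfl | rfl <;> rcases Int.units_eq_one_or d with rfl | rfl <;>
    simp only [pt, Units.val_one, Units.val_neg, zpow_one, zpow_neg] at h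
  · rw [h3 h]
  · field_simp at h; exact absurd h h2
  · field_simp at h; exact absurd h.symm h2
  · rw [h3 (inv_injective h)]

theorem pt_sub_ne_zero {n : ℕ} {x : Fin n → F} (hx : Generic x) {z w : Fin n × ℤˣ}
    (h : z ≠ w) : pt x z - pt x w ≠ 0 := sub_ne_zero.2 fun e => h (pt_injective hx e)

/-- The function `y + y⁻¹`. -/
def uu (y : F) : F := y + y⁻¹

@[simp]
theorem uu_inv (y : F) : uu y⁻¹ = uu y := by simp [uu, add_comm]

theorem kker_uu {y w : F} (hy : y ≠ 0) (hw : w ≠ 0) :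
    kker (uu y) (uu w) = (w - y) * (w - y⁻¹) / ((w + y) * (w + y⁻¹)) := by
  have h1 : uu w - uu y = (w - y) * (w - y⁻¹) / w := by rw [uu, uu]; field_simp; ring
  have h2 : uu w + uu y = (w + y) * (w + y⁻¹) / w := by rw [uu, uu]; field_simp; ring
  rw [kker, h1, h2, div_div_div_cancel_right₀ hw]

theorem uu_add_ne_zero {n : ℕ} {x : Fin n → F} (hx : Generic x) (z w : Fin n × ℤˣ) :
    uu (pt x z) + uu (pt x w) ≠ 0 := by
  have h : uu (pt x z) + uu (pt x w) = (pt x z + pt x w) * (pt x z + pt x (conj w)) / pt x z := by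
    have h1 := pt_ne_zero hx z
    have h2 := pt_ne_zero hx w
    rw [pt_conj, uu, uu]
    field_simp
    ring
  rw [h]
  exact div_ne_zero (mul_ne_zero (pt_add_ne_zero hx _ _) (pt_add_ne_zero hx _ _))
    (pt_ne_zero hx z)

theorem uu_ne_zero {n : ℕ} {x : Fin n → F} (hx : Generic x) (z : Fin n × ℤˣ) :
    uu (pt x z) ≠ 0 := fun h => uu_add_ne_zero hx z z (by rw [h, add_zero])

/-- The embedding of the alphabet without `x_i^{±1}`. -/
def skip {n : ℕ} (i : Fin (n + 1)) (w : Fin n × ℤˣ) : Fin (n + 1) × ℤˣ := (i.succAbove w.1, w.2)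

theorem skip_injective {n : ℕ} (i : Fin (n + 1)) : Function.Injective (skip i) := by
  rintro ⟨a, e⟩ ⟨b, d⟩ h
  simp only [skip, Prod.mk.injEq] at h
  rw [Fin.succAbove_right_injective h.1, h.2]

theorem pt_skip {n : ℕ} (x : Fin (n + 1) → F) (i : Fin (n + 1)) (w : Fin n × ℤˣ) :
    pt x (skip i w) = pt (x ∘ i.succAbove) w := rfl

theorem mem_range_skip {n : ℕ} (i : Fin (n + 1)) (z : Fin (n + 1) × ℤˣ) (h : z.1 ≠ i) :
    ∃ w, skip i w = z := by
  obtain ⟨j, hj⟩ := Fin.exists_succAbove_eq h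
  exact ⟨(j, z.2), by rw [skip, hj]⟩

theorem prod_erase_eq_ite {ι M : Type} [Fintype ι] [DecidableEq ι] [CommMonoid M] (a : ι)
    (h : ι → M) : ∏ v ∈ Finset.univ.erase a, h v = ∏ v, if v = a then 1 else h v := by
  rw [← Finset.mul_prod_erase Finset.univ _ (Finset.mem_univ a), if_pos rfl, one_mul]
  exact Finset.prod_congr rfl fun v hv => by rw [if_neg (Finset.ne_of_mem_erase hv)]

theorem prod_skip {n : ℕ} {M : Type} [CommMonoid M] (i : Fin (n + 1))
    (h : Fin (n + 1) × ℤˣ → M) :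
    ∏ v, h v = h (i, 1) * h (i, -1) * ∏ v, h (skip i v) := by
  rw [Fintype.prod_prod_type, Fin.prod_univ_succAbove _ i, units_prod, Fintype.prod_prod_type]
  rfl

theorem prod_erase_skip {n : ℕ} {M : Type} [CommMonoid M] (i : Fin (n + 1))
    (w : Fin n × ℤˣ) (h : Fin (n + 1) × ℤˣ → M) :
    ∏ v ∈ Finset.univ.erase (skip i w), h v =
      h (i, 1) * h (i, -1) * ∏ v ∈ Finset.univ.erase w, h (skip i v) := by
  have hne : ∀ e : ℤˣ, (i, e) ≠ skip i w := fun e h' =>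
    Fin.succAbove_ne i w.1 (congrArg Prod.fst h').symm
  rw [prod_erase_eq_ite, prod_skip i, if_neg (hne _), if_neg (hne _), prod_erase_eq_ite]
  simp only [(skip_injective i).eq_iff]

theorem prod_erase_self {n : ℕ} {M : Type} [CommMonoid M] (i : Fin (n + 1)) (e : ℤˣ)
    (h : Fin (n + 1) × ℤˣ → M) :
    ∏ v ∈ Finset.univ.erase (i, e), h v =
      h (i, -e) * ∏ v, h (skip i v) := by
  have hne : ∀ v, skip i v ≠ (i, e) := fun v h' => Fin.succAbove_ne i v.1 (congrArg Prod.fst h')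
  rw [prod_erase_eq_ite, prod_skip i]
  simp only [hne, if_false]
  congr 1
  rcases Int.units_eq_one_or e with rfl | rfl <;> simp
 
/-- The product `∏ (z - t w) / (z - w)` over the letters `w` other than `z`. -/
def letterCoeff {n : ℕ} (t : F) (x : Fin n → F) (z : Fin n × ℤˣ) : F :=
  ∏ w ∈ Finset.univ.erase z, (pt x z - t * pt x w) / (pt x z - pt x w)

/-- The residue `2 ∏ (z + w) / (z - w)` of the generating function of the `q_r` at `z`. -/
def cc {n : ℕ} (x : Fin n → F) (z : Fin n × ℤˣ) : F := 2 * letterCoeff (-1) x z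

theorem letterCoeff_skip {n : ℕ} (t : F) (x : Fin (n + 1) → F) (i : Fin (n + 1))
    (w : Fin n × ℤˣ) : letterCoeff t x (skip i w) =
      (pt x (skip i w) - t * x i) / (pt x (skip i w) - x i) *
      ((pt x (skip i w) - t * (x i)⁻¹) / (pt x (skip i w) - (x i)⁻¹)) *
      letterCoeff t (x ∘ i.succAbove) w := by
  have p1 : pt x (i, 1) = x i := by simp [pt]
  have p2 : pt x (i, -1) = (x i)⁻¹ := by simp [pt]
  rw [letterCoeff, prod_erase_skip, p1, p2]
  rfl

theorem cc_skip {n : ℕ} {x : Fin (n + 1) → F} (hx : Generic x) (i : Fin (n + 1)) (e : ℤˣ)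
    (w : Fin n × ℤˣ) :
    cc x (skip i w) * kker (uu (pt x (i, e))) (uu (pt x (skip i w))) =
      cc (x ∘ i.succAbove) w := by
  have hu : uu (pt x (i, e)) = uu (x i) := by
    rcases Int.units_eq_one_or e with rfl | rfl <;> simp [pt]
  have hw := pt_ne_zero hx (skip i w)
  have hne : ∀ e : ℤˣ, skip i w ≠ (i, e) := fun e h' =>
    Fin.succAbove_ne i w.1 (congrArg Prod.fst h')
  have h1 := pt_sub_ne_zero hx (hne 1)
  have h2 := pt_sub_ne_zero hx (hne (-1))
  have h3 := pt_add_ne_zero hx (skip i w) (i, 1)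
  have h4 := pt_add_ne_zero hx (skip i w) (i, -1)
  have p1 : pt x (i, 1) = x i := by simp [pt]
  have p2 : pt x (i, -1) = (x i)⁻¹ := by simp [pt]
  rw [p1] at h1 h3
  rw [p2] at h2 h4
  rw [hu, kker_uu (hx.ne_zero i) hw, cc, letterCoeff_skip, cc]
  have hi := hx.ne_zero i
  generalize pt x (skip i w) = y at *
  generalize (x i)⁻¹ = v at *
  simp only [neg_mul, one_mul, sub_neg_eq_add]
  field_simp

theorem kker_uu_same {n : ℕ} (x : Fin n → F) (i : Fin n) (e d : ℤˣ) :
    kker (uu (pt x (i, e))) (uu (pt x (i, d))) = 0 := by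
  have hu : ∀ e : ℤˣ, uu (pt x (i, e)) = uu (x i) := fun e => by
    rcases Int.units_eq_one_or e with rfl | rfl <;> simp [pt]
  rw [hu, hu, kker_self]

theorem cc_conj {n : ℕ} {x : Fin n → F} (hx : Generic x) (z : Fin n × ℤˣ) :
    cc x (conj z) = -cc x z := by
  obtain ⟨i, e⟩ := z
  cases n with
  | zero => exact i.elim0
  | succ n =>
    have hc : conj (i, e) = (i, -e) := rfl
    rw [cc, cc, letterCoeff, letterCoeff, hc, prod_erase_self, prod_erase_self, neg_neg]
    have hcc : ∀ v, skip i (conj v) = conj (skip i v) := fun _ => rfl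
    rw [← Equiv.prod_comp conj fun v => (pt x (i, -e) - -1 * pt x (skip i v)) /
      (pt x (i, -e) - pt x (skip i v))]
    have hz := pt_ne_zero hx (i, e)
    have hne : ∀ v, skip i v ≠ (i, e) := fun v h' =>
      Fin.succAbove_ne i v.1 (congrArg Prod.fst h')
    have h1 : ∀ v, (pt x (i, -e) - -1 * pt x (skip i (conj v))) /
        (pt x (i, -e) - pt x (skip i (conj v))) =
        -((pt x (i, e) - -1 * pt x (skip i v)) / (pt x (i, e) - pt x (skip i v))) := by
      intro v
      have hv := pt_ne_zero hx (skip i v)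
      have h2 := pt_sub_ne_zero hx (hne v)
      have h3 := pt_sub_ne_zero hx (hne v).symm
      rw [hcc, pt_conj, ← hc, pt_conj]
      have h4 : (pt x (i, e))⁻¹ - (pt x (skip i v))⁻¹ ≠ 0 := by
        rw [inv_sub_inv hz hv]; exact div_ne_zero h2 (mul_ne_zero hz hv)
      rw [← neg_sub, neg_ne_zero] at h2
      field_simp
      rw [div_eq_iff (by rwa [← neg_sub, neg_ne_zero])]
      ring
    simp only [h1, Finset.prod_neg]
    have h5 : (-1 : F) ^ (Finset.univ : Finset (Fin n × ℤˣ)).card = 1 := by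
      have : (Finset.univ : Finset (Fin n × ℤˣ)).card = n * 2 := by simp
      rw [this, mul_comm, pow_mul]; simp
    rw [h5, one_mul, ← hc, pt_conj]
    have h6 : (pt x (i, e))⁻¹ - pt x (i, e) ≠ 0 := by
      rw [← pt_conj, hc]
      refine pt_sub_ne_zero hx fun h => ?_
      have := congrArg Prod.snd h
      simp at this
    have h7 : ((pt x (i, e))⁻¹ - -1 * pt x (i, e)) / ((pt x (i, e))⁻¹ - pt x (i, e)) =
      -((pt x (i, e) - -1 * (pt x (i, e))⁻¹) / (pt x (i, e) - (pt x (i, e))⁻¹)) := by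
      rw [← div_neg, neg_sub]
      congr 1
      ring
    rw [h7]
    ring

/-- Sums of an even function against the residues vanish. -/
theorem sum_cc_mul_even [CharZero F] {n : ℕ} {x : Fin n → F} (hx : Generic x)
    (h : Fin n × ℤˣ → F) (hh : ∀ z, h (conj z) = h z) : ∑ z, cc x z * h z = 0 := by
  have h1 := Equiv.sum_comp conj fun z => cc x z * h z
  simp only [cc_conj hx, hh, neg_mul, Finset.sum_neg_distrib] at h1
  exact self_eq_neg.1 h1.symm

/-! ### The symmetrization over distinct letters -/

/-- The sum over sequences of letters which computes the `Q`-functions in `n` variables. -/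
def Phi {l n : ℕ} (x : Fin n → F) (f : Fin l → F → F) : F :=
  ∑ ζ : Fin l → Fin n × ℤˣ, (∏ i, cc x (ζ i) * f i (pt x (ζ i))) *
    kprod fun i => uu (pt x (ζ i))

theorem Phi_zero {n : ℕ} (x : Fin n → F) (f : Fin 0 → F → F) : Phi x f = 1 := by
  simp [Phi, kprod]

theorem Phi_cons_aux {l n : ℕ} (x : Fin n → F) (f : Fin (l + 1) → F → F) :
    Phi x f = ∑ z, ∑ ζ : Fin l → Fin n × ℤˣ, cc x z * f 0 (pt x z) *
      ((∏ i, cc x (ζ i) * kker (uu (pt x z)) (uu (pt x (ζ i))) * f i.succ (pt x (ζ i))) *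
        kprod fun i => uu (pt x (ζ i))) := by
  rw [Phi, ← (Fin.consEquiv fun _ => Fin n × ℤˣ).sum_comp, Fintype.sum_prod_type]
  refine Finset.sum_congr rfl fun z _ => Finset.sum_congr rfl fun ζ _ => ?_
  have h1 : (fun i => uu (pt x ((Fin.consEquiv fun _ => Fin n × ℤˣ) (z, ζ) i))) =
      (Fin.cons (uu (pt x z)) (fun i => uu (pt x (ζ i))) : Fin (l + 1) → F) := by
    funext i
    refine Fin.cases ?_ (fun i => ?_) i <;> simp [Fin.consEquiv]
  rw [h1, kprod_cons, Fin.prod_univ_succ]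
  simp only [Fin.consEquiv, Equiv.coe_fn_mk, Fin.cons_zero, Fin.cons_succ,
    Finset.prod_mul_distrib]
  ring

theorem Phi_succ {l n : ℕ} {x : Fin (n + 1) → F} (hx : Generic x) (f : Fin (l + 1) → F → F) :
    Phi x f = ∑ i, ∑ e, cc x (i, e) * f 0 (pt x (i, e)) *
      Phi (x ∘ i.succAbove) fun j => f j.succ := by
  rw [Phi_cons_aux, Fintype.sum_prod_type]
  refine Finset.sum_congr rfl fun i _ => Finset.sum_congr rfl fun e _ => ?_
  rw [← Finset.mul_sum]
  congr 1
  symm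
  refine Fintype.sum_of_injective (fun ζ : Fin l → Fin n × ℤˣ => skip i ∘ ζ)
    ((skip_injective i).comp_left) _ _ ?_ ?_
  · intro ζ hζ
    by_cases h : ∀ j, (ζ j).1 ≠ i
    · refine absurd ?_ hζ
      choose ξ hξ using fun j => mem_range_skip i (ζ j) (h j)
      exact ⟨ξ, funext hξ⟩
    · push Not at h
      obtain ⟨j, hj⟩ := h
      rw [Finset.prod_eq_zero (Finset.mem_univ j), zero_mul]
      have : ζ j = (i, (ζ j).2) := by rw [← hj]
      rw [this, kker_uu_same, mul_zero, zero_mul]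
  · intro ζ
    simp only [Function.comp_apply, cc_skip hx]
    rfl

theorem Phi_eq_zero {l n : ℕ} {x : Fin n → F} (hx : Generic x) (f : Fin l → F → F)
    (h : n < l) : Phi x f = 0 := by
  induction l generalizing n with
  | zero => omega
  | succ l ih =>
    cases n with
    | zero => rw [Phi_cons_aux]; simp
    | succ n =>
      rw [Phi_succ hx]
      refine Finset.sum_eq_zero fun i _ => Finset.sum_eq_zero fun e _ => ?_
      rw [ih (hx.succAbove i) _ (by omega), mul_zero]

theorem Phi_one {n : ℕ} (x : Fin n → F) (g : F → F) :
    Phi x ![g] = ∑ z, cc x z * g (pt x z) := by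
  rw [Phi_cons_aux]
  refine Finset.sum_congr rfl fun z _ => ?_
  simp [kprod]

theorem Phi_two {n : ℕ} (x : Fin n → F) (g h : F → F) :
    Phi x ![g, h] = ∑ z, ∑ w, cc x z * g (pt x z) * (cc x w * h (pt x w)) *
      kker (uu (pt x z)) (uu (pt x w)) := by
  rw [Phi_cons_aux]
  refine Finset.sum_congr rfl fun z _ => ?_
  rw [← (Equiv.funUnique (Fin 1) (Fin n × ℤˣ)).symm.sum_comp]
  refine Finset.sum_congr rfl fun w _ => ?_
  simp [kprod]
  ring

end Alphabet

/-! ### The Pfaffian formula -/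

section Pfaffian

/-- The skew-symmetric matrix of size `2 ⌈l/2⌉` with entries `E λ_i λ_j` above the diagonal. -/
def skewMatrix {A : Type} [Ring A] {l : ℕ} (p : Fin l → ℕ) (E : ℕ → ℕ → A) :
    Matrix (Fin (2 * ((l + 1) / 2))) (Fin (2 * ((l + 1) / 2))) A :=
  Matrix.of fun i j =>
    if i < j then E (entry p i) (entry p j)
    else if j < i then -E (entry p j) (entry p i)
    else 0

@[to_additive]
theorem prod_fin_even {M : Type} [CommMonoid M] {k : ℕ} (h : Fin (2 * k) → M) :
    ∏ j, h j = ∏ i : Fin k, h ⟨2 * i, by omega⟩ * h ⟨2 * i + 1, by omega⟩ := by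
  induction k with
  | zero => rfl
  | succ k ih =>
    have h1 : ∏ j, h j = h ⟨0, by omega⟩ * (h ⟨1, by omega⟩ *
        ∏ j : Fin (2 * k), h ⟨j + 2, by omega⟩) := by
      refine (Fin.prod_univ_succ (n := 2 * k + 1) h).trans ?_
      rw [Fin.prod_univ_succ]
      rfl
    rw [h1, ih, Fin.prod_univ_succ, mul_assoc]
    rfl

theorem prod_sum_pairs {A O : Type} [CommRing A] [Fintype O] {k : ℕ}
    (s : Equiv.Perm (Fin (2 * k))) (G : Fin (2 * k) → O → A) (c : O → O → A) :
    ∏ i : Fin k, ∑ a, ∑ b, G (s ⟨2 * i, by omega⟩) a * G (s ⟨2 * i + 1, by omega⟩) b * c a b =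
    ∑ θ : Fin (2 * k) → O, (∏ j, G j (θ j)) *
      ∏ i : Fin k, c (θ (s ⟨2 * i, by omega⟩)) (θ (s ⟨2 * i + 1, by omega⟩)) := by
  classical
  simp_rw [← Fintype.sum_prod_type']
  rw [Finset.prod_univ_sum, Fintype.piFinset_univ]
  symm
  refine Fintype.sum_bijective (fun (θ : Fin (2 * k) → O) (i : Fin k) =>
    (θ (s ⟨2 * i, by omega⟩), θ (s ⟨2 * i + 1, by omega⟩))) ?_ _ _ ?_
  · rw [Fintype.bijective_iff_injective_and_card]
    constructor
    · intro θ θ' h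
      funext j
      obtain ⟨j, rfl⟩ := s.surjective j
      have h1 := congrFun h ⟨j / 2, by omega⟩
      simp only [Prod.mk.injEq] at h1
      rcases Nat.mod_two_eq_zero_or_one j with h2 | h2
      · have h3 : (⟨2 * (j / 2), by omega⟩ : Fin (2 * k)) = j := Fin.ext (by simp; omega)
        simpa [h3] using h1.1
      · have h3 : (⟨2 * (j / 2) + 1, by omega⟩ : Fin (2 * k)) = j := Fin.ext (by simp; omega)
        simpa [h3] using h1.2
    · simp [pow_mul, sq]
  · intro θ
    rw [← Equiv.prod_comp s, prod_fin_even, ← Finset.prod_mul_distrib]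

theorem kprod_eq_ite {F : Type} [Field F] {n : ℕ} (u : Fin n → F) :
    kprod u = ∏ i, ∏ j, if i < j then kker (u i) (u j) else 1 := by
  refine Finset.prod_congr rfl fun i _ => ?_
  rw [← Finset.prod_filter]
  congr 1
  ext j
  simp

theorem kprod_snoc {F : Type} [Field F] {n : ℕ} (a : F) (v : Fin n → F) :
    kprod (Fin.snoc v a : Fin (n + 1) → F) = kprod v * ∏ j, kker (v j) a := by
  rw [kprod_eq_ite, kprod_eq_ite, Fin.prod_univ_castSucc]
  simp only [Fin.prod_univ_castSucc]
  simp [Finset.prod_mul_distrib, Fin.castSucc_lt_last, (Fin.castSucc_lt_last _).not_gt]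

variable {F : Type} [Field F]

/-- The weight of a row of the Pfaffian at a letter; the additional letter `none` carries the
last row in odd size. -/
def rowWeight {l n : ℕ} (x : Fin n → F) (f : Fin l → F → F) (i : ℕ)
    (ζ : Option (Fin n × ℤˣ)) : F :=
  if h : i < l then ζ.elim 0 fun z => cc x z * f ⟨i, h⟩ (pt x z) else ζ.elim (-1) 0

/-- The value of `y + y⁻¹` at a letter, and `0` at the additional letter. -/
def letterValue {n : ℕ} (x : Fin n → F) (ζ : Option (Fin n × ℤˣ)) : F :=
  ζ.elim 0 fun z => uu (pt x z)

theorem kker_zero_right {u : F} (hu : u ≠ 0) : kker u 0 = -1 := by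
  rw [kker, zero_sub, zero_add, neg_div, div_self hu]

theorem sum_rowWeight {l n m : ℕ} {x : Fin n → F} (hx : Generic x) (f : Fin l → F → F)
    (hm : m = l ∨ m = l + 1 ∧ Odd l) :
    ∑ θ : Fin m → Option (Fin n × ℤˣ), (∏ j : Fin m, rowWeight x f j (θ j)) *
      kprod (fun i => letterValue x (θ i)) = Phi x f := by
  symm
  rcases hm with rfl | ⟨rfl, hl⟩
  · refine Fintype.sum_of_injective (fun ζ : Fin m → Fin n × ℤˣ => Option.some ∘ ζ)
      (Option.some_injective _).comp_left _ _ ?_ ?_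
    · intro θ hθ
      by_cases h : ∀ j, (θ j).isSome
      · refine absurd ?_ hθ
        exact ⟨fun j => (θ j).get (h j), by funext j; simp⟩
      · push Not at h
        obtain ⟨j, hj⟩ := h
        have hj' : θ j = none := by simpa using hj
        rw [Finset.prod_eq_zero (Finset.mem_univ j), zero_mul]
        simp [rowWeight, hj']
    · intro ζ
      simp [rowWeight, letterValue]
  · refine Fintype.sum_of_injective (fun ζ : Fin l → Fin n × ℤˣ =>
      (Fin.snoc (Option.some ∘ ζ) none : Fin (l + 1) → Option (Fin n × ℤˣ))) ?_ _ _ ?_ ?_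
    · intro ζ ζ' h
      exact (Option.some_injective _).comp_left (Fin.snoc_inj.1 h).1
    · intro θ hθ
      by_cases h : ∀ j : Fin l, (θ j.castSucc).isSome
      · by_cases h' : θ (Fin.last l) = none
        · refine absurd ?_ hθ
          refine ⟨fun j => (θ j.castSucc).get (h j), ?_⟩
          funext j
          refine Fin.lastCases ?_ (fun j => ?_) j
          · simp [h']
          · simp
        · obtain ⟨z, hz⟩ := Option.ne_none_iff_exists'.1 h'
          rw [Finset.prod_eq_zero (Finset.mem_univ (Fin.last l)), zero_mul]
          simp [rowWeight, hz]
      · push Not at h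
        obtain ⟨j, hj⟩ := h
        have hj' : θ j.castSucc = none := by simpa using hj
        rw [Finset.prod_eq_zero (Finset.mem_univ j.castSucc), zero_mul]
        simp [rowWeight, hj']
    · intro ζ
      have h1 : (fun i => letterValue x ((Fin.snoc (Option.some ∘ ζ) none :
          Fin (l + 1) → Option (Fin n × ℤˣ)) i)) =
          (Fin.snoc (fun i => uu (pt x (ζ i))) 0 : Fin (l + 1) → F) := by
        funext j
        refine Fin.lastCases ?_ (fun j => ?_) j <;> simp [letterValue]
      rw [h1, kprod_snoc, Fin.prod_univ_castSucc]
      simp only [kker_zero_right (uu_ne_zero hx _)]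
      simp [rowWeight, hl.neg_one_pow]

/-- The Pfaffian formula for the symmetrizations. -/
theorem pfaffian_skewMatrix [CharZero F] [Algebra ℚ F] {l n : ℕ} {x : Fin n → F}
    (hx : Generic x) (p : Fin l → ℕ) (g : ℕ → F → F) (E : ℕ → ℕ → F)
    (hE₁ : ∀ i, E (p i) 0 = Phi x ![g (p i)])
    (hE₂ : ∀ i j, i < j → E (p i) (p j) = Phi x ![g (p i), g (p j)]) :
    pfaffian (skewMatrix p E) = Phi x fun i => g (p i) := by
  set f : Fin l → F → F := fun i => g (p i) with hf
  set k := (l + 1) / 2 with hk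
  let M : ℕ → ℕ → F := fun i j => ∑ ζ, ∑ η, rowWeight x f i ζ * rowWeight x f j η *
    kker (letterValue x ζ) (letterValue x η)
  have hanti : ∀ i j, M j i = -M i j := by
    intro i j
    simp only [M]
    rw [Finset.sum_comm, ← Finset.sum_neg_distrib]
    refine Finset.sum_congr rfl fun ζ _ => ?_
    rw [← Finset.sum_neg_distrib]
    refine Finset.sum_congr rfl fun η _ => ?_
    rw [kker_antisymm]
    ring
  have hlt : ∀ i j : ℕ, i < j → j < 2 * k → E (entry p i) (entry p j) = M i j := by
    intro i j hij hj
    have hi : i < l := by omega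
    by_cases hjl : j < l
    · simp only [entry, hi, hjl, dif_pos]
      rw [hE₂ _ _ (by simpa using hij), Phi_two]
      simp only [M, Fintype.sum_option]
      simp [rowWeight, hi, hjl, letterValue, hf]
    · simp only [entry, hi, hjl, dif_pos, dif_neg, not_false_eq_true]
      rw [hE₁, Phi_one]
      simp only [M, Fintype.sum_option]
      simp [rowWeight, hi, hjl, letterValue, hf, kker_zero_right (uu_ne_zero hx _)]
  have hM : ∀ i j : Fin (2 * k), skewMatrix p E i j = M i j := by
    intro i j
    simp only [skewMatrix, Matrix.of_apply]
    split_ifs with h1 h2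
    · exact hlt i j h1 j.2
    · rw [hlt j i h2 i.2, hanti, neg_neg]
    · have : i = j := le_antisymm (not_lt.1 h2) (not_lt.1 h1)
      rw [this]
      exact (self_eq_neg.1 (hanti j j)).symm
  have hu : ∀ ζ η : Option (Fin n × ℤˣ), letterValue x ζ ≠ letterValue x η →
      letterValue x ζ + letterValue x η ≠ 0 := by
    intro ζ η h
    rcases ζ with _ | z <;> rcases η with _ | w
    · exact absurd rfl h
    · simpa [letterValue] using uu_ne_zero hx w
    · simpa [letterValue] using uu_ne_zero hx z
    · exact uu_add_ne_zero hx z w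
  have key : ∑ s : Equiv.Perm (Fin (2 * k)), ((Equiv.Perm.sign s : ℤˣ) : ℤ) •
      ∏ i : Fin k, skewMatrix p E (s ⟨2 * i, by omega⟩) (s ⟨2 * i + 1, by omega⟩) =
      2 ^ k * k.factorial * Phi x f := by
    have h1 : ∀ s : Equiv.Perm (Fin (2 * k)), ((Equiv.Perm.sign s : ℤˣ) : ℤ) •
      ∏ i : Fin k, skewMatrix p E (s ⟨2 * i, by omega⟩) (s ⟨2 * i + 1, by omega⟩) =
      ∑ θ : Fin (2 * k) → Option (Fin n × ℤˣ), (∏ j : Fin (2 * k), rowWeight x f j (θ j)) *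
        ((((Equiv.Perm.sign s : ℤˣ) : ℤ) : F) * ∏ i : Fin k,
          kker (letterValue x (θ (s ⟨2 * i, by omega⟩)))
            (letterValue x (θ (s ⟨2 * i + 1, by omega⟩)))) := by
      intro s
      rw [zsmul_eq_mul]
      simp only [hM, M]
      rw [prod_sum_pairs s (fun j => rowWeight x f j)
        (fun a b => kker (letterValue x a) (letterValue x b)), Finset.mul_sum]
      exact Finset.sum_congr rfl fun θ _ => by ring
    rw [Finset.sum_congr rfl fun s _ => h1 s, Finset.sum_comm,
      ← sum_rowWeight (m := 2 * k) hx f (by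
        rcases Nat.even_or_odd l with h | h
        · left; obtain ⟨r, hr⟩ := h; omega
        · right; refine ⟨?_, h⟩; obtain ⟨r, hr⟩ := h; omega), Finset.mul_sum]
    refine Finset.sum_congr rfl fun θ _ => ?_
    rw [← Finset.mul_sum, sum_sign_prod_kker (fun i => letterValue x (θ i)) fun i j => hu _ _]
    ring
  have hc : ((2 ^ k * k.factorial : ℚ)⁻¹) • (2 ^ k * (k.factorial : F) * Phi x f) = Phi x f := by
    have : (2 ^ k * (k.factorial : F) * Phi x f) = (2 ^ k * k.factorial : ℚ) • Phi x f := by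
      rw [Algebra.smul_def]; simp
    rw [this, smul_smul, inv_mul_cancel₀ (by positivity), one_smul]
  rw [pfaffian]
  refine Eq.trans ?_ hc
  rw [← key]

end Pfaffian

/-! ### The Hall-Littlewood symmetrization -/

section Symmetrization

variable {F : Type} [Field F]

theorem Generic.map {F' : Type} [Field F'] (φ : F →+* F') {n : ℕ} {x : Fin n → F}
    (hx : Generic x) : Generic fun i => φ (x i) where
  ne_zero i := by simpa using hx.ne_zero i
  injective i j h := hx.injective (φ.injective h)
  mul_ne_one i j h := hx.mul_ne_one i j (φ.injective (by simpa using h))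
  mul_ne_neg_one i j h := hx.mul_ne_neg_one i j (φ.injective (by simpa using h))
  add_ne_zero i j h := hx.add_ne_zero i j (φ.injective (by simpa using h))

theorem pt_map {F' : Type} [Field F'] (φ : F →+* F') {n : ℕ} (x : Fin n → F)
    (z : Fin n × ℤˣ) : pt (fun i => φ (x i)) z = φ (pt x z) := by
  simp [pt, map_zpow₀]

theorem facMonomial_map {F' : Type} [Field F'] (φ : F →+* F') (a : ℕ → F) (y : F) (r : ℕ) :
    facMonomial (fun k => φ (a k)) (φ y) r = φ (facMonomial a y r) := by
  simp [facMonomial, map_prod]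

/-- The factor of the symmetrization that involves two letters. -/
def hlPair (t y w : F) : F :=
  ((1 - t * y⁻¹ * w) / (1 - y⁻¹ * w)) * ((1 - t * y⁻¹ * w⁻¹) / (1 - y⁻¹ * w⁻¹))

theorem one_sub_div {y : F} (hy : y ≠ 0) (t w : F) :
    (1 - t * y⁻¹ * w) / (1 - y⁻¹ * w) = (y - t * w) / (y - w) := by
  rw [← mul_div_mul_left _ _ hy]
  congr 1 <;> field_simp

theorem hlTerm_cons {n : ℕ} (a : ℕ → F) (t : F) (p : Fin (n + 1) → ℕ) (y : F)
    (v : Fin n → F) :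
    hlTerm a t p (Fin.cons y v : Fin (n + 1) → F) =
      facMonomial a y (p 0) * ((1 - t * (y ^ 2)⁻¹) / (1 - (y ^ 2)⁻¹) * ∏ j, hlPair t y (v j)) *
        hlTerm a t (Fin.tail p) v := by
  rw [hlTerm, hlTerm]
  have h := prod_Ioi_cons (fun y w : F => hlPair t y w) y v
  simp only [hlPair] at h ⊢
  rw [h, Fin.prod_univ_succ, Fin.prod_univ_succ]
  simp only [Fin.cons_zero, Fin.cons_succ, Fin.tail]
  ring

theorem letterCoeff_eq {n : ℕ} {x : Fin (n + 1) → F} (hx : Generic x) (t : F)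
    (i : Fin (n + 1)) (e : ℤˣ) :
    letterCoeff t x (i, e) =
      (1 - t * (pt x (i, e) ^ 2)⁻¹) / (1 - (pt x (i, e) ^ 2)⁻¹) *
        ∏ j, hlPair t (pt x (i, e)) (x (i.succAbove j)) := by
  have hy := pt_ne_zero hx (i, e)
  rw [letterCoeff, prod_erase_self, Fintype.prod_prod_type]
  congr 1
  · have : pt x (i, -e) = (pt x (i, e))⁻¹ := pt_conj x (i, e)
    rw [this, ← one_sub_div hy, sq, mul_inv, mul_assoc]
  · refine Finset.prod_congr rfl fun j _ => ?_
    rw [units_prod, hlPair, one_sub_div hy, one_sub_div hy]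
    simp [skip, pt]

theorem hlPair_zpow (t y w : F) (e : ℤˣ) : hlPair t y (w ^ ((e : ℤˣ) : ℤ)) = hlPair t y w := by
  rcases Int.units_eq_one_or e with rfl | rfl
  · simp
  · simp [hlPair, mul_comm]

theorem hlSum_succ {n : ℕ} {x : Fin (n + 1) → F} (hx : Generic x) (a : ℕ → F) (t : F)
    (p : Fin (n + 1) → ℕ) :
    hlSum a t p x = ∑ i, ∑ e, facMonomial a (pt x (i, e)) (p 0) * letterCoeff t x (i, e) *
      hlSum a t (Fin.tail p) (x ∘ i.succAbove) := by
  rw [hlSum, sum_perm_succ fun s => ∑ ε : Fin (n + 1) → ℤˣ,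
    hlTerm a t p fun i => x (s i) ^ ((ε i : ℤˣ) : ℤ)]
  refine Finset.sum_congr rfl fun i _ => ?_
  have h1 : ∀ s : Equiv.Perm (Fin n), ∑ ε : Fin (n + 1) → ℤˣ, hlTerm a t p (fun j =>
      x ((Fin.cons i (i.succAbove ∘ s) : Fin (n + 1) → Fin (n + 1)) j) ^ ((ε j : ℤˣ) : ℤ)) =
      ∑ e : ℤˣ, ∑ ε : Fin n → ℤˣ, facMonomial a (pt x (i, e)) (p 0) * letterCoeff t x (i, e) *
        hlTerm a t (Fin.tail p) fun j => (x ∘ i.succAbove) (s j) ^ ((ε j : ℤˣ) : ℤ) := by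
    intro s
    rw [← (Fin.consEquiv fun _ => ℤˣ).sum_comp, Fintype.sum_prod_type]
    refine Finset.sum_congr rfl fun e _ => Finset.sum_congr rfl fun ε _ => ?_
    have h2 : (fun j => x ((Fin.cons i (i.succAbove ∘ s) : Fin (n + 1) → Fin (n + 1)) j) ^
        ((((Fin.consEquiv fun _ => ℤˣ) (e, ε)) j : ℤˣ) : ℤ)) =
        (Fin.cons (pt x (i, e)) (fun j => (x ∘ i.succAbove) (s j) ^ ((ε j : ℤˣ) : ℤ)) :
          Fin (n + 1) → F) := by
      funext j
      refine Fin.cases ?_ (fun j => ?_) j <;> simp [Fin.consEquiv, pt]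
    rw [h2, hlTerm_cons, letterCoeff_eq hx]
    simp only [hlPair_zpow]
    rw [Equiv.prod_comp s fun j => hlPair t (pt x (i, e)) ((x ∘ i.succAbove) j)]
    rfl
  rw [Finset.sum_congr rfl fun s _ => h1 s, Finset.sum_comm]
  refine Finset.sum_congr rfl fun e _ => ?_
  rw [hlSum, Finset.mul_sum]
  refine Finset.sum_congr rfl fun s _ => ?_
  rw [Finset.mul_sum]

theorem sum_letterCoeff {n : ℕ} {x : Fin n → F} (hx : Generic x) {t : F} (ht : t ≠ 1) :
    ∑ i, ∑ e, letterCoeff t x (i, e) = ∑ k ∈ Finset.range (2 * n), t ^ k := by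
  rw [← Fintype.sum_prod_type']
  have h := sum_prod_sub_div t ht (pt x) Finset.univ (pt_injective hx).injOn
  rw [Finset.card_univ, Fintype.card_prod, Fintype.card_fin, Fintype.card_units_int,
    mul_comm] at h
  exact h

/-- Macdonald's identity: the symmetrization of the empty partition. -/
theorem hlSum_zero {n : ℕ} {x : Fin n → F} (hx : Generic x) (a : ℕ → F) {t : F} (ht : t ≠ 1) :
    hlSum a t (fun _ => 0) x =
      ∏ i ∈ Finset.Icc 1 n, ∑ k ∈ Finset.range (2 * i), t ^ k := by
  induction n with
  | zero => simp [hlSum, hlTerm]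
  | succ n ih =>
    have h0 : (Fin.tail fun _ => 0 : Fin n → ℕ) = fun _ => 0 := rfl
    rw [hlSum_succ hx, Finset.prod_Icc_succ_top (by omega), ← sum_letterCoeff hx ht,
      Finset.mul_sum]
    refine Finset.sum_congr rfl fun i _ => ?_
    rw [Finset.mul_sum]
    refine Finset.sum_congr rfl fun e _ => ?_
    rw [h0, ih (hx.succAbove i)]
    simp [facMonomial, mul_comm]

theorem entry_succ {l : ℕ} (p : Fin (l + 1) → ℕ) (i : ℕ) :
    entry p (i + 1) = entry (Fin.tail p) i := by
  simp [entry, Fin.tail]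

open Polynomial in
theorem exists_hlSum_eq {n : ℕ} {x : Fin n → F} (hx : Generic x) (a : ℕ → F) {l : ℕ}
    (hl : l ≤ n) (p : Fin l → ℕ) :
    ∃ P : F[X], hlSum (fun k => RatFunc.C (a k)) RatFunc.X (fun i : Fin n => entry p i)
        (fun i => RatFunc.C (x i)) =
      (∏ i ∈ Finset.Icc 1 (n - l), ∑ k ∈ Finset.range (2 * i), (RatFunc.X : RatFunc F) ^ k) *
        algebraMap F[X] (RatFunc F) P ∧
      2 ^ l * P.eval (-1) = Phi x fun i y => facMonomial a y (p i) := by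
  induction l generalizing n with
  | zero =>
    refine ⟨1, ?_, ?_⟩
    · have h0 : (fun i : Fin n => entry p i) = fun _ => 0 := by
        funext i; simp [entry]
      have hX : (RatFunc.X : RatFunc F) ≠ 1 := by
        rw [← RatFunc.algebraMap_X, ← map_one (algebraMap F[X] (RatFunc F))]
        exact fun h => Polynomial.X_ne_C 1 (RatFunc.algebraMap_injective F h)
      rw [h0, hlSum_zero (hx.map RatFunc.C) _ hX]
      simp
    · simp [Phi_zero]
  | succ l ih =>
    obtain ⟨n, rfl⟩ : ∃ m, n = m + 1 := ⟨n - 1, by omega⟩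
    choose P hP hP' using fun i => ih (hx.succAbove i) (by omega) (Fin.tail p)
    let L : Fin (n + 1) × ℤˣ → F[X] := fun z => ∏ w ∈ Finset.univ.erase z,
      Polynomial.C (pt x z - pt x w)⁻¹ *
        (Polynomial.C (pt x z) - Polynomial.X * Polynomial.C (pt x w))
    have hL : ∀ z, algebraMap F[X] (RatFunc F) (L z) =
        letterCoeff RatFunc.X (fun i => RatFunc.C (x i)) z := by
      intro z
      simp only [L, letterCoeff, map_prod, map_mul, map_sub, RatFunc.algebraMap_C,
        RatFunc.algebraMap_X, pt_map, map_inv₀]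
      exact Finset.prod_congr rfl fun w _ => by rw [div_eq_mul_inv, mul_comm]
    have hL' : ∀ z, (L z).eval (-1) = letterCoeff (-1) x z := by
      intro z
      simp only [L, letterCoeff, Polynomial.eval_prod, Polynomial.eval_mul, Polynomial.eval_C,
        Polynomial.eval_sub, Polynomial.eval_X]
      exact Finset.prod_congr rfl fun w _ => by rw [div_eq_mul_inv, mul_comm]
    refine ⟨∑ i, ∑ e, Polynomial.C (facMonomial a (pt x (i, e)) (p 0)) * L (i, e) * P i,
      ?_, ?_⟩
    · have ht : (Fin.tail fun i : Fin (n + 1) => entry p i) =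
          fun i : Fin n => entry (Fin.tail p) i := by
        funext i
        simp only [Fin.tail, Fin.val_succ]
        exact entry_succ p i
      have h0 : entry p ((0 : Fin (n + 1)) : ℕ) = p 0 := by simp [entry]
      rw [hlSum_succ (hx.map RatFunc.C), ht, map_sum, Finset.mul_sum]
      refine Finset.sum_congr rfl fun i _ => ?_
      rw [map_sum, Finset.mul_sum]
      refine Finset.sum_congr rfl fun e _ => ?_
      have h1 := hP i
      simp only [Function.comp_def] at h1 ⊢
      rw [h1, h0, map_mul, map_mul, hL, RatFunc.algebraMap_C, pt_map, facMonomial_map,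
        Nat.add_sub_add_right]
      ring
    · rw [Phi_succ hx, Polynomial.eval_finsetSum, Finset.mul_sum]
      refine Finset.sum_congr rfl fun i _ => ?_
      rw [Polynomial.eval_finsetSum, Finset.mul_sum]
      refine Finset.sum_congr rfl fun e _ => ?_
      have h2 := hP' i
      simp only [Fin.tail] at h2
      rw [← h2, Polynomial.eval_mul, Polynomial.eval_mul, hL', Polynomial.eval_C, cc, pow_succ]
      ring

end Symmetrization

/-! ### The norm -/

theorem card_entry_eq_zero {l n : ℕ} {p : Fin l → ℕ} (hp : ∀ i, 0 < p i) :
    (Finset.univ.filter fun j : Fin n => entry p j = 0).card = n - l := by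
  have h : (Finset.univ.filter fun j : Fin n => entry p j = 0) =
      Finset.univ.filter fun j : Fin n => l ≤ (j : ℕ) := by
    refine Finset.filter_congr fun j _ => ?_
    simp only [entry]
    split_ifs with h
    · simp [(hp ⟨j, h⟩).ne', h]
    · simpa using h
  rw [h]
  have h2 := Fin.card_filter_val_lt (n := n) (m := l)
  have h3 := Finset.card_filter_add_card_filter_not (s := (Finset.univ : Finset (Fin n)))
    (fun j => (j : ℕ) < l)
  simp only [not_lt, Finset.card_univ, Fintype.card_fin] at h3
  omega

theorem hlNorm_entry {F : Type} [Field F] {l n : ℕ} {p : Fin l → ℕ} (t : F)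
    (hp : ∀ i, 0 < p i) (hinj : Function.Injective p) :
    hlNorm t (fun i : Fin n => entry p i) =
      ∏ i ∈ Finset.Icc 1 (n - l), ∑ k ∈ Finset.range (2 * i), t ^ k := by
  rw [hlNorm, card_entry_eq_zero hp]
  refine (congrArg _ ?_).trans (mul_one _)
  refine Finset.prod_eq_one fun r hr => ?_
  obtain ⟨hr0, hr⟩ := Finset.mem_erase.1 hr
  obtain ⟨j, -, hj⟩ := Finset.mem_image.1 hr
  have h : (Finset.univ.filter fun j : Fin n => entry p j = r) = {j} := by
    ext i
    simp only [Finset.mem_filter, Finset.mem_univ, true_and, Finset.mem_singleton]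
    constructor
    · intro hi
      rw [← hj] at hi hr0
      simp only [entry] at hi hr0
      split_ifs at hi hr0 with h1 h2
      · have := hinj hi
        simp only [Fin.mk.injEq] at this
        exact Fin.ext this
      all_goals simp_all
    · rintro rfl; exact hj
  rw [h]
  simp

theorem geomProd_ne_zero {K : Type} [Field K] (m : ℕ) :
    ∏ i ∈ Finset.Icc 1 m, ∑ k ∈ Finset.range (2 * i), (RatFunc.X : RatFunc K) ^ k ≠ 0 := by
  refine Finset.prod_ne_zero_iff.2 fun i hi h => ?_
  have h1 := (Finset.mem_Icc.1 hi).1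
  have h2 : algebraMap (Polynomial K) (RatFunc K)
      (∑ k ∈ Finset.range (2 * i), Polynomial.X ^ k) = 0 := by
    rw [map_sum, ← h]
    simp
  have h3 := (map_eq_zero_iff _ (RatFunc.algebraMap_injective K)).1 h2
  have h4 := congrArg (fun P => Polynomial.coeff P 0) h3
  simp only [Polynomial.finsetSum_coeff, Polynomial.coeff_X_pow, Polynomial.coeff_zero] at h4
  rw [Finset.sum_eq_single 0 (by intro b _ hb; rw [if_neg (Ne.symm hb)])
    (by simp; omega)] at h4
  simp at h4

/-! ### The field of rational functions -/

theorem generic_RF (R : Type) [CommRing R] [IsDomain R] [CharZero R] (n : ℕ) :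
    Generic (RF.x R n) := by
  have hinj := IsFractionRing.injective (MvPolynomial (Fin n) R) (RF R n)
  refine ⟨fun i h => ?_, fun i j h => ?_, fun i j h => ?_, fun i j h => ?_, fun i j h => ?_⟩
  · exact MvPolynomial.X_ne_zero i ((map_eq_zero_iff _ hinj).1 h)
  · exact MvPolynomial.X_injective (hinj h)
  · rw [RF.x, RF.x, ← map_mul, ← map_one (algebraMap (MvPolynomial (Fin n) R) (RF R n))] at h
    have := congrArg (MvPolynomial.aeval (fun _ => (0 : R))) (hinj h)
    simp at this
  · rw [RF.x, RF.x, ← map_mul, ← map_one (algebraMap (MvPolynomial (Fin n) R) (RF R n)),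
      ← map_neg] at h
    have := congrArg (MvPolynomial.aeval (fun _ => (0 : R))) (hinj h)
    simp at this
  · rw [RF.x, RF.x, ← map_add, map_eq_zero_iff _ hinj] at h
    have := congrArg (MvPolynomial.aeval (fun _ => (1 : R))) h
    simp only [map_add, MvPolynomial.aeval_X, map_zero] at this
    norm_num at this

theorem facSympQ_eq {R : Type} [CommRing R] [IsDomain R] [CharZero R] (n : ℕ) (a : ℕ → R)
    {l : ℕ} {p : Fin l → ℕ} (hp : ∀ i, 0 < p i) (hinj : Function.Injective p) :
    facSympQ n a p = Phi (RF.x R n) fun i y =>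
      facMonomial (fun k => algebraMap R (RF R n) (a k)) y (p i) := by
  have hx := generic_RF R n
  rw [facSympQ]
  split_ifs with h
  · obtain ⟨P, h1, h2⟩ := exists_hlSum_eq hx (fun k => algebraMap R (RF R n) (a k)) h p
    rw [facHL, h1, hlNorm_entry _ hp hinj, mul_div_cancel_left₀ _ (geomProd_ne_zero _),
      RatFunc.eval_algebraMap, ← h2, Polynomial.eval₂_id]
    rfl
  · rw [Phi_eq_zero hx _ (not_le.1 h)]

/-! ### Specializations of symmetric functions -/

section Specialization

variable {R : Type} [CommRing R] {F : Type} [Field F] [Algebra R F]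

/-- The specialization `f ↦ f (x_0, ..., x_{n-1}, x_0⁻¹, ..., x_{n-1}⁻¹, 0, ...)`. -/
def pr {n : ℕ} (x : Fin n → F) : SymFun R →ₐ[R] F :=
  (MvPolynomial.aeval (Sum.elim x fun i => (x i)⁻¹)).comp (toPoly R n)

theorem proj_eq_pr (R : Type) [CommRing R] [IsDomain R] (n : ℕ) :
    proj R n = pr (RF.x R n) := rfl

theorem coe_toPoly (n : ℕ) (f : SymFun R) :
    ((toPoly R n f : MvPolynomial (Fin n ⊕ Fin n) R) : MvPowerSeries (Fin n ⊕ Fin n) R) =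
      MvPowerSeries.killCompl (alphabet n) (f : MvPowerSeries ℕ R) := by
  have h := congrArg Subtype.val (AlgEquiv.apply_symm_apply
    (AlgEquiv.ofInjective _ (coe_injective R (Fin n ⊕ Fin n)))
    (((MvPowerSeries.killCompl (alphabet n)).comp (SymFun R).val).codRestrict _
      (killCompl_mem_range (alphabet n)) f))
  rw [AlgEquiv.ofInjective_apply] at h
  rw [MvPolynomial.coeToMvPowerSeries.algHom_apply, Algebra.algebraMap_self,
    MvPowerSeries.map_id] at h
  exact h

theorem coeff_toPoly (n : ℕ) (f : SymFun R) (m : Fin n ⊕ Fin n →₀ ℕ) :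
    (toPoly R n f).coeff m =
      MvPowerSeries.coeff (m.embDomain (alphabet n)) (f : MvPowerSeries ℕ R) := by
  rw [← MvPolynomial.coeff_coe, coe_toPoly, MvPowerSeries.coeff_killCompl]

theorem coeff_q (r : ℕ) (m : ℕ →₀ ℕ) :
    MvPowerSeries.coeff m (q R r : MvPowerSeries ℕ R) =
      if m.degree = r then 2 ^ m.support.card else 0 := rfl

theorem toPoly_q (n r : ℕ) : toPoly R n (q R r) =
    ∑ m ∈ (Finset.univ : Finset (Fin n ⊕ Fin n)).finsuppAntidiag r,
      MvPolynomial.monomial m (2 ^ m.support.card) := by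
  ext m
  have h1 : (m.embDomain (alphabet n)).degree = m.degree := by
    rw [Finsupp.embDomain_eq_mapDomain, Finsupp.degree_mapDomain]
  rw [coeff_toPoly, coeff_q, h1, Finsupp.support_embDomain, Finset.card_map,
    MvPolynomial.coeff_sum]
  simp only [MvPolynomial.coeff_monomial, Finset.sum_ite_eq', Finset.mem_finsuppAntidiag,
    Finset.subset_univ, and_true, Finsupp.degree_eq_sum]

/-- The power series `(1 + y T) / (1 - y T)`. -/
def qSeries (y : F) : PowerSeries F := PowerSeries.mk fun k => if k = 0 then 1 else 2 * y ^ k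

theorem one_sub_mul_mk_pow (y : F) :
    (1 - PowerSeries.C y * PowerSeries.X) * PowerSeries.mk (fun k => y ^ k) = 1 := by
  ext k
  rw [sub_mul, one_mul, mul_assoc, map_sub, PowerSeries.coeff_C_mul]
  cases k with
  | zero => simp
  | succ k => rw [PowerSeries.coeff_succ_X_mul]; simp [pow_succ, PowerSeries.coeff_one]; ring

theorem qSeries_eq (y : F) : qSeries y =
    algebraMap F (PowerSeries F) (-1) + (1 - -1 : F) • PowerSeries.mk (fun k => y ^ k) := by
  ext k
  rw [PowerSeries.algebraMap_apply]
  simp only [qSeries, PowerSeries.coeff_mk, map_add, PowerSeries.coeff_smul, smul_eq_mul,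
    Algebra.algebraMap_self, RingHom.id_apply, PowerSeries.coeff_C]
  split_ifs with h
  · rw [h]; ring
  · ring

theorem one_sub_mul_qSeries (y : F) :
    (1 - PowerSeries.C y * PowerSeries.X) * qSeries y = 1 + PowerSeries.C y * PowerSeries.X := by
  rw [qSeries_eq, mul_add, mul_smul_comm, one_sub_mul_mk_pow, Algebra.smul_def]
  simp
  ring

theorem qSeries_mul_neg (y : F) : qSeries y * qSeries (-y) = 1 := by
  have h1 := one_sub_mul_qSeries y
  have h2 := one_sub_mul_qSeries (-y)
  have hne : ∀ y : F, (1 - PowerSeries.C y * PowerSeries.X : PowerSeries F) ≠ 0 := fun y h => by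
    have := one_sub_mul_mk_pow y
    rw [h, zero_mul] at this
    exact zero_ne_one this
  refine mul_left_cancel₀ (mul_ne_zero (hne y) (hne (-y))) ?_
  rw [mul_one, mul_mul_mul_comm, h1, h2, map_neg]
  ring

/-- The generating function of the specializations of the `q_r`. -/
def qGen {n : ℕ} (x : Fin n → F) : PowerSeries F := ∏ z, qSeries (pt x z)

theorem pr_q {n : ℕ} (x : Fin n → F) (r : ℕ) :
    pr x (q R r) = PowerSeries.coeff r (qGen x) := by
  have h1 : qGen x = ∏ i : Fin n ⊕ Fin n, qSeries (Sum.elim x (fun i => (x i)⁻¹) i) := by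
    rw [qGen, Fintype.prod_prod_type, Fintype.prod_sum_type, ← Finset.prod_mul_distrib]
    refine Finset.prod_congr rfl fun i _ => ?_
    rw [units_prod]
    simp [pt]
  rw [h1, PowerSeries.coeff_prod, pr, AlgHom.comp_apply, toPoly_q, map_sum]
  refine Finset.sum_congr rfl fun m _ => ?_
  rw [MvPolynomial.aeval_monomial, Finsupp.prod, map_pow, map_ofNat, ← Finset.prod_const,
    ← Finset.prod_mul_distrib]
  refine Finset.prod_subset_one_on_sdiff (Finset.subset_univ _) ?_ ?_
  · intro i hi
    have : m i = 0 := by simpa using hi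
    simp [qSeries, this]
  · intro i hi
    have : m i ≠ 0 := by simpa using hi
    simp [qSeries, this]

theorem pr_q_eq_sum {n : ℕ} {x : Fin n → F} (hx : Generic x) {r : ℕ} (hr : r ≠ 0) :
    pr x (q R r) = ∑ z, cc x z * pt x z ^ r := by
  have h := prod_partialFractions (-1 : F) (pt x) Finset.univ (pt_injective hx).injOn
    (PowerSeries F) (fun z => PowerSeries.mk fun k => pt x z ^ k) (by
      intro i _ j _ _
      have hi := one_sub_mul_mk_pow (pt x i)
      have hj := one_sub_mul_mk_pow (pt x j)
      simp only [Algebra.smul_def, PowerSeries.algebraMap_apply, Algebra.algebraMap_self,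
        RingHom.id_apply, map_sub]
      linear_combination (PowerSeries.C (pt x i) * PowerSeries.mk fun k => pt x i ^ k) * hj -
        (PowerSeries.C (pt x j) * PowerSeries.mk fun k => pt x j ^ k) * hi)
  simp only [← qSeries_eq] at h
  rw [pr_q, qGen, h, PowerSeries.algebraMap_apply]
  simp only [map_add, PowerSeries.coeff_C, hr, if_false, zero_add, PowerSeries.coeff_smul,
    map_sum, PowerSeries.coeff_mk, smul_eq_mul, Finset.mul_sum]
  refine Finset.sum_congr rfl fun z _ => ?_
  rw [cc, letterCoeff]
  ring

/-! ### The functions with one and two parts -/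

/-- The functions `q_r`, continued to an odd function of `r ∈ ℤ`. -/
def qOdd (R : Type) [CommRing R] (e : ℤ) : SymFun R :=
  if 0 < e then q R e.toNat else if e < 0 then -q R (-e).toNat else 0

theorem pr_qOdd [CharZero F] {n : ℕ} {x : Fin n → F} (hx : Generic x) (e : ℤ) :
    pr x (qOdd R e) = ∑ z, cc x z * pt x z ^ e := by
  rw [qOdd]
  split_ifs with h1 h2
  · obtain ⟨r, rfl⟩ := Int.eq_ofNat_of_zero_le h1.le
    rw [Int.toNat_natCast, pr_q_eq_sum hx (by omega)]
    simp
  · obtain ⟨r, hr⟩ := Int.eq_ofNat_of_zero_le (by omega : 0 ≤ -e)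
    rw [map_neg, hr, Int.toNat_natCast, pr_q_eq_sum hx (by omega), ← Equiv.sum_comp conj,
      ← Finset.sum_neg_distrib]
    have he : e = -(r : ℤ) := by omega
    refine Finset.sum_congr rfl fun z _ => ?_
    rw [cc_conj hx, pt_conj, he, zpow_neg, zpow_natCast, inv_pow]
    ring
  · have he : e = 0 := by omega
    rw [map_zero, he, sum_cc_mul_even hx _ (by simp)]

/-- The number `2` to the number of variables in `x ^ k`. -/
def two0 (k : ℕ) : ℤ := if k = 0 then 1 else 2

theorem coeff_qSeries (y : F) (k : ℕ) :
    PowerSeries.coeff k (qSeries y) = (two0 k : F) * y ^ k := by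
  rw [qSeries, PowerSeries.coeff_mk, two0]
  split_ifs with h <;> simp [h]

/-- The universal symplectic `Q`-function of a sequence with two entries `r` and `s ≠ 0`. -/
def uTwo (R : Type) [CommRing R] (r s : ℕ) : SymFun R :=
  ∑ c ∈ Finset.HasAntidiagonal.antidiagonal s, q R c.1 * ∑ d ∈ Finset.HasAntidiagonal.antidiagonal c.2,
    (two0 d.1 * two0 d.2 * (-1) ^ c.2) • qOdd R (r + d.1 - d.2)

theorem sum_cc_kker [CharZero F] {n : ℕ} {x : Fin n → F} (hx : Generic x) {s : ℕ} (hs : s ≠ 0)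
    (z : Fin n × ℤˣ) :
    ∑ w, cc x w * pt x w ^ s * kker (uu (pt x z)) (uu (pt x w)) =
      PowerSeries.coeff s (qGen x * (qSeries (-pt x z) * qSeries (-(pt x z)⁻¹))) := by
  obtain ⟨i, e⟩ := z
  cases n with
  | zero => exact i.elim0
  | succ n =>
    have hG : qGen x * (qSeries (-pt x (i, e)) * qSeries (-(pt x (i, e))⁻¹)) =
        qGen (x ∘ i.succAbove) := by
      have h1 : qGen x = qSeries (pt x (i, e)) * qSeries (pt x (i, e))⁻¹ *
          qGen (x ∘ i.succAbove) := by
        rw [qGen, prod_skip i, ← units_prod' (fun e => qSeries (pt x (i, e))) e,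
          show (i, -e) = conj (i, e) from rfl, pt_conj]
        rfl
      have h2 := qSeries_mul_neg (pt x (i, e))
      have h3 := qSeries_mul_neg (pt x (i, e))⁻¹
      rw [h1]
      linear_combination qGen (x ∘ i.succAbove) * qSeries (pt x (i, e)) * qSeries (-pt x (i, e))
        * h3 + qGen (x ∘ i.succAbove) * h2
    have h2 := pr_q (R := F) (x ∘ i.succAbove) s
    rw [pr_q_eq_sum (hx.succAbove i) hs] at h2
    rw [hG, ← h2]
    symm
    refine Fintype.sum_of_injective (skip i) (skip_injective i) _ _ ?_ ?_
    · intro w hw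
      by_cases h : w.1 = i
      · have : w = (i, w.2) := by rw [← h]
        rw [this, kker_uu_same, mul_zero]
      · exact absurd (mem_range_skip i w h) hw
    · intro w
      rw [← cc_skip hx i e w, pt_skip]
      ring

theorem pr_uTwo [CharZero F] {n : ℕ} {x : Fin n → F} (hx : Generic x) (r : ℕ) {s : ℕ}
    (hs : s ≠ 0) : pr x (uTwo R r s) = Phi x ![fun y => y ^ r, fun y => y ^ s] := by
  have h1 : Phi x ![fun y => y ^ r, fun y => y ^ s] =
      ∑ z, cc x z * pt x z ^ r * PowerSeries.coeff s
        (qGen x * (qSeries (-pt x z) * qSeries (-(pt x z)⁻¹))) := by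
    rw [Phi_two]
    refine Finset.sum_congr rfl fun z _ => ?_
    rw [← sum_cc_kker hx hs, Finset.mul_sum]
    exact Finset.sum_congr rfl fun w _ => by ring
  rw [h1, uTwo, map_sum]
  simp only [PowerSeries.coeff_mul (n := s), Finset.mul_sum]
  rw [Finset.sum_comm]
  refine Finset.sum_congr rfl fun c _ => ?_
  rw [map_sum]
  simp only [map_mul, pr_q, PowerSeries.coeff_mul, Finset.mul_sum]
  rw [Finset.sum_comm]
  refine Finset.sum_congr rfl fun d hd => ?_
  rw [map_zsmul, pr_qOdd hx, zsmul_eq_mul, Finset.mul_sum, Finset.mul_sum]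
  refine Finset.sum_congr rfl fun z _ => ?_
  have hz := pt_ne_zero hx z
  rw [coeff_qSeries, coeff_qSeries, ← Finset.HasAntidiagonal.mem_antidiagonal.1 hd, neg_pow (pt x z),
    neg_pow (pt x z)⁻¹, zpow_sub₀ hz, zpow_add₀ hz]
  push_cast
  simp only [zpow_natCast, inv_pow, pow_add]
  field_simp

/-- The entries of the Pfaffian of a universal symplectic `Q`-function. -/
def uEntry (R : Type) [CommRing R] (r s : ℕ) : SymFun R :=
  if s = 0 then q R r else uTwo R r s

theorem pfaffian_map {A B : Type} [CommRing A] [Algebra ℚ A] [CommRing B] [Algebra ℚ B]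
    (φ : A →+* B) {k : ℕ} (M : Matrix (Fin (2 * k)) (Fin (2 * k)) A) :
    φ (pfaffian M) = pfaffian (M.map φ) := by
  rw [pfaffian, pfaffian, map_rat_smul, map_sum]
  simp only [map_zsmul, map_prod, Matrix.map_apply]

theorem skewMatrix_map {A B : Type} [Ring A] [Ring B] (φ : A →+* B) {l : ℕ} (p : Fin l → ℕ)
    (E : ℕ → ℕ → A) : (skewMatrix p E).map φ = skewMatrix p fun r s => φ (E r s) := by
  ext i j
  simp only [skewMatrix, Matrix.map_apply, Matrix.of_apply]
  split_ifs <;> simp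

theorem pr_pfaffian [CharZero F] [Algebra ℚ (SymFun R)] {l n : ℕ} {x : Fin n → F}
    (hx : Generic x) (p : Fin l → ℕ) (g : ℕ → F → F) (E : ℕ → ℕ → SymFun R)
    (hE₁ : ∀ i, pr x (E (p i) 0) = Phi x ![g (p i)])
    (hE₂ : ∀ i j, i < j → pr x (E (p i) (p j)) = Phi x ![g (p i), g (p j)]) :
    pr x (pfaffian (skewMatrix p E)) = Phi x fun i => g (p i) := by
  have h := pfaffian_map (pr x : SymFun R →ₐ[R] F).toRingHom (skewMatrix p E)
  rw [skewMatrix_map] at h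
  exact h.trans (pfaffian_skewMatrix hx p g _ hE₁ hE₂)

end Specialization

/-- The universal symplectic `Q`-function as a Pfaffian. -/
def univQ (R : Type) [CommRing R] [Algebra ℚ R] {l : ℕ} (p : Fin l → ℕ) : SymFun R :=
  pfaffian (skewMatrix p (uEntry R))

theorem pr_univQ {R : Type} [CommRing R] [Algebra ℚ R] {F : Type} [Field F] [Algebra R F]
    [CharZero F] {l n : ℕ} {x : Fin n → F} (hx : Generic x) {p : Fin l → ℕ}
    (hp : ∀ i, 0 < p i) : pr x (univQ R p) = Phi x fun i y => y ^ p i := by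
  refine pr_pfaffian hx p (fun r y => y ^ r) (uEntry R) (fun i => ?_) (fun i j _ => ?_)
  · rw [uEntry, if_pos rfl, pr_q_eq_sum hx (hp i).ne', Phi_one]
  · rw [uEntry, if_neg (hp j).ne', pr_uTwo hx _ (hp j).ne']

theorem baseChange_q (R : Type) [CommRing R] [Algebra ℚ R] (r : ℕ) :
    SymFun.baseChange R (q ℚ r) = q R r := by
  refine Subtype.ext ?_
  ext m
  change algebraMap ℚ R (if m.degree = r then 2 ^ m.support.card else 0) =
    if m.degree = r then 2 ^ m.support.card else 0
  split_ifs
  · rw [map_pow, map_ofNat]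
  · rw [map_zero]

theorem baseChange_univQ (R : Type) [CommRing R] [Algebra ℚ R] {l : ℕ} (p : Fin l → ℕ) :
    SymFun.baseChange R (univQ ℚ p) = univQ R p := by
  rw [univQ, pfaffian_map, skewMatrix_map, univQ]
  congr 2
  funext r s
  rw [uEntry, uEntry]
  split_ifs
  · exact baseChange_q R r
  · simp only [uTwo, map_sum, map_mul, baseChange_q, map_zsmul]
    refine Finset.sum_congr rfl fun c _ => ?_
    congr 1
    refine Finset.sum_congr rfl fun d _ => ?_
    congr 1
    rw [qOdd, qOdd]
    split_ifs <;> simp [baseChange_q]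

/-! ### Uniqueness -/

section Uniqueness

variable {R : Type} [CommRing R] [IsDomain R]

/-- The exponent of the Laurent monomial of `m`, multiplied by `(x_0 ⋯ x_{n-1}) ^ D`. -/
def shiftExp {n : ℕ} (D : ℕ) (m : Fin n ⊕ Fin n →₀ ℕ) : Fin n →₀ ℕ :=
  Finsupp.equivFunOnFinite.symm fun i => m (Sum.inl i) + (D - m (Sum.inr i))

theorem aeval_monomial_shift {n : ℕ} (D : ℕ) (m : Fin n ⊕ Fin n →₀ ℕ) (hm : m.degree ≤ D)
    (c : R) : (∏ i, RF.x R n i) ^ D *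
      MvPolynomial.aeval (Sum.elim (RF.x R n) fun i => (RF.x R n i)⁻¹)
        (MvPolynomial.monomial m c) =
      algebraMap (MvPolynomial (Fin n) R) (RF R n) (MvPolynomial.monomial (shiftExp D m) c) := by
  have hx : ∀ i, RF.x R n i ≠ 0 := fun i h => MvPolynomial.X_ne_zero i
    ((map_eq_zero_iff _ (IsFractionRing.injective (MvPolynomial (Fin n) R) (RF R n))).1 h)
  have hle : ∀ i, m (Sum.inr i) ≤ D := fun i => (Finsupp.le_degree _ _).trans hm
  rw [MvPolynomial.aeval_monomial, MvPolynomial.monomial_eq, map_mul,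
    Finsupp.prod_fintype _ _ (by simp), Finsupp.prod_fintype _ _ (by simp),
    Fintype.prod_sum_type, map_prod, ← Finset.prod_pow]
  have hC : algebraMap (MvPolynomial (Fin n) R) (RF R n) (MvPolynomial.C c) =
      algebraMap R (RF R n) c := (IsScalarTower.algebraMap_apply R _ (RF R n) c).symm
  rw [hC, mul_left_comm, ← Finset.prod_mul_distrib, ← Finset.prod_mul_distrib]
  congr 1
  refine Finset.prod_congr rfl fun i _ => ?_
  have h1 := pow_sub₀ _ (hx i) (hle i)
  simp only [Sum.elim_inl, Sum.elim_inr, shiftExp, Finsupp.equivFunOnFinite_symm_apply_apply,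
    pow_add, map_mul, map_pow]
  change _ = RF.x R n i ^ _ * RF.x R n i ^ _
  rw [h1, inv_pow]
  ring

theorem degree_sum_type {n : ℕ} (m : Fin n ⊕ Fin n →₀ ℕ) :
    m.degree = ∑ i, m (Sum.inl i) + ∑ i, m (Sum.inr i) := by
  rw [Finsupp.degree_eq_sum, Fintype.sum_sum_type]

theorem coeff_eq_zero_of_aeval {n D : ℕ} (P : MvPolynomial (Fin n ⊕ Fin n) R)
    (hP : ∀ m, D < m.degree → P.coeff m = 0)
    (h : MvPolynomial.aeval (Sum.elim (RF.x R n) fun i => (RF.x R n i)⁻¹) P = 0)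
    (m₀ : Fin n ⊕ Fin n →₀ ℕ) (hm₀ : m₀.degree = D) (hm₀' : ∀ i, m₀ (Sum.inr i) = 0) :
    P.coeff m₀ = 0 := by
  have hD : ∀ m ∈ P.support, m.degree ≤ D := fun m hm => by
    by_contra hlt
    exact MvPolynomial.mem_support_iff.1 hm (hP m (not_le.1 hlt))
  have h1 : ∑ m ∈ P.support, MvPolynomial.monomial (shiftExp D m) (P.coeff m) = 0 := by
    refine (map_eq_zero_iff _ (IsFractionRing.injective (MvPolynomial (Fin n) R) (RF R n))).1 ?_
    rw [map_sum, Finset.sum_congr rfl fun m hm => (aeval_monomial_shift D m (hD m hm) _).symm,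
      ← Finset.mul_sum, ← map_sum, ← MvPolynomial.as_sum, h, mul_zero]
  have h2 := congrArg (MvPolynomial.coeff (shiftExp D m₀)) h1
  rw [MvPolynomial.coeff_sum, MvPolynomial.coeff_zero] at h2
  simp only [MvPolynomial.coeff_monomial] at h2
  rw [Finset.sum_eq_single m₀] at h2
  · simpa using h2
  · intro m hm hne
    refine if_neg fun he => hne ?_
    have h3 : ∀ i, m (Sum.inl i) = m₀ (Sum.inl i) + m (Sum.inr i) := by
      intro i
      have h4 := DFunLike.congr_fun he i
      simp only [shiftExp, Finsupp.equivFunOnFinite_symm_apply_apply, hm₀'] at h4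
      have h5 := (Finsupp.le_degree (Sum.inr i) m).trans (hD m hm)
      omega
    have h4 := hD m hm
    rw [degree_sum_type] at hm₀ h4
    simp only [hm₀', Finset.sum_const_zero, add_zero] at hm₀
    rw [Finset.sum_congr rfl fun i _ => h3 i, Finset.sum_add_distrib, hm₀] at h4
    have h5 : ∑ i, m (Sum.inr i) = 0 := by omega
    have h6 : ∀ i, m (Sum.inr i) = 0 := fun i => by
      simpa using (Finset.sum_eq_zero_iff.1 h5) i (Finset.mem_univ i)
    ext i
    rcases i with i | i
    · rw [h3, h6, add_zero]
    · rw [h6, hm₀']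
  · intro hm
    rw [MvPolynomial.notMem_support_iff.1 hm, ite_self]

theorem exists_embDomain_alphabet (m : ℕ →₀ ℕ) (N : ℕ) :
    ∃ n, N ≤ n ∧ ∃ m' : Fin n ⊕ Fin n →₀ ℕ, m'.embDomain (alphabet n) = m ∧
      ∀ i, m' (Sum.inr i) = 0 := by
  obtain ⟨k, hk⟩ : ∃ k, ∀ i ∈ m.support, i < k :=
    ⟨m.support.sup id + 1, fun i hi => Nat.lt_succ_of_le (Finset.le_sup (f := id) hi)⟩
  let n := max N k
  refine ⟨n, le_max_left _ _, Finsupp.comapDomain (alphabet n) m (alphabet n).injective.injOn,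
    ?_, ?_⟩
  · refine Finsupp.embDomain_comapDomain fun i hi => ?_
    have hin : i < n := (hk i hi).trans_le (le_max_right _ _)
    exact ⟨Sum.inl ⟨i, hin⟩, by simp [alphabet]⟩
  · intro i
    rw [Finsupp.comapDomain_apply]
    by_contra h
    have h1 := hk _ (Finsupp.mem_support_iff.2 h)
    have h2 : (alphabet n (Sum.inr i) : ℕ) = n + i := by simp [alphabet, add_comm]
    have h3 : k ≤ n := le_max_right _ _
    omega

theorem eq_zero_of_proj {f : SymFun R} {N : ℕ} (h : ∀ n, N ≤ n → proj R n f = 0) : f = 0 := by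
  obtain ⟨d, hd⟩ := ((mem_SymFun _).1 f.2).1
  have step : ∀ d : ℕ, (∀ m : ℕ →₀ ℕ, d < m.degree → MvPowerSeries.coeff m f.1 = 0) →
      ∀ m : ℕ →₀ ℕ, m.degree = d → MvPowerSeries.coeff m f.1 = 0 := by
    intro d hd m hm
    obtain ⟨n, hn, m', rfl, hm'⟩ := exists_embDomain_alphabet m N
    have hdeg : ∀ m : Fin n ⊕ Fin n →₀ ℕ, (m.embDomain (alphabet n)).degree = m.degree :=
      fun m => by rw [Finsupp.embDomain_eq_mapDomain, Finsupp.degree_mapDomain]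
    rw [← coeff_toPoly]
    refine coeff_eq_zero_of_aeval (D := d) (toPoly R n f) (fun m hm => ?_) (h n hn) m' ?_ hm'
    · rw [coeff_toPoly]
      exact hd _ (by rwa [hdeg])
    · rw [← hm, hdeg]
  have all : ∀ d : ℕ, (∀ m : ℕ →₀ ℕ, d < m.degree → MvPowerSeries.coeff m f.1 = 0) →
      ∀ m : ℕ →₀ ℕ, MvPowerSeries.coeff m f.1 = 0 := by
    intro d
    induction d with
    | zero =>
      intro hd m
      rcases Nat.eq_zero_or_pos m.degree with h0 | h0
      · exact step 0 hd m h0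
      · exact hd m h0
    | succ d ih =>
      intro hd
      refine ih fun m hm => ?_
      rcases Nat.lt_or_ge (d + 1) m.degree with h0 | h0
      · exact hd m h0
      · exact step (d + 1) hd m (by omega)
  exact Subtype.ext (MvPowerSeries.ext (all d hd))

theorem eq_of_proj {f g : SymFun R} {N : ℕ} (h : ∀ n, N ≤ n → proj R n f = proj R n g) :
    f = g :=
  sub_eq_zero.1 (eq_zero_of_proj (N := N) fun n hn => by rw [map_sub, h n hn, sub_self])

end Uniqueness

/-! ### The universal symplectic functions -/

theorem facMonomial_zero {F : Type} [Field F] (y : F) (r : ℕ) :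
    facMonomial (fun _ => 0) y r = y ^ r := by
  simp [facMonomial]

theorem proj_univQ {R : Type} [CommRing R] [IsDomain R] [CharZero R] [Algebra ℚ R] {l : ℕ}
    {p : Fin l → ℕ} (hp : ∀ i, 0 < p i) (hinj : Function.Injective p) (n : ℕ) :
    proj R n (univQ R p) = facSympQ n (fun _ => (0 : R)) p := by
  rw [facSympQ_eq n _ hp hinj, proj_eq_pr, pr_univQ (generic_RF R n) hp]
  simp only [map_zero, facMonomial_zero]

theorem univSympQ_eq {l : ℕ} {p : Fin l → ℕ} (hp : ∀ i, 0 < p i)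
    (hinj : Function.Injective p) : univSympQ p = univQ ℚ p := by
  have h : ∀ n : ℕ, proj ℚ n (univSympQ p) = facSympQ n (fun _ => (0 : ℚ)) p :=
    Classical.epsilon_spec (p := fun f : SymFun ℚ =>
      ∀ n : ℕ, proj ℚ n f = facSympQ n (fun _ => (0 : ℚ)) p)
      ⟨univQ ℚ p, proj_univQ hp hinj⟩
  exact eq_of_proj (N := 0) fun n _ => by rw [h, proj_univQ hp hinj]

/-! ### The expansion of the factorial functions -/

section Expansion

variable {F : Type} [Field F]

theorem Phi_comp_perm {l n : ℕ} (x : Fin n → F) (f : Fin l → F → F)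
    (s : Equiv.Perm (Fin l)) :
    Phi x (fun i => f (s i)) = ((Equiv.Perm.sign s : ℤˣ) : ℤ) * Phi x f := by
  rw [Phi, Phi, ← (Equiv.arrowCongr s.symm (Equiv.refl (Fin n × ℤˣ))).sum_comp, Finset.mul_sum]
  refine Finset.sum_congr rfl fun ζ _ => ?_
  have h := kprod_comp_perm (fun i => uu (pt x (ζ i))) s
  have h2 := Equiv.prod_comp s fun i => cc x (ζ i) * f i (pt x (ζ i))
  simp only [Equiv.arrowCongr_apply, Equiv.symm_symm, Equiv.coe_refl, Function.comp_apply, id_eq,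
    Function.comp_def] at h ⊢
  rw [h, h2]
  ring

theorem Phi_eq_zero_of_even [CharZero F] {l n : ℕ} {x : Fin n → F} (hx : Generic x)
    (f : Fin l → F → F) (i : Fin l) (hf : ∀ y, f i y⁻¹ = f i y) : Phi x f = 0 := by
  classical
  let e : (Fin l → Fin n × ℤˣ) ≃ (Fin l → Fin n × ℤˣ) :=
    Equiv.piCongrRight fun j => if j = i then conj else Equiv.refl _
  have he : ∀ ζ j, e ζ j = if j = i then conj (ζ j) else ζ j := by
    intro ζ j
    simp only [e, Equiv.piCongrRight_apply, Pi.map_apply]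
    split_ifs <;> rfl
  have h : Phi x f = -Phi x f := by
    conv_lhs => rw [Phi, ← e.sum_comp]
    rw [Phi, ← Finset.sum_neg_distrib]
    refine Finset.sum_congr rfl fun ζ _ => ?_
    have h1 : (fun j => uu (pt x (e ζ j))) = fun j => uu (pt x (ζ j)) := by
      funext j
      rw [he]
      split_ifs
      · rw [pt_conj, uu_inv]
      · rfl
    rw [h1, ← neg_mul]
    congr 1
    rw [← Finset.mul_prod_erase _ _ (Finset.mem_univ i),
      ← Finset.mul_prod_erase _ (fun j => cc x (ζ j) * f j (pt x (ζ j))) (Finset.mem_univ i),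
      he, if_pos rfl, cc_conj hx, pt_conj, hf, neg_mul, neg_mul]
    congr 2
    refine Finset.prod_congr rfl fun j hj => ?_
    rw [he, if_neg (Finset.ne_of_mem_erase hj)]
  exact self_eq_neg.1 h

theorem Phi_eq_zero_of_eq [CharZero F] {l n : ℕ} (x : Fin n → F) (f : Fin l → F → F)
    {i j : Fin l} (hij : i ≠ j) (hf : f i = f j) : Phi x f = 0 := by
  have h := Phi_comp_perm x f (Equiv.swap i j)
  have h1 : (fun k => f (Equiv.swap i j k)) = f := by
    funext k
    rw [Equiv.swap_apply_def]
    split_ifs with h1 h2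
    · rw [h1, hf]
    · rw [h2, hf]
    · rfl
  rw [h1, Equiv.Perm.sign_swap hij] at h
  simp only [Units.val_neg, Units.val_one, Int.cast_neg, Int.cast_one, neg_mul, one_mul] at h
  exact self_eq_neg.1 h

theorem Phi_sum {l n : ℕ} (x : Fin n → F) {κ : Type} (S : Fin l → Finset κ)
    (c : Fin l → κ → F) (g : κ → F → F) :
    Phi x (fun i y => ∑ k ∈ S i, c i k * g k y) =
      ∑ k ∈ Fintype.piFinset S, (∏ i, c i (k i)) * Phi x fun i => g (k i) := by
  simp only [Phi, Finset.mul_sum (Finset.univ : Finset (Fin l → Fin n × ℤˣ))]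
  rw [Finset.sum_comm]
  refine Finset.sum_congr rfl fun ζ _ => ?_
  have h : ∏ i, cc x (ζ i) * ∑ k ∈ S i, c i k * g k (pt x (ζ i)) =
      ∑ k ∈ Fintype.piFinset S, ∏ i, cc x (ζ i) * (c i (k i) * g (k i) (pt x (ζ i))) := by
    simp only [Finset.mul_sum]
    exact Finset.prod_univ_sum S fun i k => cc x (ζ i) * (c i k * g k (pt x (ζ i)))
  rw [h, Finset.sum_mul]
  refine Finset.sum_congr rfl fun k _ => ?_
  simp only [Finset.prod_mul_distrib]
  ring

theorem facMonomial_eq_sum [Algebra Qa F] (y : F) (r : ℕ) :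
    facMonomial (fun k => algebraMap Qa F (MvPolynomial.X k)) y r =
      ∑ k ∈ Finset.range (r + 1), algebraMap Qa F (elemA r (r - k)) * y ^ k := by
  rw [facMonomial, Finset.prod_congr rfl fun i _ => add_comm y _, Finset.prod_add,
    Finset.sum_powerset, Finset.card_range, ← Finset.sum_range_reflect]
  refine Finset.sum_congr rfl fun j hj => ?_
  have hj' := Finset.mem_range.1 hj
  rw [show r + 1 - 1 - j = r - j by omega, elemA, map_sum, Finset.sum_mul]
  refine Finset.sum_congr rfl fun t ht => ?_
  obtain ⟨h1, h2⟩ := Finset.mem_powersetCard.1 ht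
  rw [map_prod, Finset.prod_const, Finset.card_sdiff_of_subset h1, Finset.card_range, h2]
  congr 2
  omega

theorem exists_strictAnti_comp {l : ℕ} {k : Fin l → ℕ} (hk : Function.Injective k) :
    ∃ σ : Equiv.Perm (Fin l), StrictAnti (k ∘ σ) := by
  refine ⟨Tuple.sort fun i => OrderDual.toDual (k i), ?_⟩
  have h := Tuple.monotone_sort fun i => OrderDual.toDual (k i)
  intro i j hij
  exact lt_of_le_of_ne (h hij.le) fun e => hij.ne ((hk.comp (Equiv.injective _)) e).symm

theorem exists_le_perm {l : ℕ} (σ : Equiv.Perm (Fin l)) (i : Fin l) : ∃ j ≤ i, i ≤ σ j := by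
  by_contra! h
  have h1 := Finset.card_le_card_of_injOn (s := Finset.Iic i) (t := Finset.Iio i) σ
    (fun j hj => by simpa using h j (by simpa using hj)) σ.injective.injOn
  simp at h1

theorem mem_subPartitions {l : ℕ} {p m : Fin l → ℕ} :
    m ∈ subPartitions p ↔ (∀ i, 1 ≤ m i ∧ m i ≤ p i) ∧ StrictAnti m := by
  simp [subPartitions]

theorem dCoeff_eq {l : ℕ} (p m : Fin l → ℕ) : dCoeff p m =
    ∑ s : Equiv.Perm (Fin l), ((Equiv.Perm.sign s : ℤˣ) : ℤ) *
      ∏ i, if m (s i) ≤ p i then elemA (p i) (p i - m (s i)) else 0 := by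
  rw [dCoeff, ← Matrix.det_transpose, Matrix.det_apply']
  rfl

theorem Phi_facMonomial [CharZero F] [Algebra Qa F] {l n : ℕ} {x : Fin n → F} (hx : Generic x)
    {p : Fin l → ℕ} (hp : StrictAnti p) :
    Phi x (fun i y => facMonomial (fun k => algebraMap Qa F (MvPolynomial.X k)) y (p i)) =
      ∑ m ∈ subPartitions p, algebraMap Qa F (dCoeff p m) * Phi x fun i y => y ^ m i := by
  classical
  let G : (Fin l → ℕ) → F := fun k =>
    (∏ i, algebraMap Qa F (elemA (p i) (p i - k i))) * Phi x fun i y => y ^ k i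
  have h1 : Phi x (fun i y => facMonomial (fun k => algebraMap Qa F (MvPolynomial.X k)) y (p i)) =
      ∑ k ∈ (Fintype.piFinset fun i => Finset.Icc 1 (p i)).filter Function.Injective, G k := by
    simp only [facMonomial_eq_sum]
    rw [Phi_sum x (fun i => Finset.range (p i + 1))
      (fun i k => algebraMap Qa F (elemA (p i) (p i - k))) (fun k y => y ^ k)]
    symm
    refine Finset.sum_subset ?_ ?_
    · intro k hk
      simp only [Finset.mem_filter, Fintype.mem_piFinset, Finset.mem_Icc, Finset.mem_range] at hk ⊢
      exact fun i => Nat.lt_succ_of_le (hk.1 i).2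
    · intro k hk hk'
      refine mul_eq_zero_of_right _ ?_
      by_cases h0 : ∃ i, k i = 0
      · obtain ⟨i, hi⟩ := h0
        exact Phi_eq_zero_of_even hx _ i (by simp [hi])
      · push Not at h0
        have hinj : ¬ Function.Injective k := fun hinj => hk' <| by
          simp only [Finset.mem_filter, Fintype.mem_piFinset, Finset.mem_Icc,
            Finset.mem_range] at hk ⊢
          exact ⟨fun i => ⟨Nat.one_le_iff_ne_zero.2 (h0 i), Nat.le_of_lt_succ (hk i)⟩, hinj⟩
        obtain ⟨i, j, hij, hne⟩ : ∃ i j, k i = k j ∧ i ≠ j := by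
          simpa [Function.Injective] using hinj
        exact Phi_eq_zero_of_eq x _ hne (by simp only [hij])
  have h2 : ∀ m ∈ subPartitions p, algebraMap Qa F (dCoeff p m) * Phi x (fun i y => y ^ m i) =
      ∑ s : Equiv.Perm (Fin l), if ∀ i, m (s i) ≤ p i then G (m ∘ s) else 0 := by
    intro m _
    rw [dCoeff_eq, map_sum, Finset.sum_mul]
    refine Finset.sum_congr rfl fun s _ => ?_
    split_ifs with h
    · simp only [h, if_true, G, Function.comp_apply, map_mul, map_prod, map_intCast]
      rw [Phi_comp_perm x (fun i y => y ^ m i) s]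
      ring
    · push Not at h
      obtain ⟨i, hi⟩ := h
      rw [Finset.prod_eq_zero (Finset.mem_univ i) (if_neg (not_le.2 hi)), mul_zero, map_zero,
        zero_mul]
  rw [h1, Finset.sum_congr rfl h2, ← Finset.sum_product', ← Finset.sum_filter]
  symm
  refine Finset.sum_bij (fun q _ => q.1 ∘ q.2) ?_ ?_ ?_ (fun _ _ => rfl)
  · rintro ⟨m, s⟩ hq
    simp only [Finset.mem_filter, Finset.mem_product, Finset.mem_univ, and_true,
      mem_subPartitions, Fintype.mem_piFinset, Finset.mem_Icc, Function.comp_apply] at hq ⊢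
    exact ⟨fun i => ⟨(hq.1.1 _).1, hq.2 i⟩, hq.1.2.injective.comp s.injective⟩
  · rintro ⟨m, s⟩ hq ⟨m', s'⟩ hq' h
    simp only [Finset.mem_filter, Finset.mem_product, Finset.mem_univ, and_true,
      mem_subPartitions] at hq hq' h
    have hr : Set.range m = Set.range m' := by
      rw [← s.surjective.range_comp m, h, s'.surjective.range_comp]
    have hm : m = m' := by
      have h3 : StrictMono (m ∘ Fin.rev) := fun i j hij => hq.1.2 (Fin.rev_lt_rev.2 hij)
      have h4 : StrictMono (m' ∘ Fin.rev) := fun i j hij => hq'.1.2 (Fin.rev_lt_rev.2 hij)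
      have h5 := (h3.range_inj h4).1 (by
        rw [Fin.rev_surjective.range_comp, Fin.rev_surjective.range_comp, hr])
      funext i
      simpa using congrFun h5 i.rev
    subst hm
    congr 1
    ext i
    exact congrArg _ (hq.1.2.injective (congrFun h i))
  · intro k hk
    simp only [Finset.mem_filter, Fintype.mem_piFinset, Finset.mem_Icc] at hk
    obtain ⟨σ, hσ⟩ := exists_strictAnti_comp hk.2
    refine ⟨(k ∘ σ, σ⁻¹), ?_, ?_⟩
    · simp only [Finset.mem_filter, Finset.mem_product, Finset.mem_univ, and_true,
        mem_subPartitions, Function.comp_apply]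
      refine ⟨⟨fun i => ⟨(hk.1 _).1, ?_⟩, hσ⟩, fun i => by simpa using (hk.1 i).2⟩
      obtain ⟨j, hj, hj'⟩ := exists_le_perm σ i
      exact (hσ.antitone hj).trans ((hk.1 _).2.trans (hp.antitone hj'))
    · funext i
      simp

end Expansion

/-! ### The universal factorial functions -/

theorem univFacQ_eq {l : ℕ} (p : Fin l → ℕ) :
    univFacQ p = ∑ m ∈ subPartitions p, dCoeff p m • univQ Qa m := by
  rw [univFacQ]
  refine Finset.sum_congr rfl fun m hm => ?_
  rw [mem_subPartitions] at hm
  rw [univSympQ_eq (fun i => (hm.1 i).1) hm.2.injective, baseChange_univQ]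

theorem pr_univFacQ {F : Type} [Field F] [CharZero F] [Algebra Qa F] {l n : ℕ} {x : Fin n → F}
    (hx : Generic x) {p : Fin l → ℕ} (hp : StrictAnti p) :
    pr x (univFacQ p) = Phi x fun i y =>
      facMonomial (fun k => algebraMap Qa F (MvPolynomial.X k)) y (p i) := by
  rw [univFacQ_eq, Phi_facMonomial hx hp, map_sum]
  refine Finset.sum_congr rfl fun m hm => ?_
  rw [mem_subPartitions] at hm
  rw [map_smul, pr_univQ hx fun i => (hm.1 i).1, Algebra.smul_def]

theorem proj_univFacQ {l : ℕ} {p : Fin l → ℕ} (hpos : ∀ i, 0 < p i) (hp : StrictAnti p)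
    (n : ℕ) : proj Qa n (univFacQ p) =
      facSympQ n (fun k => (MvPolynomial.X k : Qa)) p := by
  rw [facSympQ_eq n _ hpos hp.injective, proj_eq_pr, pr_univFacQ (generic_RF Qa n) hp]

theorem univFacQ_eq_pfaffian {l : ℕ} {p : Fin l → ℕ} (hpos : ∀ i, 0 < p i) (hp : StrictAnti p) :
    univFacQ p = pfaffian (schurMatrix p) := by
  refine eq_of_proj (N := 0) fun n _ => ?_
  have hx := generic_RF Qa n
  rw [proj_eq_pr, pr_univFacQ hx hp]
  symm
  refine pr_pfaffian hx p
    (fun r y => facMonomial (fun k => algebraMap Qa (RF Qa n) (MvPolynomial.X k)) y r)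
    univFacQ₂ (fun i => ?_) (fun i j hij => ?_)
  · rw [univFacQ₂, if_pos rfl, pr_univFacQ hx (fun a b h => by omega)]
    congr 1
    funext a
    fin_cases a
    rfl
  · have h2 : StrictAnti ![p i, p j] := by
      intro a b h
      have := hp hij
      fin_cases a <;> fin_cases b <;> simp_all
    rw [univFacQ₂, if_neg (hpos j).ne', pr_univFacQ hx h2]
    congr 1
    funext a
    fin_cases a <;> rfl

/-! ### Leading coefficients -/

section Lead

variable {K L : Type} [Field K] [Field L] {φ : PowerSeries K →+* L}

/-- The constants in a field that contains the power series. -/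
def constL (φ : PowerSeries K →+* L) : K →+* L := φ.comp PowerSeries.C

/-- The parameter of the power series. -/
def tau (φ : PowerSeries K →+* L) : L := φ PowerSeries.X

/-- `f` is `c τ ^ (-N)` up to terms of higher order in `τ`. -/
def Lead (φ : PowerSeries K →+* L) (N : ℕ) (f : L) (c : K) : Prop :=
  ∃ g : PowerSeries K, tau φ ^ N * f = φ g ∧ PowerSeries.constantCoeff g = c

theorem tau_ne_zero (hφ : Function.Injective φ) : tau φ ≠ 0 := by
  rw [tau, Ne, map_eq_zero_iff _ hφ]
  exact PowerSeries.X_ne_zero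

theorem lead_const (c : K) : Lead φ 0 (constL φ c) c :=
  ⟨PowerSeries.C c, by simp [constL], by simp⟩

theorem lead_one : Lead φ 0 (1 : L) 1 := ⟨1, by simp, by simp⟩

theorem lead_tau : Lead φ 0 (tau φ) 0 := ⟨PowerSeries.X, by simp [tau], by simp⟩

theorem lead_tau_inv (hφ : Function.Injective φ) : Lead φ 1 (tau φ)⁻¹ 1 :=
  ⟨1, by rw [pow_one, mul_inv_cancel₀ (tau_ne_zero hφ), map_one], by simp⟩

theorem Lead.mul {N M : ℕ} {f g : L} {c d : K} (hf : Lead φ N f c)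
    (hg : Lead φ M g d) : Lead φ (N + M) (f * g) (c * d) := by
  obtain ⟨f', hf, rfl⟩ := hf
  obtain ⟨g', hg, rfl⟩ := hg
  exact ⟨f' * g', by rw [map_mul, ← hf, ← hg, pow_add]; ring, by rw [map_mul]⟩

theorem Lead.mul_zero_zero {f g : L} {c d : K} (hf : Lead φ 0 f c) (hg : Lead φ 0 g d) :
    Lead φ 0 (f * g) (c * d) := hf.mul hg

theorem Lead.add {N : ℕ} {f g : L} {c d : K} (hf : Lead φ N f c)
    (hg : Lead φ N g d) : Lead φ N (f + g) (c + d) := by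
  obtain ⟨f', hf, rfl⟩ := hf
  obtain ⟨g', hg, rfl⟩ := hg
  exact ⟨f' + g', by rw [map_add, ← hf, ← hg]; ring, by rw [map_add]⟩

theorem Lead.neg {N : ℕ} {f : L} {c : K} (hf : Lead φ N f c) :
    Lead φ N (-f) (-c) := by
  obtain ⟨f', hf, rfl⟩ := hf
  exact ⟨-f', by rw [map_neg, ← hf]; ring, by rw [map_neg]⟩

theorem Lead.sub {N : ℕ} {f g : L} {c d : K} (hf : Lead φ N f c)
    (hg : Lead φ N g d) : Lead φ N (f - g) (c - d) := by
  rw [sub_eq_add_neg, sub_eq_add_neg]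
  exact hf.add hg.neg

theorem Lead.weaken {N M : ℕ} {f : L} {c : K} (hf : Lead φ N f c) (h : N < M) :
    Lead φ M f 0 := by
  obtain ⟨f', hf, rfl⟩ := hf
  refine ⟨PowerSeries.X ^ (M - N) * f', ?_, ?_⟩
  · rw [map_mul, ← hf, map_pow, ← mul_assoc, ← tau, ← pow_add, Nat.sub_add_cancel h.le]
  · rw [map_mul, map_pow, PowerSeries.constantCoeff_X, zero_pow (by omega), zero_mul]

theorem Lead.zero (N : ℕ) : Lead φ N (0 : L) 0 := ⟨0, by simp, by simp⟩

theorem Lead.eq_zero (hφ : Function.Injective φ) {N : ℕ} {c : K} (h : Lead φ N (0 : L) c) : c = 0 := by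
  obtain ⟨g, hg, rfl⟩ := h
  rw [mul_zero, eq_comm, map_eq_zero_iff _ hφ] at hg
  rw [hg, map_zero]

theorem Lead.eq (hφ : Function.Injective φ) {N : ℕ} {f : L} {c d : K} (h : Lead φ N f c) (h' : Lead φ N f d) :
    c = d := by
  have := h.sub h'
  rw [sub_self] at this
  exact sub_eq_zero.1 (this.eq_zero hφ)

theorem Lead.inv {f : L} {c : K} (hf : Lead φ 0 f c) (hc : c ≠ 0) :
    Lead φ 0 f⁻¹ c⁻¹ := by
  obtain ⟨f', hf, rfl⟩ := hf
  rw [pow_zero, one_mul] at hf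
  refine ⟨f'⁻¹, ?_, PowerSeries.constantCoeff_inv f'⟩
  have h1 : f * φ f'⁻¹ = 1 := by
    rw [hf, ← map_mul, PowerSeries.mul_inv_cancel _ hc, map_one]
  rw [pow_zero, one_mul, inv_eq_of_mul_eq_one_right h1]

theorem Lead.div {f g : L} {c d : K} (hf : Lead φ 0 f c) (hg : Lead φ 0 g d)
    (hd : d ≠ 0) : Lead φ 0 (f / g) (c / d) := by
  rw [div_eq_mul_inv, div_eq_mul_inv]
  exact hf.mul (hg.inv hd)

theorem Lead.sum {ι : Type} (s : Finset ι) {N : ℕ} {f : ι → L} {c : ι → K}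
    (h : ∀ i ∈ s, Lead φ N (f i) (c i)) : Lead φ N (∑ i ∈ s, f i) (∑ i ∈ s, c i) := by
  classical
  induction s using Finset.induction_on with
  | empty => exact Lead.zero N
  | insert a s ha ih =>
    rw [Finset.sum_insert ha, Finset.sum_insert ha]
    exact (h a (by simp)).add (ih fun i hi => h i (by simp [hi]))

theorem Lead.prod_one {ι : Type} (s : Finset ι) {f : ι → L}
    (h : ∀ i ∈ s, Lead φ 0 (f i) 1) : Lead φ 0 (∏ i ∈ s, f i) 1 := by
  classical
  induction s using Finset.induction_on with
  | empty => exact lead_one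
  | insert a s ha ih =>
    rw [Finset.prod_insert ha, ← mul_one (1 : K)]
    exact (h a (by simp)).mul (ih fun i hi => h i (by simp [hi]))

/-- The variables `x`, extended by the large variable `τ⁻¹`. -/
def consTau (φ : PowerSeries K →+* L) {n : ℕ} (x : Fin n → K) : Fin (n + 1) → L :=
  Fin.cons (tau φ)⁻¹ fun i => constL φ (x i)

theorem consTau_zero {n : ℕ} (x : Fin n → K) : consTau φ x 0 = (tau φ)⁻¹ := rfl

theorem consTau_succ {n : ℕ} (x : Fin n → K) (i : Fin n) :
    consTau φ x i.succ = constL φ (x i) := rfl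

theorem consTau_succAbove_zero {n : ℕ} (x : Fin n → K) :
    consTau φ x ∘ (0 : Fin (n + 1)).succAbove = fun i => constL φ (x i) := by
  funext i
  simp [consTau]

theorem consTau_succAbove_succ {n : ℕ} (x : Fin (n + 1) → K) (j : Fin (n + 1)) :
    consTau φ x ∘ j.succ.succAbove = consTau φ (x ∘ j.succAbove) := by
  funext i
  refine Fin.cases ?_ (fun i => ?_) i <;> simp [consTau]

theorem tau_mul_ne (hφ : Function.Injective φ) {f : L} {c d : K} (hf : Lead φ 0 f c)
    (hd : d ≠ 0) : tau φ * f ≠ constL φ d := fun h => by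
  have h1 := lead_tau.mul_zero_zero hf
  rw [h, zero_mul] at h1
  exact hd ((lead_const d).eq hφ h1)

theorem Generic.consTau [CharZero K] (hφ : Function.Injective φ) {n : ℕ} {x : Fin n → K}
    (hx : Generic x) : Generic (consTau φ x) := by
  have hC : CharZero L := charZero_of_injective_ringHom (constL φ).injective
  have hx' := hx.map (constL φ)
  have h0 := tau_ne_zero hφ
  have n1 : ∀ {d : K}, d ≠ 0 → tau φ * tau φ ≠ constL φ d := fun hd => tau_mul_ne hφ lead_tau hd
  have n2 : ∀ {y d : K}, d ≠ 0 → tau φ * constL φ y ≠ constL φ d := fun hd =>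
    tau_mul_ne hφ (lead_const _) hd
  have m1 : (-1 : K) ≠ 0 := by simp
  have key : ∀ {y z : L}, (tau φ)⁻¹ * y = z → y = tau φ * z := fun h => by
    rw [← h, mul_inv_cancel_left₀ h0]
  refine ⟨fun i => ?_, ?_, fun i j => ?_, fun i j => ?_, fun i j => ?_⟩
  · refine Fin.cases ?_ (fun i => ?_) i
    · exact inv_ne_zero h0
    · exact hx'.ne_zero i
  · rw [SymplecticQ.consTau, Fin.cons_injective_iff]
    refine ⟨?_, hx'.injective⟩
    rintro ⟨i, hi⟩
    refine n2 (y := x i) one_ne_zero ?_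
    simp only at hi
    rw [hi, mul_inv_cancel₀ h0, map_one]
  · refine Fin.cases ?_ (fun i => ?_) i <;> refine Fin.cases ?_ (fun j => ?_) j <;>
      simp only [consTau_zero, consTau_succ] <;> intro h
    · have := key h
      refine n1 one_ne_zero (d := 1) ?_
      rw [map_one, ← mul_one (tau φ * tau φ), mul_assoc, ← this, mul_inv_cancel₀ h0]
    · refine n2 (hx.ne_zero j) (y := 1) ?_
      rw [key h, map_one]
    · rw [mul_comm] at h
      refine n2 (hx.ne_zero i) (y := 1) ?_
      rw [key h, map_one]
    · exact hx'.mul_ne_one i j h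
  · refine Fin.cases ?_ (fun i => ?_) i <;> refine Fin.cases ?_ (fun j => ?_) j <;>
      simp only [consTau_zero, consTau_succ] <;> intro h
    · have := key h
      refine n1 m1 (d := -1) ?_
      rw [map_neg, map_one, ← mul_inv_cancel₀ h0, this]
      ring
    · refine n2 (hx.ne_zero j) (y := -1) ?_
      rw [key h, map_neg, map_one]
    · rw [mul_comm] at h
      refine n2 (hx.ne_zero i) (y := -1) ?_
      rw [key h, map_neg, map_one]
    · exact hx'.mul_ne_neg_one i j h
  · have h3 : ∀ y : K, (tau φ)⁻¹ + constL φ y ≠ 0 := fun y h => by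
      refine n2 (y := y) m1 ?_
      rw [map_neg, map_one, eq_neg_of_add_eq_zero_right h, mul_neg, mul_inv_cancel₀ h0]
    refine Fin.cases ?_ (fun i => ?_) i <;> refine Fin.cases ?_ (fun j => ?_) j <;>
      simp only [consTau_zero, consTau_succ] <;> intro h
    · rw [← two_mul] at h
      exact mul_ne_zero two_ne_zero (inv_ne_zero h0) h
    · exact h3 _ h
    · exact h3 _ ((add_comm _ _).trans h)
    · exact hx'.add_ne_zero i j h

theorem lead_div_one_sub {f : L} (hf : Lead φ 0 f 0) : Lead φ 0 ((1 - -1 * f) / (1 - f)) 1 := by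
  have h3 := (lead_one.add hf).div (lead_one.sub hf) (by simp)
  rw [add_zero, sub_zero, div_one] at h3
  rwa [neg_mul, one_mul, sub_neg_eq_add]

theorem lead_two : Lead φ 0 (2 : L) 2 := by
  have := lead_const (φ := φ) (2 : K)
  rwa [map_ofNat] at this

theorem lead_cc_zero [CharZero K] (hφ : Function.Injective φ) {n : ℕ} {x : Fin n → K}
    (hx : Generic x) : Lead φ 0 (cc (consTau φ x) (0, 1)) 2 := by
  have hp : pt (consTau φ x) (0, 1) = (tau φ)⁻¹ := by simp [pt, consTau]
  have hpair : ∀ w : K, Lead φ 0 (hlPair (-1) (tau φ)⁻¹ (constL φ w)) 1 := by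
    intro w
    have h0 : ∀ v : K, Lead φ 0 (tau φ * constL φ v) 0 := fun v => by
      have := lead_tau.mul_zero_zero (lead_const (φ := φ) v)
      rwa [zero_mul] at this
    have h1 := (lead_div_one_sub (h0 w)).mul_zero_zero (lead_div_one_sub (h0 w⁻¹))
    rw [mul_one, map_inv₀] at h1
    rwa [hlPair, inv_inv, mul_assoc, mul_assoc]
  have htau : Lead φ 0 ((1 - -1 * tau φ ^ 2) / (1 - tau φ ^ 2)) 1 := by
    have h1 := lead_tau.mul_zero_zero (lead_tau (φ := φ))
    rw [zero_mul, ← sq] at h1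
    exact lead_div_one_sub h1
  have h := lead_two.mul_zero_zero (htau.mul_zero_zero (Lead.prod_one Finset.univ fun j _ =>
    hpair (x j)))
  rw [mul_one, mul_one] at h
  rw [cc, letterCoeff_eq (hx.consTau hφ), hp, inv_pow, inv_inv]
  exact h

theorem exists_lead_cc [CharZero K] (hφ : Function.Injective φ) {n : ℕ} {x : Fin n → K}
    (hx : Generic x) (z : Fin (n + 1) × ℤˣ) : ∃ c, Lead φ 0 (cc (consTau φ x) z) c := by
  obtain ⟨i, e⟩ := z
  refine Fin.cases ?_ (fun i => ?_) i
  · rcases Int.units_eq_one_or e with rfl | rfl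
    · exact ⟨_, lead_cc_zero hφ hx⟩
    · have h : ((0 : Fin (n + 1)), (-1 : ℤˣ)) = conj (0, 1) := rfl
      rw [h, cc_conj (hx.consTau hφ)]
      exact ⟨_, (lead_cc_zero hφ hx).neg⟩
  · have h : (i.succ, e) = skip 0 (i, e) := by simp [skip]
    have hp : pt (consTau φ x) (skip 0 (i, e)) = constL φ (pt x (i, e)) := by
      rw [pt_skip, consTau_succAbove_zero, pt_map]
    have hl : letterCoeff (-1) (fun i => constL φ (x i)) (i, e) =
        constL φ (letterCoeff (-1) x (i, e)) := by
      simp [letterCoeff, pt_map, map_prod]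
    have h0 := tau_ne_zero hφ
    rw [h, cc, letterCoeff_skip, hp, consTau_succAbove_zero, hl, consTau_zero, inv_inv]
    have hy0 : pt x (i, e) ≠ 0 := pt_ne_zero hx _
    generalize pt x (i, e) = y at hy0
    have h1 : (constL φ y - -1 * (tau φ)⁻¹) / (constL φ y - (tau φ)⁻¹) =
        (constL φ y * tau φ + 1) / (constL φ y * tau φ - 1) := by
      rw [← mul_div_mul_right _ _ h0]
      congr 1
      · field_simp; ring
      · field_simp
    have h2 : constL φ y - -1 * tau φ = constL φ y + tau φ := by ring
    rw [h1, h2]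
    have l1 := (lead_const (φ := φ) y).mul_zero_zero lead_tau
    have l2 := (l1.add lead_one).div (l1.sub lead_one) (by simp)
    have l3 := ((lead_const (φ := φ) y).add lead_tau).div ((lead_const y).sub lead_tau)
      (by simpa using hy0)
    exact ⟨_, lead_two.mul_zero_zero ((l2.mul_zero_zero l3).mul_zero_zero (lead_const _))⟩

theorem lead_facMonomial (a : ℕ → K) {y : L} {c : K} (hy : Lead φ 0 y c) (r : ℕ) :
    ∃ d, Lead φ 0 (facMonomial (fun k => constL φ (a k)) y r) d := by
  induction r with
  | zero => exact ⟨1, by simpa [facMonomial] using lead_one⟩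
  | succ r ih =>
    obtain ⟨d, hd⟩ := ih
    rw [facMonomial, Finset.prod_range_succ]
    exact ⟨_, hd.mul_zero_zero (hy.add (lead_const (a r)))⟩

theorem lead_facMonomial_tau (hφ : Function.Injective φ) (a : ℕ → K) (r : ℕ) :
    Lead φ r (facMonomial (fun k => constL φ (a k)) (tau φ)⁻¹ r) 1 := by
  induction r with
  | zero => simpa [facMonomial] using lead_one
  | succ r ih =>
    rw [facMonomial, Finset.prod_range_succ]
    have := ih.mul ((lead_tau_inv hφ).add ((lead_const (a r)).weaken zero_lt_one))
    rwa [add_zero, mul_one] at this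

theorem Phi_map {F F' : Type} [Field F] [Field F'] (φ : F →+* F') {l n : ℕ} (x : Fin n → F)
    (a : ℕ → F) (p : Fin l → ℕ) :
    Phi (fun i => φ (x i)) (fun i y => facMonomial (fun k => φ (a k)) y (p i)) =
      φ (Phi x fun i y => facMonomial a y (p i)) := by
  have hc : ∀ z, cc (fun i => φ (x i)) z = φ (cc x z) := by
    intro z
    rw [cc, cc, map_mul, map_ofNat]
    simp [letterCoeff, pt_map, map_prod]
  simp only [Phi, map_sum, map_mul, map_prod, hc, pt_map, facMonomial_map]
  refine Finset.sum_congr rfl fun ζ _ => ?_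
  congr 1
  simp [kprod, kker, uu, map_prod]

theorem sum_units_split {M : Type} [AddCommMonoid M] {n : ℕ} (h : Fin (n + 1) → ℤˣ → M) :
    ∑ i, ∑ e, h i e = h 0 1 + (h 0 (-1) + ∑ i : Fin n, ∑ e, h i.succ e) := by
  have : (Finset.univ : Finset ℤˣ) = {1, -1} := rfl
  rw [Fin.sum_univ_succ, ← add_assoc, this, Finset.sum_pair (by decide)]

theorem exists_lead_letter [CharZero K] (hφ : Function.Injective φ) (a : ℕ → K) {n : ℕ}
    {x : Fin n → K} (hx : Generic x) {z : Fin (n + 1) × ℤˣ} (hz : z ≠ (0, 1)) (r : ℕ) :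
    ∃ c, Lead φ 0 (cc (consTau φ x) z *
      facMonomial (fun k => constL φ (a k)) (pt (consTau φ x) z) r) c := by
  have h1 : ∃ c, Lead φ 0 (pt (consTau φ x) z) c := by
    obtain ⟨i, e⟩ := z
    induction i using Fin.cases with
    | zero =>
      rcases Int.units_eq_one_or e with rfl | rfl
      · exact absurd rfl hz
      · exact ⟨0, by simpa [pt, consTau] using lead_tau⟩
    | succ i =>
      refine ⟨pt x (i, e), ?_⟩
      have h : (i.succ, e) = skip 0 (i, e) := by simp [skip]
      rw [h, pt_skip, consTau_succAbove_zero, pt_map]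
      exact lead_const _
  obtain ⟨c, hc⟩ := h1
  obtain ⟨d, hd⟩ := lead_facMonomial a hc r
  obtain ⟨c', hc'⟩ := exists_lead_cc hφ hx z
  exact ⟨_, hc'.mul_zero_zero hd⟩

theorem lead_Phi_of_lt [CharZero K] (hφ : Function.Injective φ) (a : ℕ → K) {l n : ℕ}
    {x : Fin n → K} (hx : Generic x) {p : Fin (l + 1) → ℕ} (hpos : 0 < p 0)
    (hlow : ∀ j : Fin n, ∃ M < p 0, ∃ c, Lead φ M (Phi (consTau φ x ∘ j.succ.succAbove)
      fun i y => facMonomial (fun k => constL φ (a k)) y (p i.succ)) c) :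
    Lead φ (p 0) (Phi (consTau φ x) fun i y => facMonomial (fun k => constL φ (a k)) y (p i))
      (2 * Phi x fun i y => facMonomial a y (p i.succ)) := by
  have h0 := Phi_map (constL φ) x a fun i => p i.succ
  have hp : pt (consTau φ x) (0, 1) = (tau φ)⁻¹ := by simp [pt, consTau]
  rw [Phi_succ (hx.consTau hφ), sum_units_split, consTau_succAbove_zero, h0, hp]
  have t1 := ((lead_cc_zero hφ hx).mul (lead_facMonomial_tau hφ a (p 0))).mul
    (lead_const (φ := φ) (Phi x fun i y => facMonomial a y (p i.succ)))
  rw [mul_one, zero_add, add_zero] at t1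
  obtain ⟨c, hc⟩ := exists_lead_letter hφ a hx (z := (0, -1)) (by simp) (p 0)
  have t2 := (hc.mul_zero_zero (lead_const (φ := φ)
    (Phi x fun i y => facMonomial a y (p i.succ)))).weaken hpos
  have t3 : Lead φ (p 0) (∑ j : Fin n, ∑ e : ℤˣ, cc (consTau φ x) (j.succ, e) *
      facMonomial (fun k => constL φ (a k)) (pt (consTau φ x) (j.succ, e)) (p 0) *
      Phi (consTau φ x ∘ j.succ.succAbove)
        fun i y => facMonomial (fun k => constL φ (a k)) y (p i.succ)) 0 := by
    have := Lead.sum (φ := φ) (Finset.univ : Finset (Fin n)) (N := p 0) (c := fun _ => 0)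
      (f := fun j => ∑ e : ℤˣ, cc (consTau φ x) (j.succ, e) *
        facMonomial (fun k => constL φ (a k)) (pt (consTau φ x) (j.succ, e)) (p 0) *
        Phi (consTau φ x ∘ j.succ.succAbove)
          fun i y => facMonomial (fun k => constL φ (a k)) y (p i.succ)) fun j _ => by
      obtain ⟨M, hM, d, hd⟩ := hlow j
      have := Lead.sum (φ := φ) (Finset.univ : Finset ℤˣ) (N := p 0) (c := fun _ => 0)
        (f := fun e => cc (consTau φ x) (j.succ, e) *
          facMonomial (fun k => constL φ (a k)) (pt (consTau φ x) (j.succ, e)) (p 0) *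
          Phi (consTau φ x ∘ j.succ.succAbove)
            fun i y => facMonomial (fun k => constL φ (a k)) y (p i.succ)) fun e _ => by
        obtain ⟨c, hc⟩ := exists_lead_letter hφ a hx (z := (j.succ, e))
          (fun h => Fin.succ_ne_zero j (congrArg Prod.fst h)) (p 0)
        have := hc.mul hd
        rw [zero_add] at this
        exact this.weaken hM
      rwa [Finset.sum_const_zero] at this
    rwa [Finset.sum_const_zero] at this
  have t := t1.add (t2.add t3)
  rwa [add_zero, add_zero] at t

theorem lead_Phi [CharZero K] (hφ : Function.Injective φ) (a : ℕ → K) {l n : ℕ}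
    {x : Fin n → K} (hx : Generic x) {p : Fin (l + 1) → ℕ} (hp : StrictAnti p)
    (hpos : ∀ i, 0 < p i) :
    Lead φ (p 0) (Phi (consTau φ x) fun i y => facMonomial (fun k => constL φ (a k)) y (p i))
      (2 * Phi x fun i y => facMonomial a y (p i.succ)) := by
  induction l generalizing n with
  | zero =>
    exact lead_Phi_of_lt hφ a hx (hpos 0) fun j => ⟨0, hpos 0, 1, by rw [Phi_zero]; exact lead_one⟩
  | succ l ih =>
    refine lead_Phi_of_lt hφ a hx (hpos 0) fun j => ?_
    obtain _ | n := n
    · exact j.elim0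
    · have h := ih (hx.succAbove j) (p := fun i => p i.succ)
        (fun i j h => hp (Fin.succ_lt_succ_iff.2 h)) (fun i => hpos i.succ)
      rw [← consTau_succAbove_succ] at h
      exact ⟨_, hp (Fin.succ_pos 0), _, h⟩

end Lead

/-! ### Linear independence -/

theorem StrictPartition.ext_entry {p r : StrictPartition} (h : p.len = r.len)
    (he : ∀ i, entry p.part i = entry r.part i) : p = r := by
  obtain ⟨l, p, hp, hp'⟩ := p
  obtain ⟨l', r, hr, hr'⟩ := r
  obtain rfl : l = l' := h
  obtain rfl : p = r := by
    funext i
    simpa [entry] using he i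
  rfl

/-- The strict partition without its first part. -/
def StrictPartition.tail (p : StrictPartition) : StrictPartition where
  len := p.len - 1
  part i := p.part ⟨i + 1, by omega⟩
  strictAnti i j h := p.strictAnti (by simpa using h)
  pos i := p.pos _

theorem StrictPartition.entry_tail (p : StrictPartition) (i : ℕ) :
    entry p.tail.part i = entry p.part (i + 1) := by
  have hl : p.tail.len = p.len - 1 := rfl
  rw [entry, entry]
  by_cases h : i + 1 < p.len
  · rw [dif_pos h, dif_pos (by omega)]
    rfl
  · rw [dif_neg h, dif_neg (by omega)]

theorem StrictPartition.entry_pos (p : StrictPartition) (h : p.len ≠ 0) :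
    0 < entry p.part 0 := by
  rw [entry, dif_pos (by omega)]
  exact p.pos _

/-- The symmetrization of the strict partition `p`. -/
def PhiP {K : Type} [Field K] {n : ℕ} (x : Fin n → K) (a : ℕ → K) (p : StrictPartition) : K :=
  Phi x fun i y => facMonomial a y (p.part i)

theorem lead_PhiP {K L : Type} [Field K] [Field L] {φ : PowerSeries K →+* L} [CharZero K]
    (hφ : Function.Injective φ) (a : ℕ → K) {n : ℕ} {x : Fin n → K} (hx : Generic x)
    (p : StrictPartition) (h : p.len ≠ 0) :
    Lead φ (entry p.part 0) (PhiP (consTau φ x) (fun k => constL φ (a k)) p)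
      (2 * PhiP x a p.tail) := by
  obtain ⟨l, p, hp, hp'⟩ := p
  obtain _ | l := l
  · exact absurd rfl h
  · exact lead_Phi hφ a hx hp hp'

theorem PhiP_of_len_eq_zero {K : Type} [Field K] {n : ℕ} (x : Fin n → K) (a : ℕ → K)
    (p : StrictPartition) (h : p.len = 0) : PhiP x a p = 1 := by
  obtain ⟨l, p, hp, hp'⟩ := p
  obtain rfl : l = 0 := h
  exact Phi_zero x _

theorem eq_zero_of_len_eq_zero {R K : Type} [CommRing R] [Field K] {ψ : R →+* K}
    (hψ : Function.Injective ψ) {n : ℕ} (x : Fin n → K) (a : ℕ → K) (v : StrictPartition →₀ R)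
    (hv : ∀ p ∈ v.support, p.len = 0) (h : (v.sum fun p c => ψ c * PhiP x a p) = 0) : v = 0 := by
  by_contra hne
  obtain ⟨p, hp⟩ := Finsupp.support_nonempty_iff.2 hne
  have h1 : v.support = {p} := Finset.eq_singleton_iff_unique_mem.2 ⟨hp, fun r hr =>
    StrictPartition.ext_entry ((hv r hr).trans (hv p hp).symm) fun i => by
      rw [entry, entry, dif_neg (by rw [hv r hr]; omega), dif_neg (by rw [hv p hp]; omega)]⟩
  rw [Finsupp.sum, h1, Finset.sum_singleton, PhiP_of_len_eq_zero x a p (hv p hp), mul_one] at h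
  exact Finsupp.mem_support_iff.1 hp (hψ (h.trans (map_zero ψ).symm))

theorem exists_generic_linearIndependent (R : Type) [CommRing R] [IsDomain R] [CharZero R]
    (a : ℕ → R) (n : ℕ) : ∃ (K : Type) (_ : Field K) (_ : CharZero K) (ψ : R →+* K)
      (x : Fin n → K), Function.Injective ψ ∧ Generic x ∧ ∀ v : StrictPartition →₀ R,
      (∀ p ∈ v.support, p.len ≤ n) →
      (v.sum fun p c => ψ c * PhiP x (fun k => ψ (a k)) p) = 0 → v = 0 := by
  classical
  induction n with
  | zero =>
    refine ⟨FractionRing R, inferInstance, inferInstance, algebraMap R (FractionRing R), Fin.elim0,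
      IsFractionRing.injective R (FractionRing R), ⟨fun i => i.elim0, fun i => i.elim0,
      fun i => i.elim0, fun i => i.elim0, fun i => i.elim0⟩, ?_⟩
    intro v hv h
    exact eq_zero_of_len_eq_zero (IsFractionRing.injective R (FractionRing R)) _ _ v
      (fun p hp => Nat.le_zero.1 (hv p hp)) h
  | succ n ih =>
    obtain ⟨K, _, _, ψ, x, hψ, hx, ih⟩ := ih
    let φ : PowerSeries K →+* FractionRing (PowerSeries K) := algebraMap _ _
    have hφ : Function.Injective φ := IsFractionRing.injective _ _
    refine ⟨FractionRing (PowerSeries K), inferInstance,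
      charZero_of_injective_ringHom (constL φ).injective, (constL φ).comp ψ, consTau φ x,
      (constL φ).injective.comp hψ, hx.consTau hφ, ?_⟩
    intro v hv h
    by_contra hne
    obtain ⟨r, hr, hmax⟩ := Finset.exists_max_image v.support (fun p => entry p.part 0)
      (Finsupp.support_nonempty_iff.2 hne)
    set N := entry r.part 0 with hN
    by_cases hr0 : r.len = 0
    · refine hne (eq_zero_of_len_eq_zero (ψ := (constL φ).comp ψ)
        ((constL φ).injective.comp hψ) _ _ v (fun p hp => ?_) h)
      by_contra hp0
      have h1 := (p.entry_pos hp0).trans_le (hmax p hp)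
      rw [hN, entry, dif_neg (by omega)] at h1
      exact lt_irrefl _ h1
    have hNpos : 0 < N := r.entry_pos hr0
    have hlen : ∀ p : StrictPartition, entry p.part 0 = N → p.len ≠ 0 := fun p hp h0 => by
      rw [entry, dif_neg (by omega)] at hp
      omega
    have hlead : ∀ p ∈ v.support, Lead φ N (((constL φ).comp ψ) (v p) *
        PhiP (consTau φ x) (fun k => ((constL φ).comp ψ) (a k)) p)
        (if entry p.part 0 = N then ψ (v p) * (2 * PhiP x (fun k => ψ (a k)) p.tail) else 0) := by
      intro p hp
      split_ifs with hpN
      · have h1 := (lead_const (φ := φ) (ψ (v p))).mul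
          (lead_PhiP hφ (fun k => ψ (a k)) hx p (hlen p hpN))
        rwa [hpN, zero_add] at h1
      · have hlt : entry p.part 0 < N := lt_of_le_of_ne (hmax p hp) hpN
        by_cases hp0 : p.len = 0
        · rw [PhiP_of_len_eq_zero _ _ p hp0, mul_one]
          exact (lead_const _).weaken hNpos
        · have h1 := (lead_const (φ := φ) (ψ (v p))).mul
            (lead_PhiP hφ (fun k => ψ (a k)) hx p hp0)
          rw [zero_add] at h1
          exact h1.weaken hlt
    have hsum := Lead.sum v.support hlead
    unfold Finsupp.sum at h
    rw [h] at hsum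
    have h0 := hsum.eq_zero hφ
    rw [← Finset.sum_filter] at h0
    let w := v.filter fun p => entry p.part 0 = N
    have hw : (w.mapDomain StrictPartition.tail).sum
        (fun p c => ψ c * PhiP x (fun k => ψ (a k)) p) = 0 := by
      rw [Finsupp.sum_mapDomain_index (by simp) (fun p c d => by rw [map_add, add_mul]),
        Finsupp.sum_filter_index, Finsupp.support_filter]
      have h2 : (2 : K) ≠ 0 := two_ne_zero
      refine (mul_eq_zero.1 ?_).resolve_left h2
      rw [← h0, Finset.mul_sum]
      exact Finset.sum_congr rfl fun p _ => by ring
    have hw0 := ih _ (fun p hp => by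
      obtain ⟨p', hp', rfl⟩ := Finset.mem_image.1 (Finsupp.mapDomain_support hp)
      rw [Finsupp.support_filter, Finset.mem_filter] at hp'
      have := hv p' hp'.1
      simp only [StrictPartition.tail]
      omega) hw
    have hinj : Set.InjOn StrictPartition.tail {p | entry p.part 0 = N} := by
      intro p hp p' hp' he
      have h1 := hlen p hp
      have h2 := hlen p' hp'
      have h3 : p.len - 1 = p'.len - 1 := congrArg StrictPartition.len he
      refine StrictPartition.ext_entry (by omega) fun i => ?_
      obtain _ | i := i
      · exact hp.trans hp'.symm
      · rw [← StrictPartition.entry_tail, ← StrictPartition.entry_tail, he]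
    have hw1 : w = 0 := Finsupp.mapDomain_injOn _ hinj
      (by
        intro p hp
        rw [Finset.mem_coe, Finsupp.support_filter, Finset.mem_filter] at hp
        exact hp.2)
      (by simp) (by rw [hw0, Finsupp.mapDomain_zero])
    have h3 := DFunLike.congr_fun hw1 r
    rw [Finsupp.filter_apply_pos (fun p : StrictPartition => entry p.part 0 = N) v rfl] at h3
    exact Finsupp.mem_support_iff.1 hr h3

/-- Symmetric functions that specialize to the symmetrizations of strict partitions are
linearly independent. -/
theorem linearIndependent_of_pr {R : Type} [CommRing R] [IsDomain R] [CharZero R] (a : ℕ → R)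
    (f : StrictPartition → SymFun R)
    (hf : ∀ (K : Type) [Field K] [CharZero K] [Algebra R K] (n : ℕ) (x : Fin n → K), Generic x →
      ∀ p, pr x (f p) = PhiP x (fun k => algebraMap R K (a k)) p) :
    LinearIndependent R f := by
  rw [linearIndependent_iff]
  intro v hv
  obtain ⟨K, _, _, ψ, x, hψ, hx, h⟩ := exists_generic_linearIndependent R a
    (v.support.sup StrictPartition.len)
  let : Algebra R K := ψ.toAlgebra
  refine h v (fun p hp => Finset.le_sup hp) ?_
  have h1 := congrArg (pr x) hv
  rw [Finsupp.linearCombination_apply, map_zero, Finsupp.sum, map_sum] at h1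
  rw [← h1]
  refine Finset.sum_congr rfl fun p _ => ?_
  rw [map_smul, hf K _ x hx, Algebra.smul_def]
  rfl

/-! ### Products of the functions `q_r` -/

section Monomials

variable (R : Type) [CommRing R]

/-- The product of the `q_r`, where `r` runs over a multiset. -/
def qProd (ν : Multiset ℕ) : SymFun R := (ν.map (q R)).prod

theorem q_zero : q R 0 = 1 := by
  refine Subtype.ext ?_
  ext m
  rw [coeff_q]
  change _ = MvPowerSeries.coeff m (1 : MvPowerSeries ℕ R)
  classical
  rw [MvPowerSeries.coeff_one]
  by_cases h : m = 0
  · simp [h]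
  · rw [if_neg h, if_neg fun h' => h ((Finsupp.degree_eq_zero_iff m).1 h')]

@[simp]
theorem qProd_cons (r : ℕ) (ν : Multiset ℕ) : qProd R (r ::ₘ ν) = q R r * qProd R ν := by
  simp [qProd]

theorem qProd_add (ν ρ : Multiset ℕ) : qProd R (ν + ρ) = qProd R ν * qProd R ρ := by
  simp [qProd]

theorem qGen_mul_rescale {F : Type} [Field F] {n : ℕ} (x : Fin n → F) :
    qGen x * PowerSeries.rescale (-1) (qGen x) = 1 := by
  rw [qGen, map_prod, ← Finset.prod_mul_distrib]
  refine Finset.prod_eq_one fun z _ => ?_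
  rw [← qSeries_mul_neg (pt x z)]
  congr 1
  ext k
  rw [PowerSeries.coeff_rescale, coeff_qSeries, coeff_qSeries, neg_pow (pt x z)]
  ring

/-- The relations between the functions `q_r`. -/
theorem sum_q_mul_q [IsDomain R] [CharZero R] {r : ℕ} (hr : r ≠ 0) :
    ∑ k ∈ Finset.range (2 * r + 1), (-1) ^ (2 * r - k) * (q R k * q R (2 * r - k)) = 0 := by
  refine eq_zero_of_proj (N := 0) fun n _ => ?_
  have h := congrArg (PowerSeries.coeff (2 * r)) (qGen_mul_rescale (RF.x R n))
  rw [PowerSeries.coeff_mul, Finset.Nat.sum_antidiagonal_eq_sum_range_succ_mk,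
    PowerSeries.coeff_one, if_neg (by omega)] at h
  rw [proj_eq_pr, map_sum, ← h]
  refine Finset.sum_congr rfl fun k _ => ?_
  simp only [map_mul, map_pow, map_neg, map_one, pr_q, PowerSeries.coeff_rescale]
  ring

end Monomials

theorem neg_one_pow_mul_self (A : Type) [CommRing A] (r : ℕ) : (-1 : A) ^ r * (-1) ^ r = 1 := by
  rw [← mul_pow, neg_one_mul, neg_neg, one_pow]

theorem sum_sq_le (ν : Multiset ℕ) : (ν.map fun r => r * r).sum ≤ ν.sum * ν.sum := by
  induction ν using Multiset.induction_on with
  | empty => simp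
  | cons a ν ih =>
    simp only [Multiset.map_cons, Multiset.sum_cons]
    calc a * a + (ν.map fun r => r * r).sum ≤ a * a + ν.sum * ν.sum := Nat.add_le_add_left ih _
      _ ≤ a * a + ν.sum * ν.sum + 2 * (a * ν.sum) := Nat.le_add_right _ _
      _ = (a + ν.sum) * (a + ν.sum) := by ring

/-- The span of the products of the `q_r` over sets of positive integers with sum at most `d`. -/
def strictSpan (d : ℕ) : Submodule ℚ (SymFun ℚ) :=
  Submodule.span ℚ {f | ∃ ν : Multiset ℕ, ν.Nodup ∧ 0 ∉ ν ∧ ν.sum ≤ d ∧ f = qProd ℚ ν}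

theorem qProd_mem_strictSpan {d : ℕ} (N : ℕ) : ∀ ν : Multiset ℕ, ν.sum ≤ d →
    ν.sum * ν.sum - (ν.map fun r => r * r).sum + ν.card ≤ N → qProd ℚ ν ∈ strictSpan d := by
  induction N with
  | zero =>
    intro ν _ h
    have h0 : ν = 0 := Multiset.card_eq_zero.1 (by omega)
    exact Submodule.subset_span ⟨ν, by simp [h0], by simp [h0], by simp [h0], rfl⟩
  | succ N ih =>
    intro ν hd hN
    by_cases h0 : 0 ∈ ν
    · obtain ⟨ρ, rfl⟩ := Multiset.exists_cons_of_mem h0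
      rw [qProd_cons, q_zero, one_mul]
      simp only [Multiset.sum_cons, zero_add, Multiset.map_cons, mul_zero,
        Multiset.card_cons] at hd hN
      exact ih ρ hd (by omega)
    by_cases hnd : ν.Nodup
    · exact Submodule.subset_span ⟨ν, hnd, h0, hd, rfl⟩
    rw [Multiset.nodup_iff_ne_cons_cons] at hnd
    push Not at hnd
    obtain ⟨r, ρ, rfl⟩ := hnd
    have hr : r ≠ 0 := fun h => h0 (by simp [h])
    have hrel := congrArg (fun f => f * qProd ℚ ρ) (sum_q_mul_q ℚ hr)
    simp only [zero_mul] at hrel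
    rw [Finset.sum_mul, ← Finset.add_sum_erase _ _
      (Finset.mem_range.2 (by omega : r < 2 * r + 1))] at hrel
    have hmem : ∀ k ∈ (Finset.range (2 * r + 1)).erase r,
        (-1) ^ (2 * r - k) * (q ℚ k * q ℚ (2 * r - k)) * qProd ℚ ρ ∈ strictSpan d := by
      intro k hk
      obtain ⟨hkr, hk⟩ := Finset.mem_erase.1 hk
      rw [Finset.mem_range] at hk
      obtain ⟨m, hm⟩ : ∃ m, 2 * r = k + m := ⟨2 * r - k, by omega⟩
      have h1 : qProd ℚ (k ::ₘ m ::ₘ ρ) ∈ strictSpan d := by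
        have hsum : (k ::ₘ m ::ₘ ρ).sum = (r ::ₘ r ::ₘ ρ).sum := by
          simp only [Multiset.sum_cons]; omega
        refine ih _ (by rw [hsum]; exact hd) ?_
        have h2 := sum_sq_le (k ::ₘ m ::ₘ ρ)
        rw [hsum] at h2 ⊢
        simp only [Multiset.map_cons, Multiset.sum_cons, Multiset.card_cons] at hN h2 ⊢
        have h3 : r * r + r * r < k * k + m * m := by
          zify at hm hkr ⊢
          have : (m : ℤ) = 2 * r - k := by omega
          rw [this]
          have : (k - r : ℤ) ≠ 0 := sub_ne_zero.2 hkr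
          have := sq_pos_of_ne_zero this
          nlinarith
        omega
      have h2 : (-1) ^ (2 * r - k) * (q ℚ k * q ℚ (2 * r - k)) * qProd ℚ ρ =
          ((-1) ^ (2 * r - k) : ℤ) • qProd ℚ (k ::ₘ m ::ₘ ρ) := by
        rw [qProd_cons, qProd_cons, show 2 * r - k = m by omega, zsmul_eq_mul]
        push_cast
        ring
      rw [h2]
      exact zsmul_mem h1 _
    have h1 : qProd ℚ (r ::ₘ r ::ₘ ρ) = ((-1) ^ r : ℤ) • -∑ k ∈ (Finset.range (2 * r + 1)).erase r,
        (-1) ^ (2 * r - k) * (q ℚ k * q ℚ (2 * r - k)) * qProd ℚ ρ := by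
      rw [← eq_neg_of_add_eq_zero_left hrel, qProd_cons, qProd_cons, show 2 * r - r = r by omega,
        zsmul_eq_mul]
      push_cast
      linear_combination -(q ℚ r * (q ℚ r * qProd ℚ ρ)) * neg_one_pow_mul_self (SymFun ℚ) r
    rw [h1]
    exact zsmul_mem (neg_mem (sum_mem hmem)) _

/-! ### The degree filtration -/

/-- The span of the products of the `q_r` of degree at most `d`. -/
def qFil (d : ℕ) : Submodule ℚ (SymFun ℚ) :=
  Submodule.span ℚ {f | ∃ ν : Multiset ℕ, ν.sum ≤ d ∧ f = qProd ℚ ν}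

theorem qProd_mem_qFil {ν : Multiset ℕ} {d : ℕ} (h : ν.sum ≤ d) : qProd ℚ ν ∈ qFil d :=
  Submodule.subset_span ⟨ν, h, rfl⟩

theorem qFil_le_strictSpan (d : ℕ) : qFil d ≤ strictSpan d := by
  refine Submodule.span_le.2 ?_
  rintro _ ⟨ν, h, rfl⟩
  exact qProd_mem_strictSpan _ ν h le_rfl

theorem qFil_mono {d e : ℕ} (h : d ≤ e) : qFil d ≤ qFil e :=
  Submodule.span_mono fun _ ⟨ν, hν, hf⟩ => ⟨ν, hν.trans h, hf⟩

theorem mul_mem_qFil {d e : ℕ} {f g : SymFun ℚ} (hf : f ∈ qFil d) (hg : g ∈ qFil e) :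
    f * g ∈ qFil (d + e) := by
  have h : qFil d * qFil e ≤ qFil (d + e) := by
    rw [qFil, qFil, Submodule.span_mul_span]
    refine Submodule.span_le.2 ?_
    rintro _ ⟨_, ⟨ν, hν, rfl⟩, _, ⟨ρ, hρ, rfl⟩, rfl⟩
    change qProd ℚ ν * qProd ℚ ρ ∈ qFil (d + e)
    rw [← qProd_add]
    exact qProd_mem_qFil (by rw [Multiset.sum_add]; omega)
  exact h (Submodule.mul_mem_mul hf hg)

theorem prod_mem_qFil {ι : Type} (s : Finset ι) {d : ι → ℕ} {f : ι → SymFun ℚ}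
    (h : ∀ i ∈ s, f i ∈ qFil (d i)) : ∏ i ∈ s, f i ∈ qFil (∑ i ∈ s, d i) := by
  classical
  induction s using Finset.induction_on with
  | empty => simpa [qProd] using qProd_mem_qFil (ν := 0) (d := 0) (by simp)
  | insert a s ha ih =>
    rw [Finset.prod_insert ha, Finset.sum_insert ha]
    exact mul_mem_qFil (h a (by simp)) (ih fun i hi => h i (by simp [hi]))

theorem q_mem_qFil (r : ℕ) : q ℚ r ∈ qFil r := by
  have := qProd_mem_qFil (ν := {r}) (d := r) (by simp)
  simpa [qProd] using this

theorem qOdd_mem_qFil {e : ℤ} {d : ℕ} (h : e.natAbs ≤ d) : qOdd ℚ e ∈ qFil d := by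
  rw [qOdd]
  split_ifs
  · exact qFil_mono (by omega) (q_mem_qFil _)
  · exact neg_mem (qFil_mono (by omega) (q_mem_qFil _))
  · exact zero_mem _

theorem uEntry_mem_qFil (r s : ℕ) : uEntry ℚ r s ∈ qFil (r + s) := by
  rw [uEntry]
  split_ifs
  · exact qFil_mono (by omega) (q_mem_qFil _)
  · refine sum_mem fun c hc => ?_
    rw [Finset.HasAntidiagonal.mem_antidiagonal] at hc
    refine qFil_mono (d := c.1 + (r + c.2)) (by omega) (mul_mem_qFil (q_mem_qFil _) ?_)
    refine sum_mem fun d hd => zsmul_mem ?_ _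
    rw [Finset.HasAntidiagonal.mem_antidiagonal] at hd
    exact qOdd_mem_qFil (by omega)

theorem sum_entry_le {l : ℕ} (p : Fin l → ℕ) (m : ℕ) : ∑ j : Fin m, entry p j ≤ ∑ i, p i := by
  have h1 : ∑ i, p i = ∑ i ∈ Finset.range l, entry p i := by
    rw [← Fin.sum_univ_eq_sum_range]
    exact Finset.sum_congr rfl fun i _ => by simp [entry]
  rw [Fin.sum_univ_eq_sum_range (entry p), h1,
    ← Finset.sum_subset (Finset.inter_subset_left : Finset.range m ∩ Finset.range l ⊆ _)]
  · exact Finset.sum_le_sum_of_subset Finset.inter_subset_right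
  · intro i hi hi'
    rw [entry, dif_neg]
    exact fun h => hi' (Finset.mem_inter.2 ⟨hi, Finset.mem_range.2 h⟩)

theorem univQ_mem_qFil {l : ℕ} (p : Fin l → ℕ) : univQ ℚ p ∈ qFil (∑ i, p i) := by
  rw [univQ, pfaffian]
  refine Submodule.smul_mem _ _ (sum_mem fun s _ => zsmul_mem ?_ _)
  have hM : ∀ i j : Fin (2 * ((l + 1) / 2)),
      skewMatrix p (uEntry ℚ) i j ∈ qFil (entry p i + entry p j) := by
    intro i j
    rw [skewMatrix, Matrix.of_apply]
    split_ifs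
    · exact uEntry_mem_qFil _ _
    · rw [add_comm]
      exact neg_mem (uEntry_mem_qFil _ _)
    · exact zero_mem _
  refine qFil_mono ?_ (prod_mem_qFil Finset.univ fun i _ => hM _ _)
  refine le_trans (le_of_eq ?_) (sum_entry_le p (2 * ((l + 1) / 2)))
  rw [← Equiv.sum_comp s fun j => entry p j]
  exact (sum_fin_even fun j => entry p (s j)).symm

/-! ### Strict partitions as finite sets -/

/-- The strict partition with a given set of parts. -/
def StrictPartition.ofFinset (s : Finset ℕ) (hs : 0 ∉ s) : StrictPartition where
  len := s.card
  part i := s.orderEmbOfFin rfl i.rev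
  strictAnti _ _ h := (s.orderEmbOfFin rfl).strictMono (Fin.rev_lt_rev.2 h)
  pos _ := Nat.pos_of_ne_zero fun h => hs (h ▸ s.orderEmbOfFin_mem rfl _)

theorem StrictPartition.range_ofFinset (s : Finset ℕ) (hs : 0 ∉ s) :
    Set.range (ofFinset s hs).part = s := by
  change Set.range (s.orderEmbOfFin rfl ∘ Fin.rev) = s
  rw [Fin.rev_surjective.range_comp, Finset.range_orderEmbOfFin]

theorem StrictPartition.sum_ofFinset (s : Finset ℕ) (hs : 0 ∉ s) :
    ∑ i, (ofFinset s hs).part i = ∑ r ∈ s, r := by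
  refine Finset.sum_bij (fun i _ => (ofFinset s hs).part i) ?_ ?_ ?_ (fun _ _ => rfl)
  · intro i _
    rw [← Finset.mem_coe, ← range_ofFinset s hs]
    exact ⟨i, rfl⟩
  · intro i _ j _ h
    exact (ofFinset s hs).strictAnti.injective h
  · intro r hr
    rw [← Finset.mem_coe, ← range_ofFinset s hs] at hr
    obtain ⟨i, hi⟩ := hr
    exact ⟨i, Finset.mem_univ _, hi⟩

/-- The finite sets of positive integers with sum at most `d`. -/
def strictSets (d : ℕ) : Finset (Finset ℕ) :=
  (Finset.Icc 1 d).powerset.filter fun s => ∑ r ∈ s, r ≤ d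

theorem zero_notMem_of_mem_strictSets {d : ℕ} {s : Finset ℕ} (h : s ∈ strictSets d) : 0 ∉ s := by
  intro h0
  have := (Finset.mem_powerset.1 (Finset.mem_filter.1 h).1) h0
  simp at this

open Classical in
theorem strictSpan_le (d : ℕ) : strictSpan d ≤
    Submodule.span ℚ (((strictSets d).image fun s => qProd ℚ s.val : Finset (SymFun ℚ)) :
      Set (SymFun ℚ)) := by
  refine Submodule.span_le.2 ?_
  rintro _ ⟨ν, hν, h0, hd, rfl⟩
  refine Submodule.subset_span ?_
  rw [Finset.coe_image]
  refine ⟨⟨ν, hν⟩, ?_, rfl⟩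
  rw [Finset.mem_coe, strictSets, Finset.mem_filter, Finset.mem_powerset]
  have hsum : ∑ r ∈ (⟨ν, hν⟩ : Finset ℕ), r = ν.sum := by
    rw [Finset.sum_eq_multiset_sum]; simp
  refine ⟨fun r hr => ?_, hsum.trans_le hd⟩
  have hr' : r ∈ ν := hr
  rw [Finset.mem_Icc]
  exact ⟨Nat.one_le_iff_ne_zero.2 fun h => h0 (h ▸ hr'), (Multiset.le_sum_of_mem hr').trans hd⟩

theorem linearIndependent_univQ :
    LinearIndependent ℚ fun p : StrictPartition => univQ ℚ p.part := by
  refine linearIndependent_of_pr (fun _ => (0 : ℚ)) _ ?_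
  intro K _ _ _ n x hx p
  rw [pr_univQ hx p.pos, PhiP]
  simp only [map_zero, facMonomial_zero]

theorem qFil_le_span (d : ℕ) :
    qFil d ≤ Submodule.span ℚ (Set.range fun p : StrictPartition => univQ ℚ p.part) := by
  classical
  let f : strictSets d → SymFun ℚ := fun s =>
    univQ ℚ (StrictPartition.ofFinset s.1 (zero_notMem_of_mem_strictSets s.2)).part
  have hf : LinearIndependent ℚ f := by
    refine linearIndependent_univQ.comp (fun s : strictSets d =>
      StrictPartition.ofFinset s.1 (zero_notMem_of_mem_strictSets s.2)) ?_
    intro s s' h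
    refine Subtype.ext (Finset.coe_injective ?_)
    rw [← StrictPartition.range_ofFinset s.1 (zero_notMem_of_mem_strictSets s.2),
      ← StrictPartition.range_ofFinset s'.1 (zero_notMem_of_mem_strictSets s'.2)]
    exact congrArg (fun p : StrictPartition => Set.range p.part) h
  have hle : Submodule.span ℚ (Set.range f) ≤ qFil d := by
    refine Submodule.span_le.2 ?_
    rintro _ ⟨s, rfl⟩
    refine qFil_mono ?_ (univQ_mem_qFil _)
    rw [StrictPartition.sum_ofFinset]
    exact (Finset.mem_filter.1 s.2).2
  let B : Finset (SymFun ℚ) := (strictSets d).image fun s => qProd ℚ s.val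
  have hB : qFil d ≤ Submodule.span ℚ (B : Set (SymFun ℚ)) :=
    (qFil_le_strictSpan d).trans (strictSpan_le d)
  have hfin : FiniteDimensional ℚ (Submodule.span ℚ (B : Set (SymFun ℚ))) :=
    FiniteDimensional.span_finset ℚ B
  have hcard : Module.finrank ℚ (Submodule.span ℚ (B : Set (SymFun ℚ))) ≤
      Module.finrank ℚ (Submodule.span ℚ (Set.range f)) := by
    rw [finrank_span_eq_card hf, Fintype.card_coe]
    exact (finrank_span_finset_le_card B).trans Finset.card_image_le
  have heq := Submodule.eq_of_le_of_finrank_le (hle.trans hB) hcard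
  refine hB.trans (heq.symm.le.trans (Submodule.span_mono ?_))
  rintro _ ⟨s, rfl⟩
  exact ⟨_, rfl⟩

/-! ### The basis of `Γ` -/

theorem baseChange_qProd (R : Type) [CommRing R] [Algebra ℚ R] (ν : Multiset ℕ) :
    SymFun.baseChange R (qProd ℚ ν) = qProd R ν := by
  rw [qProd, map_multiset_prod, Multiset.map_map, qProd]
  congr 2
  funext r
  exact baseChange_q R r

theorem baseChange_smul (R : Type) [CommRing R] [Algebra ℚ R] (c : ℚ) (f : SymFun ℚ) :
    SymFun.baseChange R (c • f) = algebraMap ℚ R c • SymFun.baseChange R f := by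
  refine Subtype.ext ?_
  ext m
  change algebraMap ℚ R (c * MvPowerSeries.coeff m f.1) =
    algebraMap ℚ R c * algebraMap ℚ R (MvPowerSeries.coeff m f.1)
  rw [map_mul]

theorem baseChange_mem_of_mem_span {R : Type} [CommRing R] [Algebra ℚ R] {S : Set (SymFun ℚ)}
    {M : Submodule R (SymFun R)} (h : ∀ f ∈ S, SymFun.baseChange R f ∈ M) {f : SymFun ℚ}
    (hf : f ∈ Submodule.span ℚ S) : SymFun.baseChange R f ∈ M := by
  induction hf using Submodule.span_induction with
  | mem f hf => exact h f hf
  | zero => rw [map_zero]; exact M.zero_mem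
  | add f g _ _ hf hg => rw [map_add]; exact M.add_mem hf hg
  | smul c f _ hf => rw [baseChange_smul]; exact M.smul_mem _ hf

theorem qProd_mem_Gam (R : Type) [CommRing R] (ν : Multiset ℕ) : qProd R ν ∈ Gam R := by
  refine multiset_prod_mem _ fun f hf => ?_
  obtain ⟨r, -, rfl⟩ := Multiset.mem_map.1 hf
  rcases Nat.eq_zero_or_pos r with rfl | hr
  · rw [q_zero]; exact one_mem _
  · exact Algebra.subset_adjoin ⟨r, hr, rfl⟩

theorem univQ_mem_Gam (R : Type) [CommRing R] [Algebra ℚ R] {l : ℕ} (p : Fin l → ℕ) :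
    univQ R p ∈ Subalgebra.toSubmodule (Gam R) := by
  rw [← baseChange_univQ]
  refine baseChange_mem_of_mem_span ?_ (univQ_mem_qFil p)
  rintro _ ⟨ν, -, rfl⟩
  rw [baseChange_qProd]
  exact qProd_mem_Gam R ν

theorem Gam_le_span (R : Type) [CommRing R] [Algebra ℚ R] :
    Subalgebra.toSubmodule (Gam R) ≤
      Submodule.span R (Set.range fun p : StrictPartition => univQ R p.part) := by
  rw [Gam, Algebra.adjoin_eq_span]
  refine Submodule.span_le.2 fun f hf => ?_
  obtain ⟨ν, rfl⟩ : ∃ ν, f = qProd R ν := by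
    induction hf using Submonoid.closure_induction with
    | mem f hf =>
      obtain ⟨r, -, rfl⟩ := hf
      exact ⟨{r}, by simp [qProd]⟩
    | one => exact ⟨0, by simp [qProd]⟩
    | mul f g _ _ hf hg =>
      obtain ⟨ν, rfl⟩ := hf
      obtain ⟨ρ, rfl⟩ := hg
      exact ⟨ν + ρ, (qProd_add R ν ρ).symm⟩
  rw [← baseChange_qProd]
  refine baseChange_mem_of_mem_span ?_ (qFil_le_span _ (qProd_mem_qFil (ν := ν) le_rfl))
  rintro _ ⟨p, rfl⟩
  rw [baseChange_univQ]
  exact Submodule.subset_span ⟨p, rfl⟩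

theorem dCoeff_self {l : ℕ} {p : Fin l → ℕ} (hp : StrictAnti p) : dCoeff p p = 1 := by
  rw [dCoeff, Matrix.det_of_isUpperTriangular]
  · simp [elemA]
  · intro i j hij
    rw [Matrix.of_apply, if_neg]
    exact not_le.2 (hp hij)

theorem univQ_mem_span_univFacQ (N : ℕ) : ∀ p : StrictPartition, ∑ i, p.part i ≤ N →
    univQ Qa p.part ∈
      Submodule.span Qa (Set.range fun p : StrictPartition => univFacQ p.part) := by
  induction N using Nat.strong_induction_on with
  | _ N ih =>
    intro p hN
    have hmem : p.part ∈ subPartitions p.part :=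
      mem_subPartitions.2 ⟨fun i => ⟨p.pos i, le_rfl⟩, p.strictAnti⟩
    have h := univFacQ_eq p.part
    rw [← Finset.add_sum_erase _ _ hmem, dCoeff_self p.strictAnti, one_smul] at h
    rw [← sub_eq_iff_eq_add.2 h]
    refine Submodule.sub_mem _ (Submodule.subset_span ⟨p, rfl⟩)
      (Submodule.sum_mem _ fun m hm => Submodule.smul_mem _ _ ?_)
    obtain ⟨hne, hm⟩ := Finset.mem_erase.1 hm
    rw [mem_subPartitions] at hm
    have hlt : ∑ i, m i < ∑ i, p.part i := by
      obtain ⟨i, hi⟩ := Function.ne_iff.1 hne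
      exact Finset.sum_lt_sum (fun i _ => (hm.1 i).2)
        ⟨i, Finset.mem_univ i, lt_of_le_of_ne (hm.1 i).2 hi⟩
    exact ih _ (hlt.trans_le hN) ⟨p.len, m, hm.2, fun i => (hm.1 i).1⟩ le_rfl

theorem linearIndependent_univFacQ :
    LinearIndependent Qa fun p : StrictPartition => univFacQ p.part :=
  linearIndependent_of_pr (fun k => (MvPolynomial.X k : Qa)) _ fun _ _ _ _ _ _ hx p =>
    pr_univFacQ hx p.strictAnti

theorem span_univFacQ :
    Submodule.span Qa (Set.range fun p : StrictPartition => univFacQ p.part) =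
      Subalgebra.toSubmodule (Gam Qa) := by
  refine le_antisymm (Submodule.span_le.2 ?_) ((Gam_le_span Qa).trans (Submodule.span_le.2 ?_))
  · rintro _ ⟨p, rfl⟩
    simp only [univFacQ_eq]
    exact Submodule.sum_mem _ fun m _ => Submodule.smul_mem _ _ (univQ_mem_Gam Qa m)
  · rintro _ ⟨p, rfl⟩
    exact univQ_mem_span_univFacQ _ p le_rfl

end SymplecticQ

end

theorem mainTheorem5 :
    -- the universal symplectic functions are well defined
    (∀ p : SymplecticQ.StrictPartition,
      (∀ n : ℕ, SymplecticQ.proj ℚ n (SymplecticQ.univSympQ p.part) =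
        SymplecticQ.facSympQ n (fun _ => (0 : ℚ)) p.part) ∧
      ∀ f : SymplecticQ.SymFun ℚ,
        (∀ n : ℕ, p.len ≤ n → SymplecticQ.proj ℚ n f =
          SymplecticQ.facSympQ n (fun _ => (0 : ℚ)) p.part) →
        f = SymplecticQ.univSympQ p.part) ∧
    -- (1)
    (∀ p : SymplecticQ.StrictPartition,
      (∀ n : ℕ, SymplecticQ.proj SymplecticQ.Qa n (SymplecticQ.univFacQ p.part) =
        SymplecticQ.facSympQ n (fun k => (MvPolynomial.X k : SymplecticQ.Qa)) p.part) ∧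
      ∀ f : SymplecticQ.SymFun SymplecticQ.Qa,
        (∀ n : ℕ, p.len ≤ n → SymplecticQ.proj SymplecticQ.Qa n f =
          SymplecticQ.facSympQ n (fun k => (MvPolynomial.X k : SymplecticQ.Qa)) p.part) →
        f = SymplecticQ.univFacQ p.part) ∧
    -- (2)
    (∀ p : SymplecticQ.StrictPartition,
      SymplecticQ.univFacQ p.part =
        SymplecticQ.pfaffian (SymplecticQ.schurMatrix p.part)) ∧
    -- (3)
    (LinearIndependent SymplecticQ.Qa
        (fun p : SymplecticQ.StrictPartition => SymplecticQ.univFacQ p.part) ∧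
      Submodule.span SymplecticQ.Qa
        (Set.range fun p : SymplecticQ.StrictPartition => SymplecticQ.univFacQ p.part) =
        Subalgebra.toSubmodule (SymplecticQ.Gam SymplecticQ.Qa)) := by
  refine ⟨fun p => ⟨fun n => ?_, fun f hf => ?_⟩, fun p => ⟨fun n => ?_, fun f hf => ?_⟩,
    fun p => ?_, SymplecticQ.linearIndependent_univFacQ, SymplecticQ.span_univFacQ⟩
  · rw [SymplecticQ.univSympQ_eq p.pos p.strictAnti.injective]
    exact SymplecticQ.proj_univQ p.pos p.strictAnti.injective n
  · refine SymplecticQ.eq_of_proj (N := p.len) fun n hn => ?_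
    rw [hf n hn, SymplecticQ.univSympQ_eq p.pos p.strictAnti.injective]
    exact (SymplecticQ.proj_univQ p.pos p.strictAnti.injective n).symm
  · exact SymplecticQ.proj_univFacQ p.pos p.strictAnti n
  · refine SymplecticQ.eq_of_proj (N := p.len) fun n hn => ?_
    rw [hf n hn, SymplecticQ.proj_univFacQ p.pos p.strictAnti n]
  · exact SymplecticQ.univFacQ_eq_pfaffian p.pos p.strictAnti
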